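/- **Setting.** Let $d\ge 3$, let $P$ be the law of $(X,Y)\in\mathbb R^d\times\mathcal Y$, $\mathcal Y\subseteq\mathbb R$, with $\mathbb E\|X\|_2^4$, $\mathbb E\|YX\|_2^2$, $\mathbb E|Y|^2<\infty$. Let $\ell(z,y)$ be a loss that is convex in $z\in\mathbb R$ for each $y\in\mathcal Y$, with derivative in $z$ (any measurable choice of subgradient where it is not differentiable) $\ell'(z,y)$, and with $|\ell(z,y)|\le C_1+C_2|z-y|^2$, $|\ell'(z,y)|\le C_1'+C_2'|z-y|$ for some positive constants. Put $\mathcal L(\theta)=\mathbb E[\ell(\langle\theta,X\rangle,Y)]$. Fix $\theta_0\in\mathbb R^d$, $R>0$ and an integer $\bar s\ge1$; write $B_r=\{\theta:\|\theta-\theta_0\|_1\le r\}$. Let $\theta^\star\in B_R$ have at most $\bar s$ nonzero coordinates and minimize $\mathcal L$ over $B_{3R}$, and suppose that for constants $M,\kappa,\lambda>0$ and all $\theta,\theta'\in B_{3R}$ $$\mathcal L(\theta)-\mathcal L(\theta')\le M\|\theta-\theta'\|_1,\qquad \mathcal L(\theta)-\mathcal L(\theta^\star)\ge\frac{\kappa\|\theta-\theta^\star\|_2^2}{\lambda+\|\theta-\theta^\star\|_2}.$$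 Let $\sigma_{\max}^2=\sup_{\theta\in B_{3R}}\max_{j\le d}\mathrm{Var}(\ell'(\langle\theta,X\rangle,Y)X^j)$ and assume $\sigma_{\max}>0$. **Data.** Let $K\ge1$ be the number of stages, $T'$ the number of iterations per stage, $T=KT'$, $\delta\in(0,1)$, $\tilde\delta=\delta/T$, $\eta\ge0$. The $n=T\tilde n$ data points, $\tilde n>0$ even, are split into $T$ batches of size $\tilde n$. The index set is partitioned into inliers and outliers; each batch holds at most $\eta\tilde n$ outliers; the inliers are i.i.d. with law $P$; the outliers are arbitrary random points, except that the inliers of each batch are independent of all the data of the preceding batches. **Gradient estimator.** Iteration $t$ uses batch $t$ only. With its points $(X_i,Y_i)$, the $j$-th coordinate of $\hat g(\theta)$ is $\mathrm{TM}_\alpha$ applied to $\ell'(\langle\theta,X_i\rangle,Y_i)X_i^j$, $i\le\tilde n$, where $$\mathrm{TM}_\alpha(x_1,\dots,x_{\tilde n})=\frac2{\tilde n}\sum_{i=\tilde n/2+1}^{\tilde n}q_\alpha\vee x_i\wedge q_{1-\alpha},$$ $q_\beta=x^{(\lfloor\beta\tilde n/2\rfloor)}$ are order statistics of $x_1,\dots,x_{\tilde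 n/2}$, and $\alpha=8\eta+12\frac{\log(4/\tilde\delta)+\log d}{\tilde n}$ is assumed to be less than $1/2$. **Constants.** Let $$\bar\epsilon=7\sigma_{\max}\sqrt{4\eta+6\,\tfrac{\log(4/\tilde\delta)+\log d}{\tilde n}},\quad \tau=\frac{10\sqrt{8\bar s}\,\bar\epsilon}{\kappa},\quad R^\star=\frac{80\lambda\bar s\bar\epsilon}{\kappa},\quad \nu=\tfrac12e^2\log d,$$ and assume $\tau<1$, $R^\star\le R$ and $T'\ge\lceil((\nu+M^2)/\bar\epsilon)^2\rceil$. Let $R_0=R$ and $R_{k+1}=\max(\tau R_k,\tfrac12(R_k+R^\star))$. **Algorithm (AMDA).** Let $\omega(\theta)=\tfrac12e\log(d)\,d^{(p-1)(2-p)/p}\|\theta\|_p^2$ with $p=1+1/\log d$. Put $\theta^{(0)}=\theta_0$. In stage $k=1,\dots,K$, put $\Theta_k=\{\theta:\|\theta-\theta^{(k-1)}\|_1\le R_{k-1}\}$ and run dual averaging on $\Theta_k$ from $\vartheta_0=\theta^{(k-1)}$ with steps $a_i=R_{k-1}$ and scalings $\gamma_i=\sqrt{i+1}$: with $A_t=\sum_{i\le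 t}a_i$, $$\vartheta_t^+=\arg\min_{\theta\in\Theta_k}\Big\langle\sum_{i\le t}a_i\hat g(\vartheta_i),\theta\Big\rangle+\gamma_t\,\omega(\theta-\theta^{(k-1)}),\qquad \vartheta_{t+1}=\Big(1-\frac{a_{t+1}}{A_{t+1}}\Big)\vartheta_t+\frac{a_{t+1}}{A_{t+1}}\vartheta_t^+ .$$ Let $\theta^{(k)}$ be an $\ell_1$-closest vector to $\vartheta_{T'}$ among those with at most $\bar s$ nonzero coordinates (ties broken by a fixed measurable rule). The output is $\hat\theta=\theta^{(K)}$. **Claim.** There is a first index $K_1\ge0$ with $\tau R_{K_1}\le\frac12(R_{K_1}+R^\star)$. It satisfies $$K_1\le\log\Big(\frac{\kappa R}{80\lambda\bar s\bar\epsilon}\Big)\Big/\log(1/\tau),$$ and with probability at least $1-\delta$, $$\|\hat\theta-\theta^\star\|_2\le\tau^{K\wedge K_1}\,2^{(K_1-K)\wedge0}\,\frac{R}{\sqrt{2\bar s}}+\frac{280\lambda\sqrt{2\bar s}\,\sigma_{\max}}{\kappa}\sqrt{4\eta+6\,\frac{\log(4/\tilde\delta)+\log d}{\tilde n}}.$$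 -/

import Mathlib

open MeasureTheory ProbabilityTheory

namespace AMDA

noncomputable section

/-- Parameters and covariates: `ℝ^d`, with its Euclidean norm `‖·‖`. -/
abbrev Vec (d : ℕ) := EuclideanSpace ℝ (Fin d)

/-- The norm `‖v‖₁`. -/
def l1Norm {d : ℕ} (v : Vec d) : ℝ := ∑ j, |v j|

/-- The closed `ℓ₁` ball. -/
def l1Ball {d : ℕ} (c : Vec d) (r : ℝ) : Set (Vec d) := {θ | l1Norm (θ - c) ≤ r}

/-- The norm `‖v‖_p`. -/
def lpNorm {d : ℕ} (p : ℝ) (v : Vec d) : ℝ := (∑ j, |v j| ^ p) ^ (1 / p)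

/-- Number of nonzero coordinates. -/
def nnz {d : ℕ} (v : Vec d) : ℕ := (Finset.univ.filter fun j => v j ≠ 0).card

/-- `H` maps every vector to an `ℓ₁`-closest `sbar`-sparse vector (ties are broken by any fixed
measurable rule). -/
structure IsSparsifier {d : ℕ} (sbar : ℕ) (H : Vec d → Vec d) : Prop where
  measurable : Measurable H
  sparse : ∀ θ, nnz (H θ) ≤ sbar
  closest : ∀ θ v, nnz v ≤ sbar → l1Norm (H θ - θ) ≤ l1Norm (v - θ)

/-! ### Loss, objective and gradient samples -/

/-- The loss `ℓ(z, y)` (prediction `z ∈ ℝ`, label `y ∈ 𝒴`) is convex in `z`, `ℓ'` is its derivative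
in `z` (a subgradient where `ℓ(·, y)` is not differentiable), and both satisfy the growth
conditions. -/
structure IsAdmissibleLoss (𝒴 : Set ℝ) (ℓ ℓ' : ℝ → ℝ → ℝ) : Prop where
  measurable : Measurable (Function.uncurry ℓ)
  measurable_deriv : Measurable (Function.uncurry ℓ')
  convex : ∀ y ∈ 𝒴, ConvexOn ℝ Set.univ fun z => ℓ z y
  subgradient : ∀ y ∈ 𝒴, ∀ z z', ℓ z y + ℓ' z y * (z' - z) ≤ ℓ z' y
  growth : ∃ C₁ C₂ : ℝ, 0 < C₁ ∧ 0 < C₂ ∧ ∀ z, ∀ y ∈ 𝒴, |ℓ z y| ≤ C₁ + C₂ * |z - y| ^ 2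
  growth_deriv : ∃ C₁ C₂ : ℝ, 0 < C₁ ∧ 0 < C₂ ∧ ∀ z, ∀ y ∈ 𝒴, |ℓ' z y| ≤ C₁ + C₂ * |z - y|

/-- The moment conditions on the law `P` of `(X, Y)`, with labels in `𝒴`. -/
structure HasMoments {d : ℕ} (𝒴 : Set ℝ) (P : Measure (Vec d × ℝ)) : Prop where
  label_mem : ∀ᵐ z ∂P, z.2 ∈ 𝒴
  covariate : Integrable (fun z => ‖z.1‖ ^ 4) P
  product : Integrable (fun z => ‖z.2 • z.1‖ ^ 2) P
  label : Integrable (fun z => |z.2| ^ 2) P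

/-- The objective `𝓛(θ) = 𝔼[ℓ(⟨θ, X⟩, Y)]`. -/
def risk {d : ℕ} (ℓ : ℝ → ℝ → ℝ) (P : Measure (Vec d × ℝ)) (θ : Vec d) : ℝ :=
  ∫ z, ℓ (inner ℝ θ z.1) z.2 ∂P

/-- The gradient sample `ℓ'(⟨θ, x⟩, y) x` at the data point `z = (x, y)`. -/
def gradSample {d : ℕ} (ℓ' : ℝ → ℝ → ℝ) (θ : Vec d) (z : Vec d × ℝ) : Vec d :=
  ℓ' (inner ℝ θ z.1) z.2 • z.1

/-- `σ_max`: the square root of the supremum over `θ ∈ S` and coordinates `j` of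
`Var (ℓ'(⟨θ, X⟩, Y) X^j)`. -/
def sigmaMax {d : ℕ} (ℓ' : ℝ → ℝ → ℝ) (P : Measure (Vec d × ℝ)) (S : Set (Vec d)) : ℝ :=
  Real.sqrt (sSup {v | ∃ θ ∈ S, ∃ j : Fin d, v = variance (fun z => gradSample ℓ' θ z j) P})

/-! ### Trimmed mean -/

/-- The `k`-th order statistic (`1 ≤ k ≤ m`) of `x`. -/
def orderStat {m : ℕ} (x : Fin m → ℝ) (k : ℕ) : ℝ :=
  if h : k - 1 < m then x (Tuple.sort x ⟨k - 1, h⟩) else 0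

/-- The trimmed mean: quantiles from the first half of the sample, average of the clipped values
over the second half. -/
def trimmedMean {n : ℕ} (α : ℝ) (x : Fin n → ℝ) : ℝ :=
  let firstHalf : Fin (n / 2) → ℝ := fun i => x (Fin.castLE (Nat.div_le_self n 2) i)
  let qlo := orderStat firstHalf ⌊α * n / 2⌋₊
  let qhi := orderStat firstHalf ⌊(1 - α) * n / 2⌋₊
  2 / (n : ℝ) * ∑ i ∈ Finset.univ.filter (fun i : Fin n => n / 2 ≤ i.val), max qlo (min (x i) qhi)

/-- Coordinatewise trimmed mean of the gradient samples of one batch. -/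
def gradEst {d n : ℕ} (ℓ' : ℝ → ℝ → ℝ) (α : ℝ) (z : Fin n → Vec d × ℝ) (θ : Vec d) : Vec d :=
  WithLp.toLp 2 fun j => trimmedMean α fun i => gradSample ℓ' θ (z i) j

/-- Sample splitting: the gradient estimator of iteration `t` uses the `t`-th batch only
(there are `T` batches; the value for `t ≥ T` is never used). -/
def batchGradEst {d T n : ℕ} (ℓ' : ℝ → ℝ → ℝ) (α : ℝ) (z : Fin T → Fin n → Vec d × ℝ)
    (t : ℕ) (θ : Vec d) : Vec d :=
  if h : t < T then gradEst ℓ' α (z ⟨t, h⟩) θ else 0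

/-! ### Corrupted data -/

/-- `T` batches of `n` data points, with outliers at the indices in `O`: the inliers are i.i.d. with
law `P`, each batch holds at most `η n` outliers, and outliers are arbitrary except that the
inliers of a batch are independent of all the data (outliers included) of the preceding batches. -/
structure IsCorruptedSample {Ω : Type*} [MeasurableSpace Ω] (μ : Measure Ω) {d T n : ℕ}
    (P : Measure (Vec d × ℝ)) (η : ℝ) (O : Finset (Fin T × Fin n))
    (Z : Fin T → Fin n → Ω → Vec d × ℝ) : Prop where
  measurable : ∀ t i, Measurable (Z t i)
  card_outliers : ∀ t, ((Finset.univ.filter fun i => (t, i) ∈ O).card : ℝ) ≤ η * n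
  law : ∀ t i, (t, i) ∉ O → μ.map (Z t i) = P
  indep : iIndepFun (fun p : {p : Fin T × Fin n // p ∉ O} => Z p.1.1 p.1.2) μ
  indep_past : ∀ t, IndepFun
    (fun ω (i : {i : Fin n // (t, i) ∉ O}) => Z t i.1 ω)
    (fun ω (p : {p : Fin T × Fin n // p.1 < t}) => Z p.1.1 p.1.2 ω) μ

/-! ### Dual averaging and its multistage version -/

/-- A minimizer of `f` over `S` (any, if there is one). -/
def argminOn {d : ℕ} (f : Vec d → ℝ) (S : Set (Vec d)) : Vec d :=
  Classical.epsilon fun θ => θ ∈ S ∧ ∀ θ' ∈ S, f θ ≤ f θ'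

/-- The exponent `p = 1 + 1 / log d`. -/
def proxExponent (d : ℕ) : ℝ := 1 + 1 / Real.log d

/-- The prox-function `ω(θ) = (1/2) e log(d) d^{(p-1)(2-p)/p} ‖θ‖_p²`. -/
def proxFun {d : ℕ} (θ : Vec d) : ℝ :=
  1 / 2 * Real.exp 1 * Real.log d
    * (d : ℝ) ^ ((proxExponent d - 1) * (2 - proxExponent d) / proxExponent d)
    * lpNorm (proxExponent d) θ ^ 2

/-- The quadratic growth constant `ν = (1/2) e² log d` of `proxFun`. -/
def nu (d : ℕ) : ℝ := 1 / 2 * Real.exp 1 ^ 2 * Real.log d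

/-- Dual averaging on the domain `Θ` with prox-function `ω`, steps `a`, scalings `γ` and gradient
estimators `ghat i`. The value at `t` is the pair `(θ_t, ∑_{i ≤ t} a_i ghat_i(θ_i))`, whose second
entry is `A_t s_t`. -/
def dualAveraging {d : ℕ} (Θ : Set (Vec d)) (ω : Vec d → ℝ) (a γ : ℕ → ℝ)
    (ghat : ℕ → Vec d → Vec d) (θ₀ : Vec d) : ℕ → Vec d × Vec d
  | 0 => (θ₀, a 0 • ghat 0 θ₀)
  | t + 1 =>
    let prev := dualAveraging Θ ω a γ ghat θ₀ t
    let θplus := argminOn (fun θ => inner ℝ prev.2 θ + γ t * ω θ) Θ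
    let w := a (t + 1) / ∑ i ∈ Finset.range (t + 2), a i
    let θnext := (1 - w) • prev.1 + w • θplus
    (θnext, prev.2 + a (t + 1) • ghat (t + 1) θnext)

/-- The radii `R_0 = R`, `R_{k+1} = max (τ R_k) ((R_k + R^⋆) / 2)`. -/
def stageRadius (τ Rstar R : ℝ) : ℕ → ℝ
  | 0 => R
  | k + 1 => max (τ * stageRadius τ Rstar R k) (1 / 2 * (stageRadius τ Rstar R k + Rstar))

/-- The output `θ^{(k)}` of stage `k` of AMDA, with `T'` iterations per stage and sparsifier `H`;
stage `k + 1` uses the estimators `ghat (k T'), …, ghat (k T' + T' - 1)`. -/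
def amda {d : ℕ} (T' : ℕ) (H : Vec d → Vec d) (τ Rstar R : ℝ) (ghat : ℕ → Vec d → Vec d)
    (θ₀ : Vec d) : ℕ → Vec d
  | 0 => θ₀
  | k + 1 =>
    let c := amda T' H τ Rstar R ghat θ₀ k
    let r := stageRadius τ Rstar R k
    H (dualAveraging (l1Ball c r) (fun θ => proxFun (θ - c)) (fun _ => r)
        (fun i => Real.sqrt (i + 1)) (fun i => ghat (k * T' + i)) c T').1

/-! ### Constants -/

/-- `√(4η + 6 (log(4/δ) + log d) / n)`. -/
def statRate (η δ : ℝ) (d n : ℕ) : ℝ :=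
  Real.sqrt (4 * η + 6 * ((Real.log (4 / δ) + Real.log d) / n))

/-- The trimming level `α = 8η + 12 log(4d/δ) / n`. -/
def trimLevel (η δ : ℝ) (d n : ℕ) : ℝ :=
  8 * η + 12 * ((Real.log (4 / δ) + Real.log d) / n)

/-- `τ = 10 √(8 sbar) ε / κ`. -/
def tauConst (sbar : ℕ) (κ ε : ℝ) : ℝ := 10 * Real.sqrt (8 * sbar) * ε / κ

/-- `R^⋆ = 80 λ sbar ε / κ`. -/
def rStar (sbar : ℕ) (κ lam ε : ℝ) : ℝ := 80 * lam * sbar * ε / κ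

end

end AMDA

namespace AMDA

/-! ### The prox-function -/

/-! The argument separates a deterministic contraction from one concentration estimate. Write `ε`
for the coordinatewise gradient error that is tolerated and `R_k` for the stage radii.

Contraction. The prox-function is 1-strongly convex for `‖·‖₁` and at most `ν‖·‖₁²`: this is the
2-uniform convexity of `ℓ_p` (`lpNorm_parallelogram`) with `p - 1 = 1 / log d`, for which the
passage from `ℓ_p` to `ℓ₁` costs only a constant. Gradient errors therefore enter through their
largest coordinate. If a stage starts at `c` with `‖c - θ⋆‖₁ ≤ r`, then `θ⋆` lies in its domain, and
an estimate-sequence argument gives excess risk at most `5rε` after `T'` steps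
(`dualAveraging_invariant`, `dualAveraging_convergence`). The growth condition turns this into an
`ℓ₂` bound: linear growth far from `θ⋆` gives the factor `τ`, quadratic growth near `θ⋆` gives `√(r
R⋆) ≤ (r + R⋆) / 2`. Sparsification at most doubles the `ℓ₂` distance, and the difference of two
`sbar`-sparse vectors satisfies `‖·‖₁ ≤ √(2 sbar) ‖·‖₂`, so the next centre is within `R_{k+1}` of
`θ⋆` in `ℓ₁` (`IsSparsifier.norm_sub_le_of_excess`, `amda_error_le`). The radii shrink by `τ` up to
the turning index, and afterwards their excess over `R⋆` is halved at each stage.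

Concentration. For a fixed parameter, `prob_trimmedMean_error` bounds the trimmed-mean error outside
an event that involves the inliers alone: it quantifies over all samples that agree with the
inliers, so the outliers may be chosen after seeing everything. Empirical quantiles are controlled
by Chernoff bounds on counts, and the clipped average by an exponential moment.

Gluing. The query point of iteration `t` is a measurable function of the earlier batches, hence
independent of the inliers of batch `t`. Fubini extends the fixed-parameter bound to it
(`prob_estimator_error_le`), and a union bound over coordinates and iterations uses up `δ`. -/

lemma two_le_rpow_add_rpow {r t : ℝ} (hr : r ≤ 1) (ht0 : 0 ≤ t) (ht1 : t < 1) :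
    2 ≤ (1 + t) ^ (r - 1) + (1 - t) ^ (r - 1) := by
  have h1 : 0 < (1 + t) ^ (r - 1) := Real.rpow_pos_of_pos (by linarith) _
  have h2 : 0 < (1 - t) ^ (r - 1) := Real.rpow_pos_of_pos (by linarith) _
  have h3 : 1 ≤ (1 + t) ^ (r - 1) * (1 - t) ^ (r - 1) := by
    rw [← Real.mul_rpow (by linarith) (by linarith)]
    exact Real.one_le_rpow_of_pos_of_le_one_of_nonpos (by nlinarith) (by nlinarith) (by linarith)
  nlinarith [sq_nonneg ((1 + t) ^ (r - 1) - (1 - t) ^ (r - 1))]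

/-- Both sides vanish at `t = 0`, and the derivatives compare by `two_le_rpow_add_rpow`, which is
AM-GM applied to two factors of product at least 1. The use is with `r = p - 1`. -/
lemma two_mul_le_rpow_sub_rpow {r t : ℝ} (hr0 : 0 ≤ r) (hr : r ≤ 1) (ht0 : 0 ≤ t) (ht1 : t ≤ 1) :
    2 * r * t ≤ (1 + t) ^ r - (1 - t) ^ r := by
  rcases hr0.eq_or_lt with rfl | hr0
  · simp
  have hmono : MonotoneOn (fun t : ℝ => (1 + t) ^ r - (1 - t) ^ r - 2 * r * t) (Set.Icc 0 1) := by
    have hd : ∀ x ∈ Set.Ioo (0 : ℝ) 1,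
        HasDerivAt (fun t : ℝ => (1 + t) ^ r - (1 - t) ^ r - 2 * r * t)
          (1 * r * (1 + x) ^ (r - 1) - (-1) * r * (1 - x) ^ (r - 1) - 2 * r * 1) x := by
      intro x hx
      have h1 : HasDerivAt (fun t : ℝ => 1 + t) 1 x := (hasDerivAt_id x).const_add 1
      have h2 : HasDerivAt (fun t : ℝ => 1 - t) (-1) x := (hasDerivAt_id x).const_sub 1
      exact ((h1.rpow_const (Or.inl (by linarith [hx.1]))).sub
        (h2.rpow_const (Or.inl (by linarith [hx.2])))).sub ((hasDerivAt_id x).const_mul (2 * r))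
    refine monotoneOn_of_deriv_nonneg (convex_Icc 0 1) ?_ ?_ ?_
    · refine Continuous.continuousOn ?_
      have h1 : Continuous fun t : ℝ => (1 + t) ^ r :=
        (continuous_const.add continuous_id).rpow_const fun _ => Or.inr hr0.le
      have h2 : Continuous fun t : ℝ => (1 - t) ^ r :=
        (continuous_const.sub continuous_id).rpow_const fun _ => Or.inr hr0.le
      exact (h1.sub h2).sub (by fun_prop)
    · rw [interior_Icc]
      exact fun x hx => (hd x hx).differentiableAt.differentiableWithinAt
    · rw [interior_Icc]
      intro x hx
      rw [(hd x hx).deriv]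
      nlinarith [two_le_rpow_add_rpow hr hx.1.le hx.2]
  have := hmono (Set.left_mem_Icc.2 zero_le_one) ⟨ht0, ht1⟩ ht0
  simp at this
  linarith

/-- A second integration: both sides equal 2 at `t = 0`, and the derivatives compare by the previous
lemma times `p`. -/
lemma two_add_le_rpow_add_rpow {p t : ℝ} (hp1 : 1 ≤ p) (hp2 : p ≤ 2) (ht0 : 0 ≤ t) (ht1 : t ≤ 1) :
    2 + p * (p - 1) * t ^ 2 ≤ (1 + t) ^ p + (1 - t) ^ p := by
  have hmono : MonotoneOn (fun t : ℝ => (1 + t) ^ p + (1 - t) ^ p - p * (p - 1) * t ^ 2)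
      (Set.Icc 0 1) := by
    have hd : ∀ x ∈ Set.Ioo (0 : ℝ) 1,
        HasDerivAt (fun t : ℝ => (1 + t) ^ p + (1 - t) ^ p - p * (p - 1) * t ^ 2)
          (1 * p * (1 + x) ^ (p - 1) + (-1) * p * (1 - x) ^ (p - 1)
            - p * (p - 1) * (2 * x)) x := by
      intro x hx
      have h1 : HasDerivAt (fun t : ℝ => 1 + t) 1 x := (hasDerivAt_id x).const_add 1
      have h2 : HasDerivAt (fun t : ℝ => 1 - t) (-1) x := (hasDerivAt_id x).const_sub 1
      have h3 : HasDerivAt (fun t : ℝ => t ^ 2) (2 * x) x := by simpa using hasDerivAt_pow 2 x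
      exact ((h1.rpow_const (Or.inl (by linarith [hx.1]))).add
        (h2.rpow_const (Or.inl (by linarith [hx.2])))).sub (h3.const_mul (p * (p - 1)))
    refine monotoneOn_of_deriv_nonneg (convex_Icc 0 1) ?_ ?_ ?_
    · refine Continuous.continuousOn ?_
      have h1 : Continuous fun t : ℝ => (1 + t) ^ p :=
        (continuous_const.add continuous_id).rpow_const fun _ => Or.inr (by linarith)
      have h2 : Continuous fun t : ℝ => (1 - t) ^ p :=
        (continuous_const.sub continuous_id).rpow_const fun _ => Or.inr (by linarith)
      exact (h1.add h2).sub (by fun_prop)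
    · rw [interior_Icc]
      exact fun x hx => (hd x hx).differentiableAt.differentiableWithinAt
    · rw [interior_Icc]
      intro x hx
      rw [(hd x hx).deriv]
      nlinarith [two_mul_le_rpow_sub_rpow (r := p - 1) (by linarith) (by linarith) hx.1.le hx.2.le]
  have := hmono (Set.left_mem_Icc.2 zero_le_one) ⟨ht0, ht1⟩ ht0
  simp at this
  linarith

/-- By homogeneity `a = 1`. Bernoulli for the exponent `p / 2 ≤ 1` bounds the left side by the
quadratic polynomial of `two_add_le_rpow_add_rpow`. -/
lemma two_point_of_le {p a b : ℝ} (hp1 : 1 ≤ p) (hp2 : p ≤ 2) (hb : 0 ≤ b) (hab : b ≤ a) :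
    2 * (a ^ 2 + (p - 1) * b ^ 2) ^ (p / 2) ≤ (a + b) ^ p + (a - b) ^ p := by
  rcases (hb.trans hab).eq_or_lt with rfl | ha
  · obtain rfl : b = 0 := le_antisymm hab hb
    have h1 : p ≠ 0 := by linarith
    simp [Real.zero_rpow h1, h1]
  have ht0 : 0 ≤ b / a := by positivity
  have ht1 : b / a ≤ 1 := (div_le_one ha).2 hab
  have e1 : a + b = a * (1 + b / a) := by field_simp
  have e2 : a - b = a * (1 - b / a) := by field_simp
  have e3 : a ^ 2 + (p - 1) * b ^ 2 = a ^ 2 * (1 + (p - 1) * (b / a) ^ 2) := by field_simp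
  have h0 : 0 ≤ (p - 1) * (b / a) ^ 2 := mul_nonneg (by linarith) (sq_nonneg _)
  have e4 : (a ^ 2) ^ (p / 2) = a ^ p := by
    rw [← Real.rpow_natCast a 2, ← Real.rpow_mul ha.le]; congr 1; push_cast; ring
  rw [e1, e2, e3, Real.mul_rpow ha.le (by linarith), Real.mul_rpow ha.le (by linarith),
    Real.mul_rpow (by positivity) (by linarith), e4]
  have h1 := two_add_le_rpow_add_rpow hp1 hp2 ht0 ht1
  have h2 := rpow_one_add_le_one_add_mul_self (s := (p - 1) * (b / a) ^ 2) (p := p / 2)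
    (by linarith) (by linarith) (by linarith)
  have h3 : 0 < a ^ p := Real.rpow_pos_of_pos ha p
  nlinarith

/-- The two-point inequality behind the 2-uniform convexity of `ℓ_p`, `1 ≤ p ≤ 2`. -/
lemma two_point {p : ℝ} (hp1 : 1 ≤ p) (hp2 : p ≤ 2) (a b : ℝ) :
    2 * (a ^ 2 + (p - 1) * b ^ 2) ^ (p / 2) ≤ |a + b| ^ p + |a - b| ^ p := by
  have key : ∀ a b : ℝ, 0 ≤ a → 0 ≤ b →
      2 * (a ^ 2 + (p - 1) * b ^ 2) ^ (p / 2) ≤ |a + b| ^ p + |a - b| ^ p := by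
    intro a b ha hb
    rcases le_total b a with h | h
    · rw [abs_of_nonneg (by linarith), abs_of_nonneg (by linarith : 0 ≤ a - b)]
      exact two_point_of_le hp1 hp2 hb h
    · rw [abs_of_nonneg (by linarith), abs_sub_comm, abs_of_nonneg (by linarith : 0 ≤ b - a),
        add_comm a b]
      refine le_trans ?_ (two_point_of_le hp1 hp2 ha h)
      have h0 : a ^ 2 ≤ b ^ 2 := by nlinarith
      have h1 : 0 ≤ a ^ 2 + (p - 1) * b ^ 2 :=
        add_nonneg (sq_nonneg _) (mul_nonneg (by linarith) (sq_nonneg _))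
      -- As `p - 1 ≤ 1`, exchanging the two numbers only increases the left side, so the ordered
      -- case suffices.
      have : a ^ 2 + (p - 1) * b ^ 2 ≤ b ^ 2 + (p - 1) * a ^ 2 := by nlinarith
      have := Real.rpow_le_rpow h1 this (by linarith : 0 ≤ p / 2)
      linarith
  have h := key |a| |b| (abs_nonneg a) (abs_nonneg b)
  rw [sq_abs, sq_abs] at h
  rcases abs_cases a with ⟨ha, -⟩ | ⟨ha, -⟩ <;> rcases abs_cases b with ⟨hb, -⟩ | ⟨hb, -⟩ <;>
    rw [ha, hb] at h
  · exact h
  · simp only [← sub_eq_add_neg, sub_neg_eq_add] at h; linarith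
  · rw [show -a + b = -(a - b) by ring, show -a - b = -(a + b) by ring, abs_neg, abs_neg] at h
    linarith
  · rw [show -a + -b = -(a + b) by ring, show -a - -b = -(a - b) by ring, abs_neg, abs_neg] at h
    exact h

/-- The triangle inequality for the `ℓ_r` norm of the plane, applied to the vectors `(u i, v i)`. -/
lemma minkowski_pair {ι : Type*} (s : Finset ι) {r : ℝ} (hr : 1 ≤ r) (u v : ι → ℝ)
    (hu : ∀ i, 0 ≤ u i) (hv : ∀ i, 0 ≤ v i) :
    ((∑ i ∈ s, u i) ^ r + (∑ i ∈ s, v i) ^ r) ^ (1 / r)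
      ≤ ∑ i ∈ s, (u i ^ r + v i ^ r) ^ (1 / r) := by
  classical
  have hr0 : r ≠ 0 := by linarith
  induction s using Finset.induction_on with
  | empty => simp [hr0]
  | insert i s his ih =>
    rw [Finset.sum_insert his, Finset.sum_insert his, Finset.sum_insert his]
    have hU : 0 ≤ ∑ i ∈ s, u i := Finset.sum_nonneg fun i _ => hu i
    have hV : 0 ≤ ∑ i ∈ s, v i := Finset.sum_nonneg fun i _ => hv i
    have := Real.Lp_add_le_of_nonneg (s := (Finset.univ : Finset (Fin 2)))
      (f := ![u i, v i]) (g := ![∑ i ∈ s, u i, ∑ i ∈ s, v i]) hr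
      (by intro j _; fin_cases j <;> simp [hu, hv]) (by intro j _; fin_cases j <;> simp [hU, hV])
    simp only [Fin.sum_univ_two, Matrix.cons_val_zero, Matrix.cons_val_one] at this
    linarith

variable {d : ℕ}

lemma lpNorm_sq (p : ℝ) (x : Vec d) : lpNorm p x ^ 2 = (∑ j, |x j| ^ p) ^ (2 / p) := by
  have h : 0 ≤ ∑ j, |x j| ^ p := Finset.sum_nonneg fun j _ => Real.rpow_nonneg (abs_nonneg _) _
  rw [lpNorm, ← Real.rpow_natCast, ← Real.rpow_mul h]
  congr 1; push_cast; ring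

/-- 2-uniform convexity of the `ℓ_p` norm, `1 < p ≤ 2`. -/
lemma lpNorm_parallelogram {p : ℝ} (hp1 : 1 < p) (hp2 : p ≤ 2) (x y : Vec d) :
    2 * (lpNorm p x ^ 2 + (p - 1) * lpNorm p y ^ 2)
      ≤ lpNorm p (x + y) ^ 2 + lpNorm p (x - y) ^ 2 := by
  simp only [lpNorm_sq]
  have hp0 : 0 < p := by linarith
  set r := 2 / p with hr
  have hr1 : 1 ≤ r := by rw [hr, le_div_iff₀ hp0]; linarith
  have hr0 : 0 < r := by linarith
  have hrinv : 1 / r = p / 2 := by rw [hr]; field_simp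
  set c := Real.sqrt (p - 1) with hc
  have hc2 : c ^ 2 = p - 1 := Real.sq_sqrt (by linarith)
  have hc0 : 0 ≤ c := Real.sqrt_nonneg _
  have hpr : ∀ a : ℝ, (|a| ^ p) ^ r = a ^ 2 := by
    intro a
    rw [← Real.rpow_mul (abs_nonneg _), hr, mul_div_cancel₀ _ hp0.ne',
      show (2 : ℝ) = ((2 : ℕ) : ℝ) by norm_num, Real.rpow_natCast, sq_abs]
  have hcr : (c ^ p) ^ r = p - 1 := by rw [← hc2, ← hpr c, abs_of_nonneg hc0]
  have hu : ∀ z : Vec d, ∀ j, 0 ≤ |z j| ^ p := fun z j => Real.rpow_nonneg (abs_nonneg _) _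
  have hS : ∀ z : Vec d, 0 ≤ ∑ j, |z j| ^ p := fun z => Finset.sum_nonneg fun j _ => hu z j
  -- For `r = 2 / p` and `c² = p - 1` the `r`-th powers of the two entries are `x_j²` and `(p - 1)
  -- y_j²`, so each summand is the left side of `two_point`.
  have hmink := minkowski_pair (Finset.univ : Finset (Fin d)) hr1 (fun j => |x j| ^ p)
    (fun j => c ^ p * |y j| ^ p) (hu x)
    (fun j => mul_nonneg (Real.rpow_nonneg hc0 _) (hu y j))
  have hcp : 0 ≤ c ^ p := Real.rpow_nonneg hc0 _
  rw [← Finset.mul_sum, Real.mul_rpow hcp (hS y), hcr] at hmink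
  have hpt : ∑ j, ((|x j| ^ p) ^ r + (c ^ p * |y j| ^ p) ^ r) ^ (1 / r)
      ≤ (∑ j, |(x + y) j| ^ p + ∑ j, |(x - y) j| ^ p) / 2 := by
    rw [← Finset.sum_add_distrib, Finset.sum_div]
    refine Finset.sum_le_sum fun j _ => ?_
    rw [Real.mul_rpow hcp (hu y j), hcr, hpr, hpr, hrinv]
    have := two_point hp1.le hp2 (x j) (y j)
    simp only [PiLp.add_apply, PiLp.sub_apply]
    linarith
  have hA : 0 ≤ (∑ j, |x j| ^ p) ^ r + (p - 1) * (∑ j, |y j| ^ p) ^ r :=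
    add_nonneg (Real.rpow_nonneg (hS x) _)
      (mul_nonneg (by linarith) (Real.rpow_nonneg (hS y) _))
  have h1 := Real.rpow_le_rpow (Real.rpow_nonneg hA _) (hmink.trans hpt) hr0.le
  rw [← Real.rpow_mul hA, one_div_mul_cancel hr0.ne', Real.rpow_one] at h1
  have h2 := (convexOn_rpow hr1).2 (hS (x + y)) (hS (x - y)) (by norm_num : (0 : ℝ) ≤ 1 / 2)
    (by norm_num : (0 : ℝ) ≤ 1 / 2) (by norm_num)
  simp only [smul_eq_mul] at h2
  rw [show 1 / 2 * ∑ j, |(x + y) j| ^ p + 1 / 2 * ∑ j, |(x - y) j| ^ p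
    = (∑ j, |(x + y) j| ^ p + ∑ j, |(x - y) j| ^ p) / 2 by ring] at h2
  linarith

lemma l1Norm_nonneg (x : Vec d) : 0 ≤ l1Norm x := Finset.sum_nonneg fun _ _ => abs_nonneg _

lemma l1Norm_sq_le {p : ℝ} (hp1 : 1 ≤ p) (x : Vec d) :
    l1Norm x ^ 2 ≤ (d : ℝ) ^ (2 * (p - 1) / p) * lpNorm p x ^ 2 := by
  have hp0 : 0 < p := by linarith
  have hS : 0 ≤ ∑ j, |x j| ^ p := Finset.sum_nonneg fun j _ => Real.rpow_nonneg (abs_nonneg _) _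
  have h := Real.rpow_sum_le_const_mul_sum_rpow (Finset.univ : Finset (Fin d)) (fun j => x j) hp1
  rw [Finset.card_univ, Fintype.card_fin] at h
  change l1Norm x ^ p ≤ _ at h
  have h' := Real.rpow_le_rpow (Real.rpow_nonneg (l1Norm_nonneg x) _) h
    (by positivity : 0 ≤ 2 / p)
  rw [Real.mul_rpow (by positivity) hS, ← Real.rpow_mul (Nat.cast_nonneg d),
    ← Real.rpow_mul (l1Norm_nonneg x), mul_div_cancel₀ _ hp0.ne'] at h'
  rw [lpNorm_sq, ← Real.rpow_natCast, show 2 * (p - 1) / p = (p - 1) * (2 / p) by ring]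
  exact_mod_cast h'

lemma lpNorm_sq_le {p : ℝ} (hp1 : 1 ≤ p) (x : Vec d) : lpNorm p x ^ 2 ≤ l1Norm x ^ 2 := by
  have hp0 : 0 < p := by linarith
  have hS : 0 ≤ ∑ j, |x j| ^ p := Finset.sum_nonneg fun j _ => Real.rpow_nonneg (abs_nonneg _) _
  have h0 := l1Norm_nonneg x
  have h : ∑ j, |x j| ^ p ≤ l1Norm x ^ p := by
    have hs : l1Norm x ^ p = ∑ j, |x j| * l1Norm x ^ (p - 1) := by
      rw [← Finset.sum_mul]
      change _ = l1Norm x * _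
      rcases h0.eq_or_lt with h | h
      · rw [← h, Real.zero_rpow hp0.ne', zero_mul]
      · rw [Real.rpow_sub_one h.ne']; field_simp
    rw [hs]
    refine Finset.sum_le_sum fun j _ => ?_
    have hj : |x j| ≤ l1Norm x :=
      Finset.single_le_sum (f := fun j => |x j|) (fun _ _ => abs_nonneg _) (Finset.mem_univ j)
    rcases (abs_nonneg (x j)).eq_or_lt with h | h
    · rw [← h, Real.zero_rpow hp0.ne', zero_mul]
    · calc |x j| ^ p = |x j| * |x j| ^ (p - 1) := by
            rw [Real.rpow_sub_one h.ne']; field_simp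
        _ ≤ _ := by gcongr
  rw [lpNorm_sq]
  calc _ ≤ (l1Norm x ^ p) ^ (2 / p) := Real.rpow_le_rpow hS h (by positivity)
    _ = l1Norm x ^ 2 := by
      rw [← Real.rpow_mul h0, mul_div_cancel₀ _ hp0.ne']; exact_mod_cast Real.rpow_natCast _ 2

lemma one_lt_log_of_three_le (hd : 3 ≤ d) : 1 < Real.log d := by
  rw [Real.lt_log_iff_exp_lt (by positivity)]
  have : (3 : ℝ) ≤ d := by exact_mod_cast hd
  linarith [Real.exp_one_lt_d9]

lemma proxExponent_bounds (hd : 3 ≤ d) : 1 < proxExponent d ∧ proxExponent d ≤ 2 := by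
  have h := one_lt_log_of_three_le hd
  unfold proxExponent
  have h1 : 0 < 1 / Real.log d := by positivity
  have h2 : 1 / Real.log d ≤ 1 := (div_le_one (by linarith)).2 h.le
  constructor <;> linarith

/-- The reason for the choice of `p`: `d ^ (p - 1) = e`, so powers of the dimension become
constants. -/
lemma natCast_rpow_proxExponent_sub_one_mul (hd : 3 ≤ d) (a : ℝ) :
    (d : ℝ) ^ ((proxExponent d - 1) * a) = Real.exp a := by
  have h := one_lt_log_of_three_le hd
  have hd0 : (0 : ℝ) < d := by positivity
  rw [Real.rpow_def_of_pos hd0, proxExponent]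
  congr 1; field_simp; ring

/-- Midpoint form of the strong convexity of the prox-function with respect to `‖·‖₁`. -/
lemma proxFun_midpoint (hd : 3 ≤ d) (u v : Vec d) :
    proxFun ((1 / 2 : ℝ) • (u + v))
      ≤ (proxFun u + proxFun v) / 2 - l1Norm (u - v) ^ 2 / 8 := by
  obtain ⟨hp1, hp2⟩ := proxExponent_bounds hd
  have hL := one_lt_log_of_three_le hd
  have hL0 : Real.log d ≠ 0 := by linarith
  have hp0 : proxExponent d ≠ 0 := by linarith
  have hpar := lpNorm_parallelogram hp1 hp2 ((1 / 2 : ℝ) • (u + v)) ((1 / 2 : ℝ) • (u - v))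
  have e1 : (1 / 2 : ℝ) • (u + v) + (1 / 2 : ℝ) • (u - v) = u := by module
  have e2 : (1 / 2 : ℝ) • (u + v) - (1 / 2 : ℝ) • (u - v) = v := by module
  rw [e1, e2] at hpar
  have hl1 := l1Norm_sq_le hp1.le ((1 / 2 : ℝ) • (u - v))
  have e3 : l1Norm ((1 / 2 : ℝ) • (u - v)) = 1 / 2 * l1Norm (u - v) := by
    simp [l1Norm, abs_mul, Finset.mul_sum]
  have hpe : proxExponent d - 1 = 1 / Real.log d := by unfold proxExponent; ring
  rw [e3, show 2 * (proxExponent d - 1) / proxExponent d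
    = (proxExponent d - 1) * (2 / proxExponent d) by ring,
    natCast_rpow_proxExponent_sub_one_mul hd] at hl1
  unfold proxFun
  rw [show (proxExponent d - 1) * (2 - proxExponent d) / proxExponent d
    = (proxExponent d - 1) * (2 / proxExponent d - 1) by field_simp,
    natCast_rpow_proxExponent_sub_one_mul hd, Real.exp_sub]
  rw [hpe] at hpar
  set E := Real.exp (2 / proxExponent d)
  have hE : 0 < E := Real.exp_pos _
  set e := Real.exp 1
  have he : 0 < e := Real.exp_pos _
  set L := Real.log d
  set A := lpNorm (proxExponent d) ((1 / 2 : ℝ) • (u + v)) ^ 2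
  set B := lpNorm (proxExponent d) ((1 / 2 : ℝ) • (u - v)) ^ 2
  set C := lpNorm (proxExponent d) u ^ 2
  set D := lpNorm (proxExponent d) v ^ 2
  have hB : L * (1 / L * B) = B := by field_simp
  -- The prefactor is `L * E / 2`: `L` offsets the convexity modulus `p - 1 = 1 / L`, and `E` the
  -- comparison of `‖·‖₁²` with `‖·‖_p²`.
  have e4 : ∀ x, 1 / 2 * e * L * (E / e) * x = 1 / 2 * L * E * x := by intro x; field_simp
  rw [e4, e4, e4]
  have hLE : 0 < L * E := by positivity
  have h1 := mul_le_mul_of_nonneg_left hpar hLE.le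
  have h2 : L * E * (2 * (A + 1 / L * B)) = 2 * (L * E * A) + 2 * (E * B) := by
    field_simp
  rw [h2] at h1
  nlinarith

lemma proxFun_le (hd : 3 ≤ d) (u : Vec d) : proxFun u ≤ nu d * l1Norm u ^ 2 := by
  obtain ⟨hp1, hp2⟩ := proxExponent_bounds hd
  have hL := one_lt_log_of_three_le hd
  have hp0 : 0 < proxExponent d := by linarith
  unfold proxFun nu
  rw [show (proxExponent d - 1) * (2 - proxExponent d) / proxExponent d
    = (proxExponent d - 1) * ((2 - proxExponent d) / proxExponent d) by field_simp,
    natCast_rpow_proxExponent_sub_one_mul hd]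
  have h1 : Real.exp ((2 - proxExponent d) / proxExponent d) ≤ Real.exp 1 := by
    apply Real.exp_le_exp.2
    rw [div_le_one hp0]; linarith
  have h2 := lpNorm_sq_le hp1.le u
  have he := Real.exp_pos 1
  calc _ ≤ 1 / 2 * Real.exp 1 * Real.log d * Real.exp 1 * l1Norm u ^ 2 := by gcongr
    _ = _ := by ring

lemma proxFun_zero (hd : 3 ≤ d) : proxFun (0 : Vec d) = 0 := by
  obtain ⟨hp1, hp2⟩ := proxExponent_bounds hd
  have hp0 : proxExponent d ≠ 0 := by linarith
  simp [proxFun, lpNorm, Real.zero_rpow hp0, hp0]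

lemma continuous_proxFun (hd : 3 ≤ d) : Continuous (proxFun : Vec d → ℝ) := by
  obtain ⟨hp1, hp2⟩ := proxExponent_bounds hd
  unfold proxFun lpNorm
  refine continuous_const.mul (Continuous.pow ?_ 2)
  refine Continuous.rpow_const ?_ fun _ => Or.inr (by positivity)
  exact continuous_finsetSum _ fun j _ =>
    Continuous.rpow_const (by fun_prop) fun _ => Or.inr (by linarith)

end AMDA

namespace AMDA

variable {d : ℕ}

/-! ### The `ℓ₁` norm -/

lemma l1Norm_add_le (x y : Vec d) : l1Norm (x + y) ≤ l1Norm x + l1Norm y := by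
  unfold l1Norm
  rw [← Finset.sum_add_distrib]
  exact Finset.sum_le_sum fun j _ => abs_add_le _ _

lemma l1Norm_smul (a : ℝ) (x : Vec d) : l1Norm (a • x) = |a| * l1Norm x := by
  simp [l1Norm, abs_mul, Finset.mul_sum]

lemma l1Norm_neg (x : Vec d) : l1Norm (-x) = l1Norm x := by simp [l1Norm]

lemma l1Norm_sub_comm (x y : Vec d) : l1Norm (x - y) = l1Norm (y - x) := by
  rw [← l1Norm_neg, neg_sub]

lemma l1Norm_sub_le (x y z : Vec d) : l1Norm (x - z) ≤ l1Norm (x - y) + l1Norm (y - z) := by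
  simpa using l1Norm_add_le (x - y) (y - z)

lemma l1Norm_zero : l1Norm (0 : Vec d) = 0 := by simp [l1Norm]

lemma continuous_l1Norm : Continuous (l1Norm : Vec d → ℝ) := by
  unfold l1Norm; fun_prop

lemma norm_le_l1Norm (x : Vec d) : ‖x‖ ≤ l1Norm x := by
  rw [EuclideanSpace.norm_eq]
  refine Real.sqrt_le_iff.2 ⟨l1Norm_nonneg x, ?_⟩
  simpa [l1Norm] using Finset.sum_sq_le_sq_sum_of_nonneg (s := Finset.univ) (f := fun j => |x j|)
    fun j _ => abs_nonneg _

lemma l1Norm_eq_zero {x : Vec d} (h : l1Norm x = 0) : x = 0 :=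
  norm_le_zero_iff.1 (h ▸ norm_le_l1Norm x)

lemma abs_inner_le {b : ℝ} {s : Vec d} (hs : ∀ j, |s j| ≤ b) (x : Vec d) :
    |(inner ℝ s x : ℝ)| ≤ b * l1Norm x := by
  rw [PiLp.inner_apply, l1Norm, Finset.mul_sum]
  refine (Finset.abs_sum_le_sum_abs _ _).trans (Finset.sum_le_sum fun j _ => ?_)
  simp only [RCLike.inner_apply, conj_trivial, abs_mul]
  rw [mul_comm]
  exact mul_le_mul_of_nonneg_right (hs j) (abs_nonneg _)

lemma isCompact_l1Ball (c : Vec d) (r : ℝ) : IsCompact (l1Ball c r) := by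
  refine Metric.isCompact_of_isClosed_isBounded ?_ ?_
  · exact isClosed_le (continuous_l1Norm.comp (continuous_id.sub continuous_const))
      continuous_const
  · refine (Metric.isBounded_closedBall (x := c) (r := r)).subset fun θ hθ => ?_
    rw [Metric.mem_closedBall, dist_eq_norm]
    exact (norm_le_l1Norm _).trans hθ

lemma measurableSet_l1Ball (c : Vec d) (r : ℝ) : MeasurableSet (l1Ball c r) :=
  (isCompact_l1Ball c r).measurableSet

lemma l1Ball_combo {c u v : Vec d} {r s w : ℝ} (hu : u ∈ l1Ball c r) (hv : v ∈ l1Ball c s)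
    (hw0 : 0 ≤ w) (hw1 : w ≤ 1) : (1 - w) • u + w • v ∈ l1Ball c ((1 - w) * r + w * s) := by
  have e : (1 - w) • u + w • v - c = (1 - w) • (u - c) + w • (v - c) := by module
  change l1Norm _ ≤ _
  rw [e]
  refine (l1Norm_add_le _ _).trans ?_
  rw [l1Norm_smul, l1Norm_smul, abs_of_nonneg hw0, abs_of_nonneg (by linarith : 0 ≤ 1 - w)]
  exact add_le_add (mul_le_mul_of_nonneg_left hu (by linarith)) (mul_le_mul_of_nonneg_left hv hw0)

lemma l1Ball_midpoint {c u v : Vec d} {r : ℝ} (hu : u ∈ l1Ball c r) (hv : v ∈ l1Ball c r) :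
    (1 / 2 : ℝ) • (u + v) ∈ l1Ball c r := by
  have h := l1Ball_combo hu hv (by norm_num : (0 : ℝ) ≤ 1 / 2) (by norm_num)
  have e : (1 / 2 : ℝ) • (u + v) = (1 - 1 / 2 : ℝ) • u + (1 / 2 : ℝ) • v := by module
  rw [e, show r = (1 - 1 / 2) * r + 1 / 2 * r by ring]
  exact h

/-! ### The proximal step -/

/-- A minimizer of a midpoint strongly convex function enjoys the full quadratic growth. -/
lemma quadratic_growth_of_midpoint {ψ : Vec d → ℝ} {S : Set (Vec d)} {γ : ℝ}
    (hS : ∀ u ∈ S, ∀ v ∈ S, (1 / 2 : ℝ) • (u + v) ∈ S)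
    (hψ : ∀ u v, ψ ((1 / 2 : ℝ) • (u + v)) ≤ (ψ u + ψ v) / 2 - γ * (l1Norm (u - v) ^ 2 / 8))
    {m : Vec d} (hm : m ∈ S) (hmin : ∀ θ ∈ S, ψ m ≤ ψ θ) {θ : Vec d} (hθ : θ ∈ S) :
    ψ m + γ / 2 * l1Norm (θ - m) ^ 2 ≤ ψ θ := by
  -- One comparison with the midpoint yields half of the constant. Applying the bound at the
  -- midpoint of `θ` and `m` maps a fraction `a` to `(1 + a) / 2`, whose iterates from 0 tend to 1.
  have key : ∀ n : ℕ, ∀ θ ∈ S, ψ m + γ / 2 * (1 - (1 / 2) ^ n) * l1Norm (θ - m) ^ 2 ≤ ψ θ := by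
    intro n
    induction n with
    | zero => intro θ hθ; simpa using hmin θ hθ
    | succ n ih =>
      intro θ hθ
      have h1 := ih _ (hS θ hθ m hm)
      have h2 := hψ θ m
      have e : (1 / 2 : ℝ) • (θ + m) - m = (1 / 2 : ℝ) • (θ - m) := by module
      rw [e, l1Norm_smul, abs_of_pos (by norm_num : (0 : ℝ) < 1 / 2)] at h1
      rw [pow_succ]
      nlinarith
  have hlim : Filter.Tendsto (fun n : ℕ => ψ m + γ / 2 * (1 - (1 / 2 : ℝ) ^ n)
      * l1Norm (θ - m) ^ 2) Filter.atTop (nhds (ψ m + γ / 2 * (1 - 0) * l1Norm (θ - m) ^ 2)) :=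
    (((tendsto_const_nhds.sub (tendsto_pow_atTop_nhds_zero_of_lt_one (by norm_num)
      (by norm_num))).const_mul _).mul_const _).const_add _
  rw [sub_zero, mul_one] at hlim
  exact le_of_tendsto' hlim fun n => key n θ hθ

/-- The proximal step of dual averaging. -/
noncomputable def proxStep (c : Vec d) (r γ : ℝ) (s : Vec d) : Vec d :=
  argminOn (fun θ => inner ℝ s θ + γ * proxFun (θ - c)) (l1Ball c r)

lemma proxStep_spec (hd : 3 ≤ d) (c : Vec d) {r : ℝ} (hr : 0 ≤ r) (γ : ℝ) (s : Vec d) :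
    proxStep c r γ s ∈ l1Ball c r ∧ ∀ θ ∈ l1Ball c r,
      inner ℝ s (proxStep c r γ s) + γ * proxFun (proxStep c r γ s - c)
        ≤ inner ℝ s θ + γ * proxFun (θ - c) := by
  refine Classical.epsilon_spec (p := fun θ => θ ∈ l1Ball c r ∧ ∀ θ' ∈ l1Ball c r,
    inner ℝ s θ + γ * proxFun (θ - c) ≤ inner ℝ s θ' + γ * proxFun (θ' - c)) ?_
  have hcont : Continuous fun θ : Vec d => (inner ℝ s θ : ℝ) + γ * proxFun (θ - c) :=
    (by fun_prop : Continuous fun θ : Vec d => (inner ℝ s θ : ℝ)).add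
      (continuous_const.mul ((continuous_proxFun hd).comp (continuous_id.sub continuous_const)))
  have hne : (l1Ball c r).Nonempty := ⟨c, by simpa [l1Ball, l1Norm_zero] using hr⟩
  obtain ⟨x, hx, hmin⟩ := (isCompact_l1Ball c r).exists_isMinOn hne hcont.continuousOn
  exact ⟨x, hx, fun θ hθ => hmin hθ⟩

lemma proxObjective_midpoint (hd : 3 ≤ d) (c s : Vec d) {γ : ℝ} (hγ : 0 ≤ γ) (u v : Vec d) :
    (inner ℝ s ((1 / 2 : ℝ) • (u + v)) : ℝ) + γ * proxFun ((1 / 2 : ℝ) • (u + v) - c)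
      ≤ ((inner ℝ s u + γ * proxFun (u - c)) + (inner ℝ s v + γ * proxFun (v - c))) / 2
        - γ * (l1Norm (u - v) ^ 2 / 8) := by
  have h := proxFun_midpoint hd (u - c) (v - c)
  have e : (1 / 2 : ℝ) • (u - c + (v - c)) = (1 / 2 : ℝ) • (u + v) - c := by module
  rw [e, sub_sub_sub_cancel_right] at h
  rw [inner_smul_right, inner_add_right]
  nlinarith

lemma proxStep_growth (hd : 3 ≤ d) (c : Vec d) {r : ℝ} (hr : 0 ≤ r) {γ : ℝ} (hγ : 0 ≤ γ)
    (s : Vec d) {θ : Vec d} (hθ : θ ∈ l1Ball c r) :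
    inner ℝ s (proxStep c r γ s) + γ * proxFun (proxStep c r γ s - c)
      + γ / 2 * l1Norm (θ - proxStep c r γ s) ^ 2 ≤ inner ℝ s θ + γ * proxFun (θ - c) := by
  obtain ⟨h1, h2⟩ := proxStep_spec hd c hr γ s
  exact quadratic_growth_of_midpoint (ψ := fun θ => inner ℝ s θ + γ * proxFun (θ - c))
    (fun u hu v hv => l1Ball_midpoint hu hv) (proxObjective_midpoint hd c s hγ) h1 h2 hθ

/-- Each minimizer, translated to the other centre, is a competitor there. Adding the two quadratic
growth bounds cancels the prox terms. This one estimate gives uniqueness, translation equivariance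
and continuity in `s`. -/
lemma l1Norm_proxStep_sub_le (hd : 3 ≤ d) (c c' : Vec d) {r : ℝ} (hr : 0 ≤ r) {γ : ℝ}
    (hγ : 0 < γ) (s s' : Vec d) :
    γ * l1Norm ((proxStep c r γ s - c) - (proxStep c' r γ s' - c')) ≤ l1Norm (s - s') := by
  obtain ⟨m1, -⟩ := proxStep_spec hd c hr γ s
  obtain ⟨m2, -⟩ := proxStep_spec hd c' hr γ s'
  have h1 := proxStep_growth hd c hr hγ.le s (θ := proxStep c' r γ s' - c' + c)
    (by simpa [l1Ball] using m2)
  have h2 := proxStep_growth hd c' hr hγ.le s' (θ := proxStep c r γ s - c + c')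
    (by simpa [l1Ball] using m1)
  set m := proxStep c r γ s
  set m' := proxStep c' r γ s'
  have e1 : m' - c' + c - m = -((m - c) - (m' - c')) := by abel
  have e2 : m - c + c' - m' = (m - c) - (m' - c') := by abel
  rw [e1, l1Norm_neg, add_sub_cancel_right] at h1
  rw [e2, add_sub_cancel_right] at h2
  simp only [inner_add_right, inner_sub_right] at h1 h2
  have h3 : γ * l1Norm ((m - c) - (m' - c')) ^ 2
      ≤ -(inner ℝ (s - s') ((m - c) - (m' - c'))) := by
    simp only [inner_sub_right, inner_sub_left]; linarith
  have h4 := abs_inner_le (s := s - s') (b := l1Norm (s - s'))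
    (fun j => Finset.single_le_sum (f := fun j => |(s - s') j|) (fun _ _ => abs_nonneg _)
      (Finset.mem_univ j)) ((m - c) - (m' - c'))
  have h5 := (neg_le_abs _).trans h4
  rcases (l1Norm_nonneg ((m - c) - (m' - c'))).eq_or_lt with h0 | h0
  · rw [← h0, mul_zero]; exact l1Norm_nonneg _
  · nlinarith

/-- Equal slopes force equal centred minimizers, so the arbitrary choice in `argminOn` is harmless.
Measurability in both centre and slope then reduces to continuity in the slope at centre 0. -/
lemma proxStep_eq_add (hd : 3 ≤ d) (c : Vec d) {r : ℝ} (hr : 0 ≤ r) {γ : ℝ} (hγ : 0 < γ)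
    (s : Vec d) : proxStep c r γ s = c + proxStep 0 r γ s := by
  have h := l1Norm_proxStep_sub_le hd c 0 hr hγ s s
  rw [sub_self, l1Norm_zero] at h
  have h0 : l1Norm ((proxStep c r γ s - c) - (proxStep 0 r γ s - 0)) = 0 :=
    le_antisymm (by nlinarith) (l1Norm_nonneg _)
  have := l1Norm_eq_zero h0
  rw [sub_zero, sub_eq_zero] at this
  rw [← this]; abel

lemma continuous_proxStep_zero (hd : 3 ≤ d) {r : ℝ} (hr : 0 ≤ r) {γ : ℝ} (hγ : 0 < γ) :
    Continuous (proxStep (0 : Vec d) r γ) := by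
  rw [continuous_iff_continuousAt]
  intro s
  rw [ContinuousAt, tendsto_iff_norm_sub_tendsto_zero]
  have hlim : Filter.Tendsto (fun s' => γ⁻¹ * l1Norm (s' - s)) (nhds s) (nhds 0) := by
    have : Continuous fun s' => γ⁻¹ * l1Norm (s' - s) :=
      continuous_const.mul (continuous_l1Norm.comp (continuous_id.sub continuous_const))
    simpa [l1Norm_zero] using this.tendsto s
  refine squeeze_zero (fun _ => norm_nonneg _) (fun s' => ?_) hlim
  have h := l1Norm_proxStep_sub_le hd 0 0 hr hγ s' s
  rw [sub_zero, sub_zero] at h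
  rw [← div_eq_inv_mul, le_div_iff₀ hγ]
  nlinarith [norm_le_l1Norm (proxStep 0 r γ s' - proxStep 0 r γ s)]

lemma measurable_proxStep (hd : 3 ≤ d) {r : ℝ} (hr : 0 ≤ r) {γ : ℝ} (hγ : 0 < γ)
    {α : Type*} [MeasurableSpace α] {c s : α → Vec d} (hc : Measurable c) (hs : Measurable s) :
    Measurable fun a => proxStep (c a) r γ (s a) := by
  have : (fun a => proxStep (c a) r γ (s a)) = fun a => c a + proxStep 0 r γ (s a) :=
    funext fun a => proxStep_eq_add hd (c a) hr hγ (s a)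
  rw [this]
  exact hc.add ((continuous_proxStep_zero hd hr hγ).measurable.comp hs)

end AMDA

namespace AMDA

variable {d : ℕ}

/-! ### Dual averaging -/

lemma proxFun_nonneg (hd : 3 ≤ d) (u : Vec d) : 0 ≤ proxFun u := by
  have := one_lt_log_of_three_le hd
  unfold proxFun
  positivity

lemma half_l1Norm_sq_le_proxFun (hd : 3 ≤ d) (u : Vec d) : l1Norm u ^ 2 / 2 ≤ proxFun u := by
  have h := quadratic_growth_of_midpoint (ψ := proxFun) (S := Set.univ) (γ := 1)
    (fun _ _ _ _ => Set.mem_univ _) (fun u v => by simpa using proxFun_midpoint hd u v)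
    (Set.mem_univ (0 : Vec d)) (fun θ _ => by rw [proxFun_zero hd]; exact proxFun_nonneg hd θ)
    (Set.mem_univ u)
  rw [proxFun_zero hd, sub_zero] at h
  linarith

lemma l1Norm_sub_le_two_mul {c u v : Vec d} {r : ℝ} (hu : u ∈ l1Ball c r) (hv : v ∈ l1Ball c r) :
    l1Norm (u - v) ≤ 2 * r := by
  have h := l1Norm_sub_le u c v
  rw [l1Norm_sub_comm c v] at h
  have h1 : l1Norm (u - c) ≤ r := hu
  have h2 : l1Norm (v - c) ≤ r := hv
  linarith

lemma sum_inv_sqrt_le (T : ℕ) (hT : 1 ≤ T) :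
    ∑ i ∈ Finset.range T, 1 / Real.sqrt (i + 1) ≤ 2 * Real.sqrt T - 1 := by
  induction T, hT using Nat.le_induction with
  | base => norm_num
  | succ n _ ih =>
    rw [Finset.sum_range_succ]
    have h1 : 0 < Real.sqrt (n + 1) := Real.sqrt_pos.2 (by positivity)
    have h2 : 0 ≤ Real.sqrt n := Real.sqrt_nonneg _
    have h3 : Real.sqrt (n + 1) ^ 2 = n + 1 := Real.sq_sqrt (by positivity)
    have h4 : Real.sqrt n ^ 2 = n := Real.sq_sqrt (by positivity)
    have h5 : 1 / Real.sqrt (n + 1) ≤ 2 * (Real.sqrt (n + 1) - Real.sqrt n) := by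
      rw [div_le_iff₀ h1]
      nlinarith [sq_nonneg (Real.sqrt (n + 1) - Real.sqrt n)]
    push_cast
    linarith

/-- The estimate-sequence invariant of dual averaging with inexact gradients `s i`. -/
lemma dualAveraging_invariant (hd : 3 ≤ d) {c : Vec d} {r ε M : ℝ} (hr : 0 < r)
    {f : Vec d → ℝ} {T : ℕ} {θ g s : ℕ → Vec d} (h0 : θ 0 = c)
    (hstep : ∀ t < T, θ (t + 1) = (1 - 1 / ((t : ℝ) + 2)) • θ t
      + (1 / ((t : ℝ) + 2)) • proxStep c r (Real.sqrt (t + 1)) (r • ∑ i ∈ Finset.range (t + 1), s i))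
    (hmem : ∀ t ≤ T, θ t ∈ l1Ball c r)
    (hsub : ∀ t ≤ T, ∀ v ∈ l1Ball c r, f (θ t) + inner ℝ (g t) (v - θ t) ≤ f v)
    (hg : ∀ t ≤ T, ∀ j, |g t j| ≤ M) (hs : ∀ t ≤ T, ∀ j, |(s t - g t) j| ≤ ε) :
    ∀ t ≤ T, ∀ v ∈ l1Ball c r,
      ((t : ℝ) + 1) * r * f (θ t)
        ≤ r * (∑ i ∈ Finset.range (t + 1), (f (θ i) + inner ℝ (s i) (v - θ i)))
          + Real.sqrt (t + 1) * proxFun (v - c)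
          + (M ^ 2 * r ^ 2 * (1 / 2 + 1 / 2 * ∑ i ∈ Finset.range t, 1 / Real.sqrt (i + 1))
            + 2 * r ^ 2 * ε * (t + 1)) := by
  intro t
  have herr : ∀ t ≤ T, ∀ v ∈ l1Ball c r, -(2 * r * ε) ≤ (inner ℝ (s t - g t) (v - θ t) : ℝ) := by
    intro t ht v hv
    have h1 := abs_inner_le (hs t ht) (v - θ t)
    have h2 := l1Norm_sub_le_two_mul hv (hmem t ht)
    have h3 := neg_le_of_abs_le h1
    rcases Nat.eq_zero_or_pos d with h | h
    · omega
    · have : 0 ≤ ε := (abs_nonneg _).trans (hs t ht ⟨0, h⟩)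
      nlinarith [l1Norm_nonneg (v - θ t)]
  have hlip : ∀ t ≤ T, ∀ w : Vec d, -(M * l1Norm w) ≤ (inner ℝ (g t) w : ℝ) := fun t ht w =>
    neg_le_of_abs_le (abs_inner_le (hg t ht) w)
  induction t with
  | zero =>
    intro h v hv
    have e1 := herr 0 h v hv
    have e2 := hlip 0 h (v - θ 0)
    have e3 := half_l1Norm_sq_le_proxFun hd (v - c)
    rw [inner_sub_left] at e1
    simp only [Finset.range_zero, Finset.sum_empty, zero_add, Finset.sum_range_one, Nat.cast_zero,
      Real.sqrt_one]
    have e4 : 0 ≤ (r * M - l1Norm (v - c)) ^ 2 := sq_nonneg _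
    rw [h0] at *
    nlinarith
  | succ t ih =>
    intro ht v hv
    have hsq : 0 < Real.sqrt ((t : ℝ) + 1) := Real.sqrt_pos.2 (by positivity)
    set S := r • ∑ i ∈ Finset.range (t + 1), s i with hS
    set q := Real.sqrt ((t : ℝ) + 1) with hq
    have hθ := hstep t (by omega)
    have hgrow := proxStep_growth hd c hr.le hsq.le S hv
    have hp := (proxStep_spec hd c hr.le q S).1
    set m := proxStep c r q S with hm
    -- The invariant is used at the prox minimizer `m` only. The growth `hgrow` of the prox
    -- objective carries it to every `v`, with a gain of `q / 2 * ‖v - m‖₁²`.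
    have H1 := ih (by omega) m hp
    have hlin : r * (∑ i ∈ Finset.range (t + 1), (f (θ i) + inner ℝ (s i) (v - θ i)))
        - r * (∑ i ∈ Finset.range (t + 1), (f (θ i) + inner ℝ (s i) (m - θ i)))
        = inner ℝ S v - inner ℝ S m := by
      rw [← mul_sub, ← Finset.sum_sub_distrib, ← inner_sub_right, hS, inner_smul_left, sum_inner]
      simp only [conj_trivial]
      congr 1
      refine Finset.sum_congr rfl fun i _ => ?_
      rw [inner_sub_right, inner_sub_right, inner_sub_right]; ring
    have H4 := hsub (t + 1) ht (θ t) (hmem t (by omega))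
    -- `θ (t + 1)` is the average of `θ t` and `m` with weights `t + 1` and `1`. The subgradient
    -- inequality towards `θ t` thus cancels all of the new linear term except `⟨g, v - m⟩`.
    have e5 : v - θ (t + 1) = (v - m) - ((t : ℝ) + 1) • (θ t - θ (t + 1)) := by
      have h2 : (t : ℝ) + 2 ≠ 0 := by positivity
      have : ((t : ℝ) + 2) • θ (t + 1) = ((t : ℝ) + 1) • θ t + m := by
        rw [hθ, smul_add, smul_smul, smul_smul, mul_one_div_cancel h2, one_smul]
        congr 2
        field_simp; ring
      have e : m = ((t : ℝ) + 2) • θ (t + 1) - ((t : ℝ) + 1) • θ t := by rw [this]; abel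
      rw [e]; module
    have H5 : (inner ℝ (g (t + 1)) (v - θ (t + 1)) : ℝ)
        = inner ℝ (g (t + 1)) (v - m) - ((t : ℝ) + 1) * inner ℝ (g (t + 1)) (θ t - θ (t + 1)) := by
      rw [e5, inner_sub_right, inner_smul_right]
    have H6 := hlip (t + 1) ht (v - m)
    have H7 := herr (t + 1) ht v hv
    rw [inner_sub_left] at H7
    have H8 : q * proxFun (v - c) ≤ Real.sqrt ((t : ℝ) + 1 + 1) * proxFun (v - c) :=
      mul_le_mul_of_nonneg_right (Real.sqrt_le_sqrt (by linarith)) (proxFun_nonneg hd _)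
    -- Young's inequality: the remaining `⟨g, v - m⟩` is paid by the quadratic gain, at the cost of
    -- a summand of order `1 / √(t + 1)`.
    have H9 : r * (M * l1Norm (v - m))
        ≤ M ^ 2 * r ^ 2 * (1 / 2 * (1 / q)) + q / 2 * l1Norm (v - m) ^ 2 := by
      have e : M ^ 2 * r ^ 2 * (1 / 2 * (1 / q)) + q / 2 * l1Norm (v - m) ^ 2
          - r * (M * l1Norm (v - m)) = (r * M - q * l1Norm (v - m)) ^ 2 / (2 * q) := by
        field_simp; ring
      have : 0 ≤ (r * M - q * l1Norm (v - m)) ^ 2 / (2 * q) := by positivity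
      linarith
    rw [Finset.sum_range_succ, Finset.sum_range_succ (fun i => 1 / Real.sqrt ((i : ℝ) + 1))]
    push_cast
    rw [← hq]
    have H4' := mul_le_mul_of_nonneg_left H4 (by positivity : 0 ≤ ((t : ℝ) + 1) * r)
    have H6' := mul_le_mul_of_nonneg_left H6 hr.le
    have H7' := mul_le_mul_of_nonneg_left H7 hr.le
    have H5' := congrArg (fun x => r * x) H5
    nlinarith

/-- Convergence of dual averaging with inexact gradients. -/
lemma dualAveraging_convergence (hd : 3 ≤ d) {c θs : Vec d} {r ε M : ℝ} (hr : 0 < r) (hε : 0 ≤ ε)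
    {f : Vec d → ℝ} {T : ℕ} (hT : 1 ≤ T) {θ g s : ℕ → Vec d} (h0 : θ 0 = c)
    (hstep : ∀ t < T, θ (t + 1) = (1 - 1 / ((t : ℝ) + 2)) • θ t
      + (1 / ((t : ℝ) + 2)) • proxStep c r (Real.sqrt (t + 1)) (r • ∑ i ∈ Finset.range (t + 1), s i))
    (hmem : ∀ t ≤ T, θ t ∈ l1Ball c r)
    (hsub : ∀ t ≤ T, ∀ v ∈ l1Ball c r, f (θ t) + inner ℝ (g t) (v - θ t) ≤ f v)
    (hg : ∀ t ≤ T, ∀ j, |g t j| ≤ M) (hs : ∀ t ≤ T, ∀ j, |(s t - g t) j| ≤ ε)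
    (hθs : θs ∈ l1Ball c r) (hlong : nu d + M ^ 2 ≤ ε * Real.sqrt T) :
    f (θ T) - f θs ≤ 5 * r * ε := by
  have key := dualAveraging_invariant hd hr h0 hstep hmem hsub hg hs T le_rfl θs hθs
  have hω : proxFun (θs - c) ≤ nu d * r ^ 2 := by
    have h1 : l1Norm (θs - c) ^ 2 ≤ r ^ 2 := pow_le_pow_left₀ (l1Norm_nonneg _) hθs 2
    have h2 := one_lt_log_of_three_le hd
    have h3 : 0 ≤ nu d := by unfold nu; positivity
    exact (proxFun_le hd _).trans (mul_le_mul_of_nonneg_left h1 h3)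
  -- At `v = θs` the linear models lie below `f θs` up to the gradient error times the diameter
  -- `2r`: a share `2rε`, besides the `2rε` already in the invariant.
  have hsum : ∑ i ∈ Finset.range (T + 1), (f (θ i) + inner ℝ (s i) (θs - θ i))
      ≤ ((T : ℝ) + 1) * (f θs + 2 * r * ε) := by
    have : ∀ i ∈ Finset.range (T + 1), f (θ i) + (inner ℝ (s i) (θs - θ i) : ℝ)
        ≤ f θs + 2 * r * ε := by
      intro i hi
      have hi : i ≤ T := by simpa [Nat.lt_succ_iff] using hi
      have h1 := hsub i hi θs hθs
      have h2 := (le_abs_self _).trans (abs_inner_le (hs i hi) (θs - θ i))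
      have h3 := l1Norm_sub_le_two_mul hθs (hmem i hi)
      rw [inner_sub_left] at h2
      nlinarith
    refine (Finset.sum_le_card_nsmul _ _ _ this).trans ?_
    rw [Finset.card_range, nsmul_eq_mul]; push_cast; rfl
  have hroot := sum_inv_sqrt_le T hT
  have hT' : (1 : ℝ) ≤ T := by exact_mod_cast hT
  set q := Real.sqrt T with hq
  have hq2 : q ^ 2 = T := Real.sq_sqrt (by positivity)
  have hq1 : 1 ≤ q := Real.one_le_sqrt.2 hT'
  set q' := Real.sqrt ((T : ℝ) + 1) with hq'
  have hq'2 : q' ^ 2 = T + 1 := Real.sq_sqrt (by positivity)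
  have hqq' : q ≤ q' := Real.sqrt_le_sqrt (by linarith)
  have hν : 0 ≤ nu d := by
    have h2 := one_lt_log_of_three_le hd
    unfold nu; positivity
  have h1 : q' * proxFun (θs - c) ≤ q' * (nu d * r ^ 2) :=
    mul_le_mul_of_nonneg_left hω (by linarith)
  -- The last share `rε` of `5rε`: this is where the length of the stage makes the optimization
  -- error no larger than the gradient error.
  have h2 : q' * nu d + M ^ 2 * q ≤ ((T : ℝ) + 1) * ε := by
    have h3 : q' * nu d + M ^ 2 * q ≤ q' * (nu d + M ^ 2) := by nlinarith [sq_nonneg M]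
    have h4 : q' * (nu d + M ^ 2) ≤ q' * (ε * q) :=
      mul_le_mul_of_nonneg_left hlong (by linarith)
    have h5 : q' * (ε * q) ≤ q' * (ε * q') := by gcongr
    nlinarith
  have h6 : M ^ 2 * r ^ 2 * (1 / 2 + 1 / 2 * ∑ i ∈ Finset.range T, 1 / Real.sqrt (i + 1))
      ≤ M ^ 2 * r ^ 2 * q := by
    apply mul_le_mul_of_nonneg_left _ (by positivity)
    linarith
  have h7 := mul_le_mul_of_nonneg_left hsum hr.le
  have h8 := mul_le_mul_of_nonneg_left h2 (sq_nonneg r)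
  have h9 : ((T : ℝ) + 1) * r * (f (θ T) - f θs) ≤ ((T : ℝ) + 1) * r * (5 * r * ε) := by
    nlinarith
  exact le_of_mul_le_mul_left h9 (by positivity)

end AMDA

namespace AMDA

variable {d : ℕ}

/-! ### Sparsification -/

/-- The restriction of a vector to a set of coordinates. -/
noncomputable def restrict (T : Finset (Fin d)) (θ : Vec d) : Vec d :=
  WithLp.toLp 2 fun j => if j ∈ T then θ j else 0

lemma restrict_apply (T : Finset (Fin d)) (θ : Vec d) (j : Fin d) :
    restrict T θ j = if j ∈ T then θ j else 0 := rfl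

lemma nnz_restrict_le (T : Finset (Fin d)) (θ : Vec d) : nnz (restrict T θ) ≤ T.card := by
  refine Finset.card_le_card fun j hj => ?_
  by_contra h
  simp [restrict_apply, h] at hj

lemma l1Norm_restrict_sub (T : Finset (Fin d)) (θ : Vec d) :
    l1Norm (restrict T θ - θ) = l1Norm θ - ∑ j ∈ T, |θ j| := by
  rw [eq_sub_iff_add_eq, l1Norm, l1Norm, ← Finset.sum_add_sum_compl T (fun j => |θ j|),
    ← Finset.sum_add_sum_compl T]
  have h1 : ∑ j ∈ T, |(restrict T θ - θ) j| = 0 :=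
    Finset.sum_eq_zero fun j hj => by simp [restrict_apply, hj]
  have h2 : ∑ j ∈ Tᶜ, |(restrict T θ - θ) j| = ∑ j ∈ Tᶜ, |θ j| :=
    Finset.sum_congr rfl fun j hj => by
      have : j ∉ T := by simpa using hj
      simp [restrict_apply, this]
  rw [h1, h2]; ring

/-- An exchange argument. Every value on `S` is at least the largest value `a m` on `T \ S`, since
otherwise a swap would improve `S`. Then `a m` times the sums over `T \ S` and `S \ T` separates the
two sums of squares. -/
lemma sum_sq_le_sum_sq_of_top {ι : Type*} [DecidableEq ι] {S T : Finset ι} {k : ℕ} {a : ι → ℝ}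
    (ha : ∀ i, 0 ≤ a i) (hS : S.card ≤ k) (hT : T.card ≤ k)
    (htop : ∀ T : Finset ι, T.card ≤ k → ∑ j ∈ T, a j ≤ ∑ j ∈ S, a j) :
    ∑ j ∈ T, a j ^ 2 ≤ ∑ j ∈ S, a j ^ 2 := by
  have hcomm : T ∩ S = S ∩ T := Finset.inter_comm _ _
  have hST := htop T hT
  rw [← Finset.sum_inter_add_sum_sdiff T S, ← Finset.sum_inter_add_sum_sdiff S T, hcomm] at hST ⊢
  rcases (T \ S).eq_empty_or_nonempty with h | h
  · rw [h]
    simp only [Finset.sum_empty, add_zero, le_add_iff_nonneg_right]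
    exact Finset.sum_nonneg fun _ _ => sq_nonneg _
  obtain ⟨m, hm, hmax⟩ := (T \ S).exists_max_image a h
  have hmS : m ∉ S := (Finset.mem_sdiff.1 hm).2
  have hge : ∀ i ∈ S, a m ≤ a i := by
    intro i hi
    have hm' : m ∉ S.erase i := fun hx => hmS (Finset.mem_of_mem_erase hx)
    have := htop (insert m (S.erase i)) (by
      rw [Finset.card_insert_of_notMem hm', Finset.card_erase_add_one hi]; exact hS)
    rw [Finset.sum_insert hm', ← Finset.add_sum_erase S a hi] at this
    linarith
  have h1 : ∑ j ∈ T \ S, a j ^ 2 ≤ a m * ∑ j ∈ T \ S, a j := by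
    rw [Finset.mul_sum]
    exact Finset.sum_le_sum fun j hj => by nlinarith [hmax j hj, ha j]
  have h2 : a m * ∑ j ∈ S \ T, a j ≤ ∑ j ∈ S \ T, a j ^ 2 := by
    rw [Finset.mul_sum]
    exact Finset.sum_le_sum fun j hj => by nlinarith [hge j (Finset.mem_sdiff.1 hj).1, ha j]
  have h3 : a m * ∑ j ∈ T \ S, a j ≤ a m * ∑ j ∈ S \ T, a j :=
    mul_le_mul_of_nonneg_left (by linarith) (ha m)
  linarith

/-- An `ℓ₁`-closest sparse vector is also an `ℓ₂`-closest one. -/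
lemma IsSparsifier.norm_sub_le {k : ℕ} {H : Vec d → Vec d} (hH : IsSparsifier k H) (θ v : Vec d)
    (hv : nnz v ≤ k) : ‖H θ - θ‖ ≤ ‖v - θ‖ := by
  classical
  set S := Finset.univ.filter fun j => H θ j ≠ 0 with hS
  have hScard : S.card ≤ k := hH.sparse θ
  have hclose : ∀ T : Finset (Fin d), T.card ≤ k →
      l1Norm (H θ - θ) ≤ l1Norm θ - ∑ j ∈ T, |θ j| := fun T hT => by
    rw [← l1Norm_restrict_sub]
    exact hH.closest θ _ ((nnz_restrict_le T θ).trans hT)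
  have hoff : ∀ j ∈ Sᶜ, (H θ - θ) j = -θ j := fun j hj => by
    have : H θ j = 0 := by simpa [hS] using hj
    simp [this]
  have hsplit : l1Norm (H θ - θ)
      = ∑ j ∈ S, |(H θ - θ) j| + (l1Norm θ - ∑ j ∈ S, |θ j|) := by
    have e : l1Norm θ - ∑ j ∈ S, |θ j| = ∑ j ∈ Sᶜ, |θ j| := by
      rw [l1Norm, ← Finset.sum_add_sum_compl S]; ring
    rw [e, l1Norm, ← Finset.sum_add_sum_compl S]
    congr 1
    exact Finset.sum_congr rfl fun j hj => by rw [hoff j hj, abs_neg]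
  -- The restriction of `θ` to the support of `H θ` is itself a competitor. Hence `H θ` agrees with
  -- `θ` there, and that support carries the largest `ℓ₁` mass.
  have hon : ∑ j ∈ S, |(H θ - θ) j| = 0 :=
    le_antisymm (by linarith [hclose S hScard]) (Finset.sum_nonneg fun _ _ => abs_nonneg _)
  rw [hon, zero_add] at hsplit
  have htop : ∀ T : Finset (Fin d), T.card ≤ k → ∑ j ∈ T, |θ j| ≤ ∑ j ∈ S, |θ j| := fun T hT => by
    linarith [hclose T hT]
  set T := Finset.univ.filter fun j => v j ≠ 0 with hT
  have hsq := sum_sq_le_sum_sq_of_top (fun j => abs_nonneg (θ j)) hScard (T := T) hv htop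
  simp only [sq_abs] at hsq
  rw [EuclideanSpace.norm_eq, EuclideanSpace.norm_eq]
  refine Real.sqrt_le_sqrt ?_
  simp only [Real.norm_eq_abs, sq_abs]
  have h1 : ∑ j, (H θ - θ) j ^ 2 = ∑ j, θ j ^ 2 - ∑ j ∈ S, θ j ^ 2 := by
    rw [← Finset.sum_add_sum_compl S (fun j => θ j ^ 2), ← Finset.sum_add_sum_compl S]
    have e1 : ∑ j ∈ S, (H θ - θ) j ^ 2 = 0 := Finset.sum_eq_zero fun j hj => by
      have := (Finset.sum_eq_zero_iff_of_nonneg fun _ _ => abs_nonneg _).1 hon j hj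
      rw [abs_eq_zero.1 this]; simp
    have e2 : ∑ j ∈ Sᶜ, (H θ - θ) j ^ 2 = ∑ j ∈ Sᶜ, θ j ^ 2 :=
      Finset.sum_congr rfl fun j hj => by rw [hoff j hj, neg_sq]
    rw [e1, e2]; ring
  have h2 : ∑ j, θ j ^ 2 - ∑ j ∈ T, θ j ^ 2 ≤ ∑ j, (v - θ) j ^ 2 := by
    rw [← Finset.sum_add_sum_compl T (fun j => θ j ^ 2), ← Finset.sum_add_sum_compl T]
    have e1 : 0 ≤ ∑ j ∈ T, (v - θ) j ^ 2 := Finset.sum_nonneg fun _ _ => sq_nonneg _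
    have e2 : ∑ j ∈ Tᶜ, (v - θ) j ^ 2 = ∑ j ∈ Tᶜ, θ j ^ 2 :=
      Finset.sum_congr rfl fun j hj => by
        have : v j = 0 := by simpa [hT] using hj
        simp [this]
    rw [e2]; linarith
  rw [h1]
  linarith

lemma l1Norm_le_sqrt_nnz_mul_norm (x : Vec d) : l1Norm x ≤ Real.sqrt (nnz x) * ‖x‖ := by
  classical
  set S := Finset.univ.filter fun j => x j ≠ 0 with hS
  have h1 : l1Norm x = ∑ j ∈ S, |x j| := by
    refine (Finset.sum_subset (Finset.subset_univ S) fun j _ hj => ?_).symm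
    have : x j = 0 := by simpa [hS] using hj
    simp [this]
  have h2 : ∑ j ∈ S, |x j| ^ 2 ≤ ‖x‖ ^ 2 := by
    rw [EuclideanSpace.norm_eq, Real.sq_sqrt (Finset.sum_nonneg fun _ _ => sq_nonneg _)]
    exact Finset.sum_le_sum_of_subset_of_nonneg (Finset.subset_univ _) fun _ _ _ => sq_nonneg _
  have h3 : (∑ j ∈ S, |x j|) ^ 2 ≤ S.card * ∑ j ∈ S, |x j| ^ 2 := sq_sum_le_card_mul_sum_sq
  refine le_of_sq_le_sq ?_ (by positivity)
  rw [h1, mul_pow, Real.sq_sqrt (by positivity)]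
  exact h3.trans (mul_le_mul_of_nonneg_left h2 (by positivity))

lemma nnz_sub_le (u v : Vec d) : nnz (u - v) ≤ nnz u + nnz v := by
  classical
  refine (Finset.card_le_card ?_).trans (Finset.card_union_le _ _)
  intro j hj
  by_contra h
  simp only [Finset.mem_union, Finset.mem_filter, Finset.mem_univ, true_and, not_or,
    not_not] at h
  exact (Finset.mem_filter.1 hj).2 (by rw [PiLp.sub_apply, h.1, h.2, sub_zero])

lemma IsSparsifier.l1Norm_sub_le {k : ℕ} {H : Vec d → Vec d} (hH : IsSparsifier k H)
    {θ θs : Vec d} (hθs : nnz θs ≤ k) : l1Norm (H θ - θs) ≤ Real.sqrt (2 * k) * ‖H θ - θs‖ := by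
  refine (l1Norm_le_sqrt_nnz_mul_norm _).trans ?_
  gcongr
  have := nnz_sub_le (H θ) θs
  have h2 := hH.sparse θ
  exact_mod_cast (by omega : nnz (H θ - θs) ≤ 2 * k)

/-- Distance to the optimum after sparsifying a point with small excess risk. -/
lemma IsSparsifier.norm_sub_le_of_excess {k : ℕ} (hk : 1 ≤ k) {H : Vec d → Vec d}
    (hH : IsSparsifier k H) {θ θs : Vec d} (hθs : nnz θs ≤ k) {κ lam ε r D : ℝ} (hκ : 0 < κ)
    (hlam : 0 < lam) (hε : 0 < ε) (hr : 0 < r)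
    (hgrowth : κ * ‖θ - θs‖ ^ 2 / (lam + ‖θ - θs‖) ≤ D) (hD : D ≤ 5 * r * ε) :
    Real.sqrt (2 * k) * ‖H θ - θs‖
      ≤ max (tauConst k κ ε * r) (1 / 2 * (r + rStar k κ lam ε)) := by
  have hk' : (1 : ℝ) ≤ k := by exact_mod_cast hk
  set ρ := ‖θ - θs‖ with hρ
  have hρ0 : 0 ≤ ρ := norm_nonneg _
  -- `θs` is a sparse competitor, so `H θ` is at least as close to `θ` in `ℓ₂`. Its doubling
  -- produces `8 = 4 · 2` under the root in `tauConst`.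
  have h2 : ‖H θ - θs‖ ≤ 2 * ρ := by
    have h := norm_sub_le_norm_sub_add_norm_sub (H θ) θ θs
    have h' := hH.norm_sub_le θ θs hθs
    rw [norm_sub_rev θs θ] at h'
    linarith
  have e8 : Real.sqrt (8 * k) = 2 * Real.sqrt (2 * k) := by
    rw [show (8 : ℝ) * k = 2 ^ 2 * (2 * k) by ring, Real.sqrt_mul (by norm_num),
      Real.sqrt_sq (by norm_num)]
  have h3 : Real.sqrt (2 * k) * ‖H θ - θs‖ ≤ Real.sqrt (8 * k) * ρ := by
    rw [e8]; nlinarith [Real.sqrt_nonneg (2 * (k : ℝ))]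
  refine h3.trans ?_
  have hq : κ * ρ ^ 2 ≤ 5 * r * ε * (lam + ρ) := (div_le_iff₀ (by positivity)).1 (hgrowth.trans hD)
  -- For `ρ ≥ lam` the growth is at least linear, `κρ / 2`; for `ρ ≤ lam` it is at least quadratic,
  -- `κρ² / (2 lam)`.
  rcases le_total lam ρ with h | h
  · refine le_max_of_le_left ?_
    have hρpos : 0 < ρ := lt_of_lt_of_le hlam h
    have : κ * ρ ≤ 10 * r * ε := by
      have : ρ * (κ * ρ) ≤ ρ * (10 * r * ε) := by
        nlinarith [mul_le_mul_of_nonneg_left h (by positivity : 0 ≤ 5 * r * ε)]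
      exact le_of_mul_le_mul_left this hρpos
    have h5 : ρ ≤ 10 * r * ε / κ := by rw [le_div_iff₀ hκ]; linarith
    calc Real.sqrt (8 * k) * ρ ≤ Real.sqrt (8 * k) * (10 * r * ε / κ) := by gcongr
      _ = tauConst k κ ε * r := by unfold tauConst; ring
  · refine le_max_of_le_right ?_
    have h4 : κ * ρ ^ 2 ≤ 10 * lam * r * ε := by
      nlinarith [mul_le_mul_of_nonneg_left h (by positivity : 0 ≤ 5 * r * ε)]
    have h5 : ρ ^ 2 ≤ 10 * lam * r * ε / κ := by rw [le_div_iff₀ hκ]; linarith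
    have hRs : 0 ≤ rStar k κ lam ε := by unfold rStar; positivity
    refine le_of_sq_le_sq ?_ (by positivity)
    rw [mul_pow, Real.sq_sqrt (by positivity)]
    -- `rStar` is calibrated so that the squared target is at most `R⋆ r`; AM-GM then gives the
    -- arithmetic mean of the two radii.
    have h6 : 8 * k * ρ ^ 2 ≤ rStar k κ lam ε * r := by
      calc 8 * k * ρ ^ 2 ≤ 8 * k * (10 * lam * r * ε / κ) := by gcongr
        _ = rStar k κ lam ε * r := by unfold rStar; ring
    nlinarith [sq_nonneg (r - rStar k κ lam ε)]

/-! ### The radii -/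

section Radii

variable {τ Rs R : ℝ}

lemma rStar_le_stageRadius (h : Rs ≤ R) (k : ℕ) : Rs ≤ stageRadius τ Rs R k := by
  induction k with
  | zero => exact h
  | succ k ih => exact le_max_of_le_right (by linarith)

lemma stageRadius_succ_le (hτ : τ < 1) (hRs : 0 < Rs) (h : Rs ≤ R) (k : ℕ) :
    stageRadius τ Rs R (k + 1) ≤ stageRadius τ Rs R k := by
  have := rStar_le_stageRadius (τ := τ) h k
  refine max_le ?_ (by linarith)
  nlinarith

lemma stageRadius_le (hτ : τ < 1) (hRs : 0 < Rs) (h : Rs ≤ R) (k : ℕ) :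
    stageRadius τ Rs R k ≤ R :=
  antitone_nat_of_succ_le (stageRadius_succ_le hτ hRs h) (Nat.zero_le k)

lemma stageRadius_eq_of_lt {k : ℕ} (hk : ∀ i < k, ¬ τ * stageRadius τ Rs R i
      ≤ 1 / 2 * (stageRadius τ Rs R i + Rs)) : stageRadius τ Rs R k = τ ^ k * R := by
  induction k with
  | zero => simp [stageRadius]
  | succ k ih =>
    have h1 := ih fun i hi => hk i (by omega)
    have h2 := not_le.1 (hk k (by omega))
    rw [stageRadius, max_eq_left h2.le, h1]; ring

/-- Otherwise the radii equal `τ ^ k * R` for all `k` and fall below `R⋆`, which they never do. -/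
lemma exists_stageRadius_turn (hτ : τ < 1) (hRs : 0 < Rs) (h : Rs ≤ R) :
    ∃ k, τ * stageRadius τ Rs R k ≤ 1 / 2 * (stageRadius τ Rs R k + Rs) := by
  by_contra! hcon
  obtain ⟨n, hn⟩ := exists_pow_lt_of_lt_one (div_pos hRs (hRs.trans_le h)) hτ
  have h1 := stageRadius_eq_of_lt (k := n) fun i _ => not_le.2 (hcon i)
  have h2 := rStar_le_stageRadius (τ := τ) h n
  rw [lt_div_iff₀ (hRs.trans_le h)] at hn
  linarith

lemma stageRadius_add_le (hτ : τ < 1) (hRs : 0 < Rs) (h : Rs ≤ R) {k₁ : ℕ}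
    (hk : τ * stageRadius τ Rs R k₁ ≤ 1 / 2 * (stageRadius τ Rs R k₁ + Rs)) (m : ℕ) :
    stageRadius τ Rs R (k₁ + m) ≤ (1 / 2) ^ m * stageRadius τ Rs R k₁ + Rs := by
  suffices hs : stageRadius τ Rs R (k₁ + m) - Rs
      ≤ (1 / 2) ^ m * (stageRadius τ Rs R k₁ - Rs) by
    have : 0 ≤ (1 / 2 : ℝ) ^ m * Rs := by positivity
    linarith
  induction m with
  | zero => simp
  | succ m ih =>
    have hmono : stageRadius τ Rs R (k₁ + m) ≤ stageRadius τ Rs R k₁ :=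
      antitone_nat_of_succ_le (stageRadius_succ_le hτ hRs h) (Nat.le_add_right _ _)
    -- The turning condition persists: for `τ ≤ 1/2` it always holds, and for `τ > 1/2` it is an
    -- upper bound on the radius, which decreases.
    have hturn : τ * stageRadius τ Rs R (k₁ + m) ≤ 1 / 2 * (stageRadius τ Rs R (k₁ + m) + Rs) := by
      rcases le_total τ (1 / 2) with ht | ht
      · have := rStar_le_stageRadius (τ := τ) h (k₁ + m)
        nlinarith
      · nlinarith
    rw [← add_assoc, stageRadius, max_eq_right hturn, pow_succ]
    linarith

lemma stageRadius_bound (hτ : τ < 1) (hRs : 0 < Rs) (h : Rs ≤ R) {k₁ : ℕ}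
    (hk : IsLeast {k : ℕ | τ * stageRadius τ Rs R k ≤ 1 / 2 * (stageRadius τ Rs R k + Rs)} k₁)
    (K : ℕ) :
    stageRadius τ Rs R K ≤ τ ^ (min K k₁) * (2 : ℝ) ^ (min ((k₁ : ℤ) - (K : ℤ)) 0) * R + Rs := by
  have hlt : ∀ i < k₁, ¬ τ * stageRadius τ Rs R i ≤ 1 / 2 * (stageRadius τ Rs R i + Rs) :=
    fun i hi hcon => absurd (hk.2 hcon) (by omega)
  rcases le_total K k₁ with hK | hK
  · rw [min_eq_left hK, min_eq_right (by omega), zpow_zero, mul_one,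
      stageRadius_eq_of_lt fun i hi => hlt i (by omega)]
    linarith
  · obtain ⟨m, rfl⟩ := Nat.exists_eq_add_of_le hK
    rw [min_eq_right hK, min_eq_left (by omega)]
    have e : (2 : ℝ) ^ ((k₁ : ℤ) - ((k₁ + m : ℕ) : ℤ)) = (1 / 2) ^ m := by
      rw [show (k₁ : ℤ) - ((k₁ + m : ℕ) : ℤ) = -(m : ℤ) by push_cast; ring, zpow_neg,
        zpow_natCast, one_div, inv_pow]
    rw [e]
    have := stageRadius_add_le hτ hRs h hk.1 m
    rw [stageRadius_eq_of_lt hlt] at this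
    linarith

lemma turn_le_log_div_log (hτ0 : 0 < τ) (hτ : τ < 1) (hRs : 0 < Rs) (h : Rs ≤ R) {k₁ : ℕ}
    (hk : IsLeast {k : ℕ | τ * stageRadius τ Rs R k ≤ 1 / 2 * (stageRadius τ Rs R k + Rs)} k₁) :
    (k₁ : ℝ) ≤ Real.log (R / Rs) / Real.log (1 / τ) := by
  have hlt : ∀ i < k₁, ¬ τ * stageRadius τ Rs R i ≤ 1 / 2 * (stageRadius τ Rs R i + Rs) :=
    fun i hi hcon => absurd (hk.2 hcon) (by omega)
  have h1 := rStar_le_stageRadius (τ := τ) h k₁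
  rw [stageRadius_eq_of_lt hlt] at h1
  have hR := hRs.trans_le h
  rw [le_div_iff₀ (Real.log_pos (one_lt_one_div hτ0 hτ)), Real.log_div hR.ne' hRs.ne', one_div,
    Real.log_inv]
  have h2 := Real.log_le_log hRs h1
  rw [Real.log_mul (by positivity) hR.ne', Real.log_pow] at h2
  linarith

end Radii

end AMDA

namespace AMDA

variable {d : ℕ}

/-! ### The objective -/

section Risk

variable {𝒴 : Set ℝ} {ℓ ℓ' : ℝ → ℝ → ℝ} {P : Measure (Vec d × ℝ)}

lemma measurable_gradSample (hloss : IsAdmissibleLoss 𝒴 ℓ ℓ') :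
    Measurable fun p : Vec d × (Vec d × ℝ) => gradSample ℓ' p.1 p.2 := by
  have h1 : Measurable fun p : Vec d × (Vec d × ℝ) => ((inner ℝ p.1 p.2.1 : ℝ), p.2.2) := by
    fun_prop
  exact (hloss.measurable_deriv.comp h1).smul (by fun_prop)

lemma integrable_loss [IsProbabilityMeasure P] (hloss : IsAdmissibleLoss 𝒴 ℓ ℓ')
    (hmom : HasMoments 𝒴 P) (θ : Vec d) :
    Integrable (fun z : Vec d × ℝ => ℓ (inner ℝ θ z.1) z.2) P := by
  obtain ⟨C₁, C₂, hC₁, hC₂, hgr⟩ := hloss.growth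
  have hmeas : Measurable fun z : Vec d × ℝ => ℓ (inner ℝ θ z.1) z.2 :=
    hloss.measurable.comp (by fun_prop : Measurable fun z : Vec d × ℝ => ((inner ℝ θ z.1 : ℝ), z.2))
  have hdom : Integrable (fun z : Vec d × ℝ =>
      C₁ + C₂ * (2 * ‖θ‖ ^ 2 * (1 + ‖z.1‖ ^ 4) + 2 * |z.2| ^ 2)) P :=
    (integrable_const _).add (((((integrable_const _).add hmom.covariate).const_mul _).add
      (hmom.label.const_mul _)).const_mul _)
  refine hdom.mono' hmeas.aestronglyMeasurable ?_
  filter_upwards [hmom.label_mem] with z hz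
  rw [Real.norm_eq_abs]
  refine (hgr _ _ hz).trans ?_
  have h1 := abs_real_inner_le_norm θ z.1
  have h2 : (inner ℝ θ z.1 : ℝ) ^ 2 ≤ ‖θ‖ ^ 2 * ‖z.1‖ ^ 2 := by
    rw [← mul_pow, ← sq_abs]; exact pow_le_pow_left₀ (abs_nonneg _) h1 2
  have h3 : ‖z.1‖ ^ 2 ≤ 1 + ‖z.1‖ ^ 4 := by nlinarith [sq_nonneg (‖z.1‖ ^ 2 - 1)]
  have h4 : |(inner ℝ θ z.1 : ℝ) - z.2| ^ 2 ≤ 2 * (inner ℝ θ z.1 : ℝ) ^ 2 + 2 * |z.2| ^ 2 := by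
    rw [sq_abs, sq_abs]; nlinarith [sq_nonneg ((inner ℝ θ z.1 : ℝ) + z.2)]
  have h5 := mul_le_mul_of_nonneg_left h3 (sq_nonneg ‖θ‖)
  gcongr
  linarith

lemma memLp_gradSample [IsProbabilityMeasure P] (hloss : IsAdmissibleLoss 𝒴 ℓ ℓ')
    (hmom : HasMoments 𝒴 P) (θ : Vec d) (j : Fin d) :
    MemLp (fun z => gradSample ℓ' θ z j) 2 P := by
  obtain ⟨C₁, C₂, hC₁, hC₂, hgr⟩ := hloss.growth_deriv
  have hmeas : Measurable fun z : Vec d × ℝ => gradSample ℓ' θ z j := by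
    have := (measurable_gradSample (d := d) hloss).comp (measurable_prodMk_left (x := θ))
    exact (by fun_prop : Measurable fun v : Vec d => v j).comp this
  rw [memLp_two_iff_integrable_sq hmeas.aestronglyMeasurable]
  have hdom : Integrable (fun z : Vec d × ℝ =>
      3 * (C₁ ^ 2 * (1 + ‖z.1‖ ^ 4) + C₂ ^ 2 * ‖θ‖ ^ 2 * ‖z.1‖ ^ 4
        + C₂ ^ 2 * ‖z.2 • z.1‖ ^ 2)) P :=
    (((((integrable_const _).add hmom.covariate).const_mul _).add
      (hmom.covariate.const_mul _)).add (hmom.product.const_mul _)).const_mul _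
  refine hdom.mono' (hmeas.pow_const 2).aestronglyMeasurable ?_
  filter_upwards [hmom.label_mem] with z hz
  rw [Real.norm_eq_abs, abs_of_nonneg (sq_nonneg _)]
  have h0 : gradSample ℓ' θ z j = ℓ' (inner ℝ θ z.1) z.2 * z.1 j := rfl
  have h1 := abs_real_inner_le_norm θ z.1
  have h2 : |z.1 j| ≤ ‖z.1‖ := PiLp.norm_apply_le z.1 j
  have h3 : |ℓ' (inner ℝ θ z.1) z.2| ≤ C₁ + C₂ * (‖θ‖ * ‖z.1‖ + |z.2|) := by
    refine (hgr _ _ hz).trans ?_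
    gcongr
    exact (abs_sub _ _).trans (by linarith)
  have h4 : |gradSample ℓ' θ z j| ≤ (C₁ + C₂ * (‖θ‖ * ‖z.1‖ + |z.2|)) * ‖z.1‖ := by
    rw [h0, abs_mul]; gcongr
  have h5 : ‖z.1‖ ^ 2 ≤ 1 + ‖z.1‖ ^ 4 := by nlinarith [sq_nonneg (‖z.1‖ ^ 2 - 1)]
  rw [← sq_abs, norm_smul, Real.norm_eq_abs]
  have h6 := pow_le_pow_left₀ (abs_nonneg _) h4 2
  have h7 := mul_le_mul_of_nonneg_left h5 (sq_nonneg C₁)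
  set n := ‖z.1‖
  set y := |z.2|
  set t := ‖θ‖
  have h8 : ((C₁ + C₂ * (t * n + y)) * n) ^ 2
      ≤ 3 * (C₁ ^ 2 * n ^ 2 + C₂ ^ 2 * t ^ 2 * n ^ 4 + C₂ ^ 2 * (y * n) ^ 2) := by
    nlinarith [sq_nonneg (C₁ * n - C₂ * t * n ^ 2), sq_nonneg (C₁ * n - C₂ * (y * n)),
      sq_nonneg (C₂ * t * n ^ 2 - C₂ * (y * n))]
  linarith

/-- The mean gradient `𝔼[ℓ'(⟨θ, X⟩, Y) X]`. -/
noncomputable def meanGrad (ℓ' : ℝ → ℝ → ℝ) (P : Measure (Vec d × ℝ)) (θ : Vec d) : Vec d :=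
  WithLp.toLp 2 fun j => ∫ z, gradSample ℓ' θ z j ∂P

lemma meanGrad_apply (θ : Vec d) (j : Fin d) :
    meanGrad ℓ' P θ j = ∫ z, gradSample ℓ' θ z j ∂P := rfl

lemma measurable_meanGrad [IsProbabilityMeasure P] (hloss : IsAdmissibleLoss 𝒴 ℓ ℓ') (j : Fin d) :
    Measurable fun θ => meanGrad ℓ' P θ j := by
  have h : Measurable fun p : Vec d × (Vec d × ℝ) => gradSample ℓ' p.1 p.2 j :=
    (by fun_prop : Measurable fun v : Vec d => v j).comp (measurable_gradSample hloss)
  exact h.stronglyMeasurable.integral_prod_right.measurable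

/-- The pointwise subgradient inequality is integrated, so `risk` is never differentiated and any
measurable subgradient serves. -/
lemma risk_subgradient [IsProbabilityMeasure P] (hloss : IsAdmissibleLoss 𝒴 ℓ ℓ')
    (hmom : HasMoments 𝒴 P) (θ v : Vec d) :
    risk ℓ P θ + inner ℝ (meanGrad ℓ' P θ) (v - θ) ≤ risk ℓ P v := by
  have hint : ∀ j, Integrable (fun z => (v - θ) j * gradSample ℓ' θ z j) P := fun j =>
    ((memLp_gradSample hloss hmom θ j).integrable one_le_two).const_mul _
  have h1 : (inner ℝ (meanGrad ℓ' P θ) (v - θ) : ℝ)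
      = ∫ z, ∑ j, (v - θ) j * gradSample ℓ' θ z j ∂P := by
    rw [integral_finsetSum _ fun j _ => hint j, PiLp.inner_apply]
    refine Finset.sum_congr rfl fun j _ => ?_
    rw [integral_const_mul, ← meanGrad_apply]; rfl
  rw [h1, risk, risk, ← integral_add (integrable_loss hloss hmom θ)
    (integrable_finsetSum _ fun j _ => hint j)]
  refine integral_mono_ae ((integrable_loss hloss hmom θ).add
    (integrable_finsetSum _ fun j _ => hint j)) (integrable_loss hloss hmom v) ?_
  filter_upwards [hmom.label_mem] with z hz
  have h2 := hloss.subgradient z.2 hz (inner ℝ θ z.1) (inner ℝ v z.1)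
  have h3 : ∑ j, (v - θ) j * gradSample ℓ' θ z j
      = ℓ' (inner ℝ θ z.1) z.2 * (inner ℝ v z.1 - inner ℝ θ z.1) := by
    rw [← inner_sub_left, PiLp.inner_apply (v - θ), Finset.mul_sum]
    refine Finset.sum_congr rfl fun j _ => ?_
    simp [gradSample]; ring
  simp only [h3]
  exact h2

/-- The subgradient inequality is tested at `θ ± h e_j`. The points need room `h = r - r' > 0`
inside the ball where the Lipschitz bound holds; the iterates have it because averaging keeps weight
on the centre. -/
lemma abs_meanGrad_le [IsProbabilityMeasure P] (hloss : IsAdmissibleLoss 𝒴 ℓ ℓ')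
    (hmom : HasMoments 𝒴 P) {S : Set (Vec d)} {M : ℝ}
    (hLip : ∀ θ ∈ S, ∀ θ' ∈ S, risk ℓ P θ - risk ℓ P θ' ≤ M * l1Norm (θ - θ'))
    {c : Vec d} {r r' : ℝ} (hS : l1Ball c r ⊆ S) (hr : r' < r) {θ : Vec d} (hθ : θ ∈ l1Ball c r')
    (j : Fin d) : |meanGrad ℓ' P θ j| ≤ M := by
  set h := r - r' with hh
  have hpos : 0 < h := by linarith
  have key : ∀ x : ℝ, |x| = h → x * meanGrad ℓ' P θ j ≤ M * h := by
    intro x hx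
    set w : Vec d := EuclideanSpace.single j x with hw
    have hl1 : l1Norm w = h := by
      rw [l1Norm, Finset.sum_eq_single j]
      · simp [hw, hx]
      · intro i _ hi; simp [hw, hi]
      · simp
    have hmem : θ + w ∈ l1Ball c r := by
      change l1Norm (θ + w - c) ≤ r
      have e : θ + w - c = (θ - c) + w := by abel
      have h1 : l1Norm (θ - c) ≤ r' := hθ
      rw [e]
      have := l1Norm_add_le (θ - c) w
      linarith
    have h1 := risk_subgradient hloss hmom θ (θ + w)
    have h2 := hLip _ (hS hmem) θ (hS (show l1Norm (θ - c) ≤ r from le_trans hθ hr.le))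
    rw [add_sub_cancel_left] at h1 h2
    rw [hl1] at h2
    have h3 : (inner ℝ (meanGrad ℓ' P θ) w : ℝ) = x * meanGrad ℓ' P θ j := by
      rw [hw, real_inner_comm, EuclideanSpace.inner_single_left]; simp
    linarith
  rw [abs_le]
  constructor
  · have := key (-h) (by rw [abs_neg, abs_of_pos hpos])
    nlinarith
  · have := key h (abs_of_pos hpos)
    nlinarith

lemma variance_le_sigmaMax_sq {S : Set (Vec d)} (hpos : 0 < sigmaMax ℓ' P S) {θ : Vec d}
    (hθ : θ ∈ S) (j : Fin d) :
    variance (fun z => gradSample ℓ' θ z j) P ≤ sigmaMax ℓ' P S ^ 2 := by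
  have h0 := Real.sqrt_pos.1 hpos
  have hbdd : BddAbove {v | ∃ θ ∈ S, ∃ j : Fin d,
      v = variance (fun z => gradSample ℓ' θ z j) P} := by
    -- The supremum of an unbounded set is 0 by convention, so positivity of `sigmaMax` already
    -- entails that the variances are bounded.
    by_contra h
    rw [Real.sSup_of_not_bddAbove h] at h0
    exact lt_irrefl _ h0
  rw [sigmaMax, Real.sq_sqrt h0.le]
  exact le_csSup hbdd ⟨θ, hθ, j, rfl⟩

end Risk

end AMDA

namespace AMDA

/-! ### Order statistics and the trimmed mean -/

lemma card_comp_sort {m : ℕ} (x : Fin m → ℝ) (p : ℝ → Prop) [DecidablePred p] :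
    (Finset.univ.filter fun i => p (x (Tuple.sort x i))).card
      = (Finset.univ.filter fun i => p (x i)).card := by
  refine Finset.card_bij (fun i _ => Tuple.sort x i) (fun i hi => by simpa using hi)
    (fun i _ j _ h => (Tuple.sort x).injective h) fun j hj => ?_
  exact ⟨(Tuple.sort x).symm j, by simpa using hj, by simp⟩

/-- Reduces order statistics to counting. The index `k - 1` is a truncated subtraction, so `k = 0`
behaves like `k = 1`. -/
lemma orderStat_le_iff {m k : ℕ} (x : Fin m → ℝ) (h : k - 1 < m) (c : ℝ) :
    orderStat x k ≤ c ↔ k - 1 < (Finset.univ.filter fun i => x i ≤ c).card := by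
  rw [orderStat, dif_pos h, ← card_comp_sort x (fun y => y ≤ c)]
  exact (Tuple.lt_card_le_iff_apply_le_of_monotone (j := ⟨k - 1, h⟩) (a := c)
    (Tuple.monotone_sort x)).symm

lemma le_orderStat {m k : ℕ} {x : Fin m → ℝ} (h : k - 1 < m) {c : ℝ}
    (hc : (Finset.univ.filter fun i => x i < c).card ≤ k - 1) : c ≤ orderStat x k := by
  by_contra hcon
  have h1 := (orderStat_le_iff x h (orderStat x k)).1 le_rfl
  have h2 : (Finset.univ.filter fun i => x i ≤ orderStat x k).card
      ≤ (Finset.univ.filter fun i => x i < c).card :=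
    Finset.card_le_card fun i hi => by
      simp only [Finset.mem_filter, Finset.mem_univ, true_and] at hi ⊢
      exact hi.trans_lt (not_le.1 hcon)
  omega

lemma orderStat_mono {m k k' : ℕ} (x : Fin m → ℝ) (hk : k ≤ k') (h : k' - 1 < m) :
    orderStat x k ≤ orderStat x k' := by
  rw [orderStat, orderStat, dif_pos h, dif_pos (by omega)]
  exact Tuple.monotone_sort x (by simp only [Fin.mk_le_mk]; omega)

/-- Order statistics are 1-Lipschitz for the sup norm. The continuity gives measurability of the
estimator and lets rational outlier values replace real ones. -/
lemma continuous_orderStat (m k : ℕ) : Continuous fun x : Fin m → ℝ => orderStat x k := by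
  by_cases h : k - 1 < m
  · refine (LipschitzWith.of_le_add ?_).continuous
    intro x y
    rw [orderStat_le_iff x h]
    refine ((orderStat_le_iff y h (orderStat y k)).1 le_rfl).trans_le
      (Finset.card_le_card fun i hi => ?_)
    simp only [Finset.mem_filter, Finset.mem_univ, true_and] at hi ⊢
    have h1 := dist_le_pi_dist x y i
    rw [Real.dist_eq] at h1
    linarith [le_abs_self (x i - y i)]
  · simp only [orderStat, dif_neg h]
    exact continuous_const

lemma continuous_trimmedMean (n : ℕ) (α : ℝ) :
    Continuous fun x : Fin n → ℝ => trimmedMean α x := by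
  unfold trimmedMean
  have hf : Continuous fun (x : Fin n → ℝ) (i : Fin (n / 2)) =>
      x (Fin.castLE (Nat.div_le_self n 2) i) := continuous_pi fun i => continuous_apply _
  have hc : ∀ k, Continuous fun x : Fin n → ℝ =>
      orderStat (fun i : Fin (n / 2) => x (Fin.castLE (Nat.div_le_self n 2) i)) k := fun k =>
    (continuous_orderStat (n / 2) k).comp hf
  exact continuous_const.mul (continuous_finsetSum _ fun i _ =>
    (hc _).max ((continuous_apply i).min (hc _)))

/-- The average over the second half of the sample, clipped to `[a, b]`. -/
noncomputable def clippedMean {n : ℕ} (a b : ℝ) (x : Fin n → ℝ) : ℝ :=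
  2 / (n : ℝ) * ∑ i ∈ Finset.univ.filter (fun i : Fin n => n / 2 ≤ i.val), max a (min (x i) b)

/-- Negation exchanges the two clipping levels, so only upper deviations need to be estimated. -/
lemma clippedMean_neg {n : ℕ} {a b : ℝ} (hab : a ≤ b) (x : Fin n → ℝ) :
    clippedMean (-b) (-a) (fun i => -x i) = -clippedMean a b x := by
  unfold clippedMean
  rw [← mul_neg, ← Finset.sum_neg_distrib]
  congr 1
  refine Finset.sum_congr rfl fun i _ => ?_
  rw [min_neg_neg, max_neg_neg, neg_inj]
  rcases le_total (x i) b with h | h <;> rcases le_total (x i) a with h' | h' <;>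
    simp [h, h', hab]
  exact le_antisymm hab (h.trans h')

lemma card_firstHalf {n : ℕ} (x : Fin n → ℝ) (p : ℝ → Prop) [DecidablePred p] :
    (Finset.univ.filter fun i : Fin (n / 2) => p (x (Fin.castLE (Nat.div_le_self n 2) i))).card
      = (Finset.univ.filter fun i : Fin n => i.val < n / 2 ∧ p (x i)).card := by
  refine Finset.card_bij (fun i _ => Fin.castLE (Nat.div_le_self n 2) i)
    (fun i hi => by simpa using hi) (fun i _ j _ h => by simpa using h) fun j hj => ?_
  simp only [Finset.mem_filter, Finset.mem_univ, true_and] at hj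
  exact ⟨⟨j.val, hj.1⟩, by simpa using hj.2, by simp⟩

lemma card_secondHalf {n : ℕ} (hn : Even n) :
    ((Finset.univ.filter fun i : Fin n => n / 2 ≤ i.val).card : ℝ) = n / 2 := by
  have h1 := card_firstHalf (n := n) (fun _ => 0) (fun _ => True)
  simp only [Finset.filter_true, Finset.card_univ, Fintype.card_fin, and_true] at h1
  have h2 := Finset.card_filter_add_card_filter_not (s := (Finset.univ : Finset (Fin n)))
    (fun i => i.val < n / 2)
  simp only [not_lt, Finset.card_univ, Fintype.card_fin] at h2
  obtain ⟨N, rfl⟩ := hn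
  have h3 : (Finset.univ.filter fun i : Fin (N + N) => (N + N) / 2 ≤ i.val).card = N := by omega
  rw [h3]; push_cast; ring

lemma clippedMean_le_of_le {n : ℕ} (hn0 : 0 < n) (hn : Even n) {a b c : ℝ} (hab : a ≤ b)
    (hb : b ≤ c) (x : Fin n → ℝ) : clippedMean a b x ≤ c := by
  have h : ∑ i ∈ Finset.univ.filter (fun i : Fin n => n / 2 ≤ i.val), max a (min (x i) b)
      ≤ n / 2 * c := by
    refine (Finset.sum_le_card_nsmul _ _ c fun i _ => ?_).trans ?_
    · exact max_le (hab.trans hb) ((min_le_right _ _).trans hb)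
    · rw [nsmul_eq_mul, card_secondHalf hn]
  have hn' : (0 : ℝ) < n := by exact_mod_cast hn0
  unfold clippedMean
  calc _ ≤ 2 / (n : ℝ) * (n / 2 * c) := by gcongr
    _ = c := by field_simp

/-- Clipping is monotone in its levels, so the random levels may be replaced by the fixed `l` and `m
+ U` on the inliers. Each of the at most `η n` outliers adds at most `U`, whence `2 η U` after
normalization. -/
lemma clippedMean_le {n : ℕ} (hn0 : 0 < n) (hn : Even n) {a b l m U B η : ℝ} (hab : a ≤ b)
    (ha : a ≤ l) (hb : b ≤ m + U) (hU : 0 ≤ U) {Out : Finset (Fin n)}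
    (hOut : (Out.card : ℝ) ≤ η * n) (x : Fin n → ℝ)
    (hsum : ∑ i ∈ Finset.univ.filter (fun i : Fin n => n / 2 ≤ i.val ∧ i ∉ Out),
      (max l (min (x i) (m + U)) - m) ≤ n / 2 * B) :
    clippedMean a b x ≤ m + (B + 2 * η * U) := by
  have hn' : (0 : ℝ) < n := by exact_mod_cast hn0
  have h : ∑ i ∈ Finset.univ.filter (fun i : Fin n => n / 2 ≤ i.val),
      (max a (min (x i) b) - m) ≤ n / 2 * B + η * n * U := by
    rw [← Finset.sum_filter_add_sum_filter_not _ (fun i => i ∉ Out), Finset.filter_filter]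
    refine add_le_add (le_trans (Finset.sum_le_sum fun i _ => ?_) hsum) ?_
    · exact sub_le_sub_right (max_le_max ha (min_le_min_left _ hb)) _
    · refine (Finset.sum_le_card_nsmul _ _ U fun i _ => ?_).trans ?_
      · have := max_le (hab.trans hb) ((min_le_right (x i) b).trans hb)
        linarith
      · rw [nsmul_eq_mul]
        refine mul_le_mul_of_nonneg_right (le_trans ?_ hOut) hU
        exact_mod_cast Finset.card_le_card fun i hi => by
          simpa using (Finset.mem_filter.1 hi).2
  rw [Finset.sum_sub_distrib, Finset.sum_const, nsmul_eq_mul, card_secondHalf hn] at h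
  unfold clippedMean
  calc _ ≤ 2 / (n : ℝ) * (n / 2 * m + (n / 2 * B + η * n * U)) := by gcongr; linarith
    _ = _ := by field_simp

/-- Few inliers of the first half lie above the level `c`. -/
def FewAbove {n : ℕ} (Out : Finset (Fin n)) (α η c : ℝ) (x : Fin n → ℝ) : Prop :=
  ((Finset.univ.filter fun i : Fin n => i.val < n / 2 ∧ i ∉ Out ∧ c < x i).card : ℝ)
    + η * n + 1 ≤ α * n / 2

/-- Many inliers of the first half lie below the level `l`. -/
def ManyBelow {n : ℕ} (Out : Finset (Fin n)) (α l : ℝ) (x : Fin n → ℝ) : Prop :=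
  α * n / 2 + 1
    ≤ ((Finset.univ.filter fun i : Fin n => i.val < n / 2 ∧ i ∉ Out ∧ x i ≤ l).card : ℝ)

/-! ### Empirical quantiles of the first half under contamination -/

section Quantiles

variable {n : ℕ} {Out : Finset (Fin n)} {α η : ℝ} {x : Fin n → ℝ}

lemma FewAbove.card_le {c : ℝ} (hOut : (Out.card : ℝ) ≤ η * n) (h : FewAbove Out α η c x) :
    ((Finset.univ.filter fun i : Fin n => i.val < n / 2 ∧ c < x i).card : ℝ) + 1 ≤ α * n / 2 := by
  have h1 : (Finset.univ.filter fun i : Fin n => i.val < n / 2 ∧ c < x i).card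
      ≤ (Finset.univ.filter fun i : Fin n => i.val < n / 2 ∧ i ∉ Out ∧ c < x i).card
        + Out.card := by
    refine (Finset.card_le_card fun i hi => ?_).trans (Finset.card_union_le _ _)
    simp only [Finset.mem_union, Finset.mem_filter, Finset.mem_univ, true_and] at hi ⊢
    tauto
  have h2 : ((Finset.univ.filter fun i : Fin n => i.val < n / 2 ∧ c < x i).card : ℝ)
      ≤ (Finset.univ.filter fun i : Fin n => i.val < n / 2 ∧ i ∉ Out ∧ c < x i).card
        + Out.card := by exact_mod_cast h1
  unfold FewAbove at h
  linarith

lemma ManyBelow.le_card {l : ℝ} (h : ManyBelow Out α l x) :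
    α * n / 2 + 1 ≤ ((Finset.univ.filter fun i : Fin n => i.val < n / 2 ∧ x i ≤ l).card : ℝ) := by
  refine h.trans ?_
  exact_mod_cast Finset.card_le_card fun i hi => by
    simp only [Finset.mem_filter, Finset.mem_univ, true_and] at hi ⊢
    exact ⟨hi.1, hi.2.2⟩

lemma card_firstHalf_compl (n : ℕ) (p : Fin n → Prop) [DecidablePred p] :
    (Finset.univ.filter fun i : Fin n => i.val < n / 2 ∧ p i).card
      + (Finset.univ.filter fun i : Fin n => i.val < n / 2 ∧ ¬ p i).card = n / 2 := by
  have h1 := card_firstHalf (n := n) (fun _ => 0) (fun _ => True)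
  simp only [Finset.filter_true, Finset.card_univ, Fintype.card_fin, and_true] at h1
  have h2 := Finset.card_filter_add_card_filter_not
    (s := Finset.univ.filter fun i : Fin n => i.val < n / 2) p
  rw [Finset.filter_filter, Finset.filter_filter] at h2
  omega

variable (x) in
/-- The first half of a sample. -/
def firstHalf : Fin (n / 2) → ℝ := fun i => x (Fin.castLE (Nat.div_le_self n 2) i)

lemma trimmedMean_eq_clippedMean :
    trimmedMean α x = clippedMean (orderStat (firstHalf x) ⌊α * n / 2⌋₊)
      (orderStat (firstHalf x) ⌊(1 - α) * n / 2⌋₊) x := rfl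

lemma floor_index_bounds (hn : Even n) (hα : α < 1 / 2) (h1 : 1 ≤ α * n / 2) :
    1 ≤ ⌊α * n / 2⌋₊ ∧ ⌊α * n / 2⌋₊ ≤ ⌊(1 - α) * n / 2⌋₊ ∧ ⌊(1 - α) * n / 2⌋₊ - 1 < n / 2 := by
  have h2 : 1 ≤ ⌊α * n / 2⌋₊ := Nat.le_floor (by exact_mod_cast h1)
  have hn0 : (0 : ℝ) ≤ n := Nat.cast_nonneg n
  have hle : α * n / 2 ≤ (1 - α) * n / 2 := by nlinarith
  have h3 := Nat.floor_le_floor hle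
  refine ⟨h2, h3, ?_⟩
  have h4 : ⌊(1 - α) * n / 2⌋₊ ≤ n / 2 := by
    have : ((n / 2 : ℕ) : ℝ) = n / 2 := by
      rw [Nat.cast_div hn.two_dvd (by norm_num)]; norm_num
    have h5 : (1 - α) * n / 2 ≤ ((n / 2 : ℕ) : ℝ) := by rw [this]; nlinarith
    exact Nat.floor_le_of_le h5
  omega

lemma natCast_half (hn : Even n) : ((n / 2 : ℕ) : ℝ) = n / 2 := by
  rw [Nat.cast_div hn.two_dvd (by norm_num)]; norm_num

/-- Even if all outliers lie above `c`, fewer than `α n / 2` of the `n / 2` points do, so the upper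
quantile index is reached below `c`. -/
lemma qhi_le_of_fewAbove {c : ℝ} (hn : Even n) (hα : α < 1 / 2)
    (hOut : (Out.card : ℝ) ≤ η * n) (h : FewAbove Out α η c x) :
    orderStat (firstHalf x) ⌊(1 - α) * n / 2⌋₊ ≤ c := by
  have h1 := h.card_le hOut
  have hpos : 1 ≤ α * n / 2 := le_trans (by linarith [Nat.cast_nonneg (α := ℝ) (Finset.card
    (Finset.univ.filter fun i : Fin n => i.val < n / 2 ∧ c < x i))]) h1
  obtain ⟨k1, k2, k3⟩ := floor_index_bounds hn hα hpos
  rw [orderStat_le_iff _ k3]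
  have e := card_firstHalf x (fun y => y ≤ c)
  have e2 := card_firstHalf_compl n (fun i => x i ≤ c)
  simp only [not_le] at e2
  change _ < (Finset.univ.filter fun i => firstHalf x i ≤ c).card
  unfold firstHalf
  rw [e]
  have h3 : (⌊(1 - α) * n / 2⌋₊ : ℝ) ≤ (1 - α) * n / 2 := Nat.floor_le (by nlinarith)
  have h4 : ((Finset.univ.filter fun i : Fin n => i.val < n / 2 ∧ x i ≤ c).card : ℝ)
      + (Finset.univ.filter fun i : Fin n => i.val < n / 2 ∧ c < x i).card = n / 2 := by
    rw [← natCast_half hn]; exact_mod_cast e2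
  have h5 : (⌊(1 - α) * n / 2⌋₊ : ℝ)
      ≤ (Finset.univ.filter fun i : Fin n => i.val < n / 2 ∧ x i ≤ c).card := by nlinarith
  have h6 : ⌊(1 - α) * n / 2⌋₊
      ≤ (Finset.univ.filter fun i : Fin n => i.val < n / 2 ∧ x i ≤ c).card := by exact_mod_cast h5
  omega

lemma le_qlo_of_fewAbove {c : ℝ} (hn : Even n) (hα : α < 1 / 2)
    (hOut : (Out.card : ℝ) ≤ η * n) (h : FewAbove Out α η c (fun i => -x i)) :
    -c ≤ orderStat (firstHalf x) ⌊α * n / 2⌋₊ := by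
  have h1 := h.card_le hOut
  have hpos : 1 ≤ α * n / 2 := le_trans (by linarith [Nat.cast_nonneg (α := ℝ) (Finset.card
    (Finset.univ.filter fun i : Fin n => i.val < n / 2 ∧ c < -x i))]) h1
  obtain ⟨k1, k2, k3⟩ := floor_index_bounds hn hα hpos
  refine le_orderStat (by omega) ?_
  have e := card_firstHalf x (fun y => y < -c)
  unfold firstHalf
  rw [e]
  have h2 : (Finset.univ.filter fun i : Fin n => i.val < n / 2 ∧ x i < -c).card + 1
      ≤ ⌊α * n / 2⌋₊ := by
    refine Nat.le_floor ?_
    push_cast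
    simpa only [lt_neg] using h1
  omega

lemma qlo_le_of_manyBelow {l : ℝ} (hn : Even n) (hα : α < 1 / 2) (hpos : 1 ≤ α * n / 2)
    (h : ManyBelow Out α l x) : orderStat (firstHalf x) ⌊α * n / 2⌋₊ ≤ l := by
  have h1 := h.le_card
  obtain ⟨k1, k2, k3⟩ := floor_index_bounds hn hα hpos
  rw [orderStat_le_iff _ (by omega)]
  have e := card_firstHalf x (fun y => y ≤ l)
  unfold firstHalf
  rw [e]
  have h3 : (⌊α * n / 2⌋₊ : ℝ) ≤ α * n / 2 := Nat.floor_le (by linarith)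
  have h6 : ⌊α * n / 2⌋₊
      ≤ (Finset.univ.filter fun i : Fin n => i.val < n / 2 ∧ x i ≤ l).card := by
    have : (⌊α * n / 2⌋₊ : ℝ)
      ≤ (Finset.univ.filter fun i : Fin n => i.val < n / 2 ∧ x i ≤ l).card := by linarith
    exact_mod_cast this
  omega

lemma le_qhi_of_manyBelow {l : ℝ} (hn : Even n) (hα : α < 1 / 2) (hpos : 1 ≤ α * n / 2)
    (h : ManyBelow Out α l (fun i => -x i)) :
    -l ≤ orderStat (firstHalf x) ⌊(1 - α) * n / 2⌋₊ := by
  have h1 := h.le_card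
  obtain ⟨k1, k2, k3⟩ := floor_index_bounds hn hα hpos
  refine le_orderStat k3 ?_
  have e := card_firstHalf x (fun y => y < -l)
  unfold firstHalf
  rw [e]
  have e2 := card_firstHalf_compl n (fun i => x i < -l)
  have h4 : ((Finset.univ.filter fun i : Fin n => i.val < n / 2 ∧ x i < -l).card : ℝ)
      + (Finset.univ.filter fun i : Fin n => i.val < n / 2 ∧ ¬ x i < -l).card = n / 2 := by
    rw [← natCast_half hn]; exact_mod_cast e2
  simp only [not_lt, neg_le (a := l)] at h4
  have h2 : (Finset.univ.filter fun i : Fin n => i.val < n / 2 ∧ x i < -l).card + 1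
      ≤ ⌊(1 - α) * n / 2⌋₊ := by
    refine Nat.le_floor ?_
    push_cast
    linarith
  omega

/-- Deterministic error bound for the trimmed mean, for any trimming level below `1/2`. -/
lemma abs_trimmedMean_sub_le_of_fewAbove {m U : ℝ} (hn0 : 0 < n) (hn : Even n) (hα : α < 1 / 2)
    (hOut : (Out.card : ℝ) ≤ η * n) (h : FewAbove Out α η (m + U) x)
    (h' : FewAbove Out α η (-m + U) (fun i => -x i)) : |trimmedMean α x - m| ≤ U := by
  have h1 := h.card_le hOut
  have hpos : 1 ≤ α * n / 2 := le_trans (by linarith [Nat.cast_nonneg (α := ℝ) (Finset.card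
    (Finset.univ.filter fun i : Fin n => i.val < n / 2 ∧ m + U < x i))]) h1
  obtain ⟨k1, k2, k3⟩ := floor_index_bounds hn hα hpos
  have hab := orderStat_mono (firstHalf x) k2 k3
  have a1 := qhi_le_of_fewAbove hn hα hOut h
  have a2 := le_qlo_of_fewAbove hn hα hOut h'
  rw [trimmedMean_eq_clippedMean]
  have b1 := clippedMean_le_of_le hn0 hn hab a1 x
  have b2 := clippedMean_le_of_le hn0 hn (neg_le_neg hab) (neg_le.1 a2) (fun i => -x i)
  rw [clippedMean_neg hab] at b2
  rw [abs_le]; constructor <;> linarith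

/-- Deterministic error bound for the trimmed mean. -/
lemma abs_trimmedMean_sub_le {m U B l l' : ℝ} (hn0 : 0 < n) (hn : Even n) (hα : α < 1 / 2)
    (hU : 0 ≤ U) (hOut : (Out.card : ℝ) ≤ η * n) (h : FewAbove Out α η (m + U) x)
    (h' : FewAbove Out α η (-m + U) (fun i => -x i)) (hl : ManyBelow Out α l x)
    (hl' : ManyBelow Out α l' (fun i => -x i))
    (hsum : ∑ i ∈ Finset.univ.filter (fun i : Fin n => n / 2 ≤ i.val ∧ i ∉ Out),
      (max l (min (x i) (m + U)) - m) ≤ n / 2 * B)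
    (hsum' : ∑ i ∈ Finset.univ.filter (fun i : Fin n => n / 2 ≤ i.val ∧ i ∉ Out),
      (max l' (min (-x i) (-m + U)) - -m) ≤ n / 2 * B) :
    |trimmedMean α x - m| ≤ B + 2 * η * U := by
  have h1 := h.card_le hOut
  have hpos : 1 ≤ α * n / 2 := le_trans (by linarith [Nat.cast_nonneg (α := ℝ) (Finset.card
    (Finset.univ.filter fun i : Fin n => i.val < n / 2 ∧ m + U < x i))]) h1
  obtain ⟨k1, k2, k3⟩ := floor_index_bounds hn hα hpos
  have hab := orderStat_mono (firstHalf x) k2 k3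
  have a1 := qhi_le_of_fewAbove hn hα hOut h
  have a2 := le_qlo_of_fewAbove hn hα hOut h'
  have a3 := qlo_le_of_manyBelow hn hα hpos hl
  have a4 := le_qhi_of_manyBelow hn hα hpos hl'
  rw [trimmedMean_eq_clippedMean]
  have b1 := clippedMean_le hn0 hn hab a3 a1 hU hOut x hsum
  have b2 := clippedMean_le hn0 hn (neg_le_neg hab) (neg_le.1 a4) (neg_le.1 a2) hU hOut
    (fun i => -x i) hsum'
  rw [clippedMean_neg hab] at b2
  rw [abs_le]; constructor <;> linarith

end Quantiles

end AMDA

namespace AMDA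

/-! ### Laws with a bounded variance -/

/-- A law on `ℝ` with mean `m` and standard deviation at most `σ`. -/
structure HasMeanSD (ρ : Measure ℝ) (m σ : ℝ) : Prop where
  memLp : MemLp id 2 ρ
  mean : ∫ x, x ∂ρ = m
  sd : ∫ x, (x - m) ^ 2 ∂ρ ≤ σ ^ 2

section Law

variable {ρ : Measure ℝ} {m σ : ℝ}

lemma HasMeanSD.neg (h : HasMeanSD ρ m σ) : HasMeanSD (ρ.map fun x => -x) (-m) σ where
  memLp := (memLp_map_measure_iff aestronglyMeasurable_id measurable_neg.aemeasurable).2 h.memLp.neg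
  mean := by
    rw [integral_map measurable_neg.aemeasurable (by fun_prop), integral_neg, h.mean]
  sd := by
    rw [integral_map measurable_neg.aemeasurable (by fun_prop)]
    refine le_of_eq_of_le (integral_congr_ae (.of_forall fun x => ?_)) h.sd
    simp only; ring

variable [IsProbabilityMeasure ρ]

lemma HasMeanSD.integrable (h : HasMeanSD ρ m σ) : Integrable (fun x => x) ρ :=
  h.memLp.integrable one_le_two

lemma HasMeanSD.integrable_sq (h : HasMeanSD ρ m σ) : Integrable (fun x => (x - m) ^ 2) ρ :=
  (h.memLp.sub (memLp_const m)).integrable_sq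

lemma HasMeanSD.integrable_sq_of_lipschitz (h : HasMeanSD ρ m σ) {g : ℝ → ℝ} (hg : Measurable g)
    (hlip : ∀ x, |g x - g m| ≤ |x - m|) : Integrable (fun x => (g x - g m) ^ 2) ρ := by
  refine h.integrable_sq.mono' (by fun_prop) (.of_forall fun x => ?_)
  rw [Real.norm_eq_abs, abs_of_nonneg (sq_nonneg _)]
  exact sq_le_sq.2 (hlip x)

lemma HasMeanSD.integral_sq_of_lipschitz (h : HasMeanSD ρ m σ) {g : ℝ → ℝ} (hg : Measurable g)
    (hlip : ∀ x, |g x - g m| ≤ |x - m|) : ∫ x, (g x - g m) ^ 2 ∂ρ ≤ σ ^ 2 :=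
  (integral_mono (h.integrable_sq_of_lipschitz hg hlip) h.integrable_sq
    fun x => sq_le_sq.2 (hlip x)).trans h.sd

lemma HasMeanSD.integrable_of_lipschitz (h : HasMeanSD ρ m σ) {g : ℝ → ℝ} (hg : Measurable g)
    (hlip : ∀ x, |g x - g m| ≤ |x - m|) : Integrable g ρ := by
  have h1 : Integrable (fun x => |x - m| + |g m|) ρ :=
    (h.integrable.sub (integrable_const m)).abs.add (integrable_const _)
  refine h1.mono' (by fun_prop) (.of_forall fun x => ?_)
  rw [Real.norm_eq_abs]
  have := abs_sub_abs_le_abs_sub (g x) (g m)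
  linarith [hlip x]

lemma HasMeanSD.chebyshev (h : HasMeanSD ρ m σ) {U : ℝ} (hU : 0 < U) :
    ρ.real (Set.Ioi (m + U)) ≤ σ ^ 2 / U ^ 2 := by
  have h1 : U ^ 2 * ρ.real {x | U ^ 2 ≤ (x - m) ^ 2} ≤ ∫ x, (x - m) ^ 2 ∂ρ :=
    mul_meas_ge_le_integral_of_nonneg (.of_forall fun x => sq_nonneg _) h.integrable_sq _
  have h2 : ρ.real (Set.Ioi (m + U)) ≤ ρ.real {x | U ^ 2 ≤ (x - m) ^ 2} := by
    refine measureReal_mono fun x hx => ?_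
    have : m + U < x := hx
    change U ^ 2 ≤ (x - m) ^ 2
    nlinarith
  rw [le_div_iff₀ (by positivity)]
  have h3 := h.sd
  nlinarith [sq_nonneg U]

lemma abs_posPart_sub_le (l x y : ℝ) : |max (l - x) 0 - max (l - y) 0| ≤ |x - y| := by
  have := abs_max_sub_max_le_abs (l - x) (l - y) 0
  rwa [sub_sub_sub_cancel_left, abs_sub_comm y x] at this

lemma abs_clip_sub_le (l h x y : ℝ) : |max l (min x h) - max l (min y h)| ≤ |x - y| := by
  rw [max_comm l, max_comm l]
  refine (abs_max_sub_max_le_abs _ _ _).trans ?_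
  rcases le_total x h with h1 | h1 <;> rcases le_total y h with h2 | h2 <;>
    simp only [h1, h2, min_eq_left, min_eq_right] <;> simp only [abs_le] <;>
    rcases abs_cases (x - y) with ⟨h3, h4⟩ | ⟨h3, h4⟩ <;> rw [h3] <;> constructor <;> linarith

/-- A level at which the lower partial moment takes a prescribed value. -/
lemma HasMeanSD.exists_level (h : HasMeanSD ρ m σ) {b : ℝ} (hb : 0 < b) :
    ∃ l ≤ m + b, ∫ x, max (l - x) 0 ∂ρ = b := by
  have hint : ∀ l, Integrable (fun x => max (l - x) 0) ρ := fun l =>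
    h.integrable_of_lipschitz (by fun_prop) fun x => abs_posPart_sub_le l x m
  have hcont : Continuous fun l => ∫ x, max (l - x) 0 ∂ρ := by
    refine (LipschitzWith.of_le_add fun l l' => ?_).continuous
    have h1 : ∫ x, max (l - x) 0 ∂ρ ≤ ∫ x, (max (l' - x) 0 + dist l l') ∂ρ := by
      refine integral_mono (hint l) ((hint l').add (integrable_const _)) fun x => ?_
      rw [Real.dist_eq]
      refine max_le ?_ (by positivity)
      linarith [le_max_left (l' - x) 0, le_abs_self (l - l')]
    rwa [integral_add (hint l') (integrable_const _), integral_const, probReal_univ,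
      one_smul] at h1
  -- For the intermediate value theorem: `(m - t - x)₊ ≤ (x - m)² / (4t)`, so this `t` puts the
  -- partial moment at `m - t` below `b`. The `+ 1` keeps `t` positive without assuming `σ ≠ 0`.
  set t := (σ ^ 2 + 1) / (4 * b) with ht
  have htpos : 0 < t := by positivity
  have hlow : ∫ x, max (m - t - x) 0 ∂ρ ≤ b := by
    have h1 : ∫ x, max (m - t - x) 0 ∂ρ ≤ ∫ x, (x - m) ^ 2 / (4 * t) ∂ρ := by
      refine integral_mono (hint _) (h.integrable_sq.div_const _) fun x => ?_
      refine max_le ?_ (by positivity)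
      rw [le_div_iff₀ (by positivity)]
      nlinarith [sq_nonneg (x - m + 2 * t)]
    rw [integral_div] at h1
    refine h1.trans ?_
    rw [div_le_iff₀ (by positivity)]
    have e : b * (4 * t) = σ ^ 2 + 1 := by rw [ht]; field_simp
    linarith [h.sd]
  have hhigh : b ≤ ∫ x, max (m + b - x) 0 ∂ρ := by
    have h1 : ∫ x, (m + b - x) ∂ρ ≤ ∫ x, max (m + b - x) 0 ∂ρ :=
      integral_mono ((integrable_const _).sub h.integrable) (hint _) fun x => le_max_left _ _
    rw [integral_sub (integrable_const _) h.integrable, h.mean, integral_const, probReal_univ,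
      one_smul] at h1
    linarith
  obtain ⟨l, hl, hl'⟩ := intermediate_value_Icc (by linarith : m - t ≤ m + b) hcont.continuousOn
    ⟨hlow, hhigh⟩
  exact ⟨l, hl.2, hl'⟩

/-- Cauchy-Schwarz for `W = (l - x)₊`, which vanishes above `l`: `b² ≤ ρ(Iic l) ∫ W²`, and `∫ W² ≤
σ² + b²` because `W` is 1-Lipschitz. The proof uses the linearized form `2(b/p)W - (b/p)² ≤ W²` on
`Iic l`. -/
lemma HasMeanSD.le_measureReal_Iic (h : HasMeanSD ρ m σ) {b l p : ℝ} (hp : 0 < p) (hb : 0 < b)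
    (hl : ∫ x, max (l - x) 0 ∂ρ = b) (hbp : p * σ ^ 2 ≤ b ^ 2 * (1 - p)) :
    p ≤ ρ.real (Set.Iic l) := by
  by_contra! hq
  set W : ℝ → ℝ := fun x => max (l - x) 0 with hW
  have hWm : Measurable W := by fun_prop
  have hlip : ∀ x, |W x - W m| ≤ |x - m| := fun x => abs_posPart_sub_le l x m
  have hWint : Integrable W ρ := h.integrable_of_lipschitz hWm hlip
  have hsqint := h.integrable_sq_of_lipschitz hWm hlip
  have hsq := h.integral_sq_of_lipschitz hWm hlip
  have hindint : Integrable ((Set.Iic l).indicator fun _ => (b / p) ^ 2) ρ :=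
    (integrable_const _).indicator measurableSet_Iic
  have hpt : ∀ x, 2 * (b / p) * W x - (Set.Iic l).indicator (fun _ => (b / p) ^ 2) x
      ≤ (W x - W m) ^ 2 + 2 * W m * W x - W m ^ 2 := by
    intro x
    by_cases hx : x ≤ l
    · rw [Set.indicator_of_mem (show x ∈ Set.Iic l from hx)]
      nlinarith [sq_nonneg (W x - b / p)]
    · rw [Set.indicator_of_notMem (show x ∉ Set.Iic l from hx)]
      have : W x = 0 := max_eq_right (by linarith)
      rw [this]; nlinarith
  have hi := integral_mono ((hWint.const_mul (2 * (b / p))).sub hindint)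
    ((hsqint.add (hWint.const_mul (2 * W m))).sub (integrable_const (W m ^ 2))) hpt
  rw [integral_sub' (hWint.const_mul _) hindint, integral_const_mul, hl,
    integral_indicator_const _ measurableSet_Iic,
    integral_sub' (hsqint.add (hWint.const_mul _)) (integrable_const _),
    integral_add' hsqint (hWint.const_mul _), integral_const_mul, hl, integral_const,
    probReal_univ, one_smul, smul_eq_mul] at hi
  have h1 : ρ.real (Set.Iic l) * (b / p) ^ 2 < p * (b / p) ^ 2 :=
    mul_lt_mul_of_pos_right hq (by positivity)
  have e1 : p * (b / p) ^ 2 = b ^ 2 / p := by field_simp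
  have e2 : 2 * (b / p) * b = 2 * (b ^ 2 / p) := by ring
  have h2 : σ ^ 2 ≤ b ^ 2 / p - b ^ 2 := by
    rw [div_sub' hp.ne', le_div_iff₀ hp]; linarith
  nlinarith [sq_nonneg (b - W m)]

/-- The upward bias of clipping comes only from raising values to `l`. This is why `l` is fixed
through the partial moment `b` rather than as a quantile. -/
lemma HasMeanSD.integral_clip_le (h : HasMeanSD ρ m σ) {b l : ℝ}
    (hl : ∫ x, max (l - x) 0 ∂ρ = b) (c : ℝ) : ∫ x, max l (min x c) ∂ρ ≤ m + b := by
  have h1 : ∫ x, max l (min x c) ∂ρ ≤ ∫ x, (x + max (l - x) 0) ∂ρ := by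
    refine integral_mono (h.integrable_of_lipschitz (by fun_prop) fun x => abs_clip_sub_le l c x m)
      (h.integrable.add (h.integrable_of_lipschitz (by fun_prop)
        fun x => abs_posPart_sub_le l x m)) fun x => ?_
    refine max_le ?_ ((min_le_left _ _).trans ?_)
    · linarith [le_max_left (l - x) 0]
    · linarith [le_max_right (l - x) 0]
  rwa [integral_add h.integrable (h.integrable_of_lipschitz (by fun_prop)
    fun x => abs_posPart_sub_le l x m), h.mean, hl] at h1

/-- No lower bound on `x` is needed, so only the upper clipping level restricts the exponential
parameter. -/
lemma exp_le_one_add_add_sq {x : ℝ} (hx : x ≤ 1) : Real.exp x ≤ 1 + x + x ^ 2 := by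
  rcases le_total (-1) x with h | h
  · have := Real.abs_exp_sub_one_sub_id_le (abs_le.2 ⟨h, hx⟩)
    linarith [le_abs_self (Real.exp x - 1 - x)]
  · have : Real.exp x ≤ 1 := Real.exp_le_one_iff.2 (by linarith)
    nlinarith

/-- Exponential moment of a clipped variable. -/
lemma HasMeanSD.integral_exp_clip_le (h : HasMeanSD ρ m σ) {l U lam : ℝ} (hU : 0 ≤ U)
    (hl : l ≤ m + U) (hlam : 0 ≤ lam) (hlamU : lam * U ≤ 1) :
    Integrable (fun x => Real.exp (lam * (max l (min x (m + U))
        - ∫ y, max l (min y (m + U)) ∂ρ))) ρ ∧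
      ∫ x, Real.exp (lam * (max l (min x (m + U)) - ∫ y, max l (min y (m + U)) ∂ρ)) ∂ρ
        ≤ Real.exp (lam ^ 2 * σ ^ 2) := by
  set φ : ℝ → ℝ := fun x => max l (min x (m + U)) with hφ
  have hφm : Measurable φ := by fun_prop
  have hlip : ∀ x, |φ x - φ m| ≤ |x - m| := fun x => abs_clip_sub_le l (m + U) x m
  have hφint : Integrable φ ρ := h.integrable_of_lipschitz hφm hlip
  set E := ∫ y, φ y ∂ρ with hE
  have hφle : ∀ x, φ x ≤ m + U := fun x => max_le hl (min_le_right _ _)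
  have hφge : m ≤ φ m := le_max_of_le_right (le_min le_rfl (by linarith))
  have hint : Integrable (fun x => Real.exp (lam * (φ x - E))) ρ := by
    refine (integrable_const (Real.exp (lam * (m + U - E)))).mono' (by fun_prop)
      (.of_forall fun x => ?_)
    rw [Real.norm_eq_abs, abs_of_pos (Real.exp_pos _)]
    exact Real.exp_le_exp.2 (mul_le_mul_of_nonneg_left (by linarith [hφle x]) hlam)
  refine ⟨hint, ?_⟩
  have hsqint := h.integrable_sq_of_lipschitz hφm hlip
  have hsq := h.integral_sq_of_lipschitz hφm hlip
  have hdev : Integrable (fun x => φ x - φ m) ρ := hφint.sub (integrable_const _)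
  -- The expansion is about `φ m`, where `φ x - φ m ≤ U` and the second moment is at most `σ²` by
  -- the Lipschitz property. The linear term recombines with the prefactor after integration.
  have hpt : ∀ x, Real.exp (lam * (φ x - E)) ≤ Real.exp (lam * (φ m - E))
      * (1 + lam * (φ x - φ m) + lam ^ 2 * (φ x - φ m) ^ 2) := by
    intro x
    rw [show lam * (φ x - E) = lam * (φ m - E) + lam * (φ x - φ m) by ring, Real.exp_add,
      ← mul_pow]
    refine mul_le_mul_of_nonneg_left (exp_le_one_add_add_sq ?_) (Real.exp_pos _).le
    exact (mul_le_mul_of_nonneg_left (by linarith [hφle x] : φ x - φ m ≤ U) hlam).trans hlamU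
  have hi := integral_mono hint ((((integrable_const (1 : ℝ)).add (hdev.const_mul lam)).add
    (hsqint.const_mul (lam ^ 2))).const_mul (Real.exp (lam * (φ m - E)))) hpt
  refine hi.trans ?_
  rw [integral_const_mul, integral_add' ((integrable_const (1 : ℝ)).add (hdev.const_mul lam))
    (hsqint.const_mul (lam ^ 2)), integral_add' (integrable_const (1 : ℝ)) (hdev.const_mul lam),
    integral_const_mul, integral_const_mul, integral_const, probReal_univ, one_smul,
    integral_sub hφint (integrable_const _), integral_const, probReal_univ, one_smul, ← hE]
  have h1 : 1 + lam * (E - φ m) + lam ^ 2 * ∫ x, (φ x - φ m) ^ 2 ∂ρ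
      ≤ Real.exp (lam * (E - φ m) + lam ^ 2 * σ ^ 2) := by
    refine le_trans ?_ (Real.add_one_le_exp _)
    nlinarith [mul_le_mul_of_nonneg_left hsq (sq_nonneg lam)]
  calc _ ≤ Real.exp (lam * (φ m - E)) * Real.exp (lam * (E - φ m) + lam ^ 2 * σ ^ 2) :=
        mul_le_mul_of_nonneg_left h1 (Real.exp_pos _).le
    _ = _ := by rw [← Real.exp_add]; congr 1; ring

end Law

/-! ### Chernoff bounds -/

section Chernoff

variable {Ω ι : Type*} [MeasurableSpace Ω] {ν : Measure Ω} [IsProbabilityMeasure ν]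
  {X : ι → Ω → ℝ} {ρ : Measure ℝ}

lemma chernoff (hind : iIndepFun X ν) (hX : ∀ i, Measurable (X i)) (hlaw : ∀ i, ν.map (X i) = ρ)
    {h : ℝ → ℝ} (hh : Measurable h) (hint : Integrable (fun x => Real.exp (h x)) ρ) {b : ℝ}
    (hb : ∫ x, Real.exp (h x) ∂ρ ≤ Real.exp b) (s : Finset ι) (a : ℝ) :
    ν.real {ω | a ≤ ∑ i ∈ s, h (X i ω)} ≤ Real.exp (s.card * b - a) := by
  have hind' : iIndepFun (fun i ω => h (X i ω)) ν := hind.comp (fun _ => h) fun _ => hh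
  have hmeas : ∀ i, Measurable fun ω => h (X i ω) := fun i => hh.comp (hX i)
  have hexp : ∀ i, Integrable (fun ω => Real.exp (1 * h (X i ω))) ν := fun i => by
    rw [← hlaw i] at hint
    simpa [Function.comp_def] using hint.comp_measurable (hX i)
  have hsumint : Integrable (fun ω => Real.exp (1 * (∑ i ∈ s, fun ω => h (X i ω)) ω)) ν :=
    hind'.integrable_exp_mul_sum hmeas fun i _ => hexp i
  have h1 := measure_ge_le_exp_mul_mgf (μ := ν) (X := ∑ i ∈ s, fun ω => h (X i ω)) a zero_le_one
    hsumint
  rw [hind'.mgf_sum hmeas] at h1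
  have h2 : ∏ i ∈ s, mgf (fun ω => h (X i ω)) ν 1 ≤ Real.exp b ^ s.card := by
    rw [← Finset.prod_const]
    refine Finset.prod_le_prod (fun i _ => mgf_nonneg) fun i _ => ?_
    refine le_of_eq_of_le ?_ hb
    rw [mgf, ← hlaw i, integral_map (hX i).aemeasurable (by fun_prop)]
    simp
  simp only [Finset.sum_apply] at h1
  refine h1.trans ?_
  calc _ ≤ Real.exp (-1 * a) * Real.exp b ^ s.card := by gcongr
    _ = _ := by rw [← Real.exp_nat_mul, ← Real.exp_add]; congr 1; ring

/-- The parameter `t` may have either sign, so the same bound serves both tails of the count. -/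
lemma chernoff_card [IsProbabilityMeasure ρ] (hind : iIndepFun X ν) (hX : ∀ i, Measurable (X i))
    (hlaw : ∀ i, ν.map (X i) = ρ) (p : ℝ → Prop) [DecidablePred p]
    (hp : MeasurableSet {x | p x}) (s : Finset ι) (t a : ℝ) :
    ν.real {ω | t * a ≤ t * ((s.filter fun i => p (X i ω)).card : ℝ)}
      ≤ Real.exp (s.card * ((Real.exp t - 1) * ρ.real {x | p x}) - t * a) := by
  set h : ℝ → ℝ := {x | p x}.indicator fun _ => t with hh
  have hhm : Measurable h := measurable_const.indicator hp
  have e : (fun x => Real.exp (h x)) = fun x => 1 + {x | p x}.indicator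
      (fun _ => Real.exp t - 1) x := by
    funext x
    by_cases hx : x ∈ {x | p x}
    · simp [hh, hx]
    · simp [hh, hx]
  have hindint : Integrable ({x | p x}.indicator fun _ => Real.exp t - 1) ρ :=
    (integrable_const _).indicator hp
  have hint : Integrable (fun x => Real.exp (h x)) ρ := by
    rw [e]; exact (integrable_const _).add hindint
  have hb : ∫ x, Real.exp (h x) ∂ρ ≤ Real.exp ((Real.exp t - 1) * ρ.real {x | p x}) := by
    rw [e, integral_add (integrable_const _) hindint, integral_indicator_const _ hp,
      integral_const, probReal_univ, one_smul, smul_eq_mul]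
    have := Real.add_one_le_exp ((Real.exp t - 1) * ρ.real {x | p x})
    linarith
  refine le_of_eq_of_le ?_ (chernoff hind hX hlaw hhm hint hb s (t * a))
  congr 1
  ext ω
  simp only [Set.mem_ofPred_eq]
  have : ∑ i ∈ s, h (X i ω) = t * ((s.filter fun i => p (X i ω)).card : ℝ) := by
    simp [hh, Set.indicator_apply, Finset.sum_ite, mul_comm]
  rw [this]

end Chernoff

end AMDA

namespace AMDA

/-! ### The trimmed mean of a corrupted sample -/

section TrimmedMeanTail

variable {n : ℕ} {Out : Finset (Fin n)}

lemma card_inliers_eq (p : Fin n → Prop) [DecidablePred p] (q : ℝ → Prop) [DecidablePred q]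
    {x : Fin n → ℝ} {y : {i // i ∉ Out} → ℝ} (hxy : ∀ i (h : i ∉ Out), x i = y ⟨i, h⟩) :
    (Finset.univ.filter fun i => p i ∧ i ∉ Out ∧ q (x i)).card
      = ((Finset.univ.filter fun i : {i // i ∉ Out} => p i.1).filter fun i => q (y i)).card := by
  symm
  refine Finset.card_bij (fun i _ => i.1) (fun i hi => ?_) (fun i _ j _ h => Subtype.ext h)
    fun i hi => ?_
  · simp only [Finset.mem_filter, Finset.mem_univ, true_and] at hi ⊢
    exact ⟨hi.1, i.2, by rw [hxy i.1 i.2]; exact hi.2⟩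
  · simp only [Finset.mem_filter, Finset.mem_univ, true_and] at hi
    refine ⟨⟨i, hi.2.1⟩, ?_, rfl⟩
    simp only [Finset.mem_filter, Finset.mem_univ, true_and]
    exact ⟨hi.1, by rw [← hxy i hi.2.1]; exact hi.2.2⟩

lemma sum_inliers_eq (p : Fin n → Prop) [DecidablePred p] (F : ℝ → ℝ)
    {x : Fin n → ℝ} {y : {i // i ∉ Out} → ℝ} (hxy : ∀ i (h : i ∉ Out), x i = y ⟨i, h⟩) :
    ∑ i ∈ Finset.univ.filter (fun i => p i ∧ i ∉ Out), F (x i)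
      = ∑ i ∈ Finset.univ.filter (fun i : {i // i ∉ Out} => p i.1), F (y i) := by
  symm
  refine Finset.sum_bij (fun i _ => i.1) (fun i hi => ?_) (fun i _ j _ h => Subtype.ext h)
    (fun i hi => ?_) fun i _ => by rw [hxy i.1 i.2]
  · simp only [Finset.mem_filter, Finset.mem_univ, true_and] at hi ⊢
    exact ⟨hi, i.2⟩
  · simp only [Finset.mem_filter, Finset.mem_univ, true_and] at hi
    exact ⟨⟨i, hi.2⟩, by simpa using hi.1, rfl⟩

variable (Out) in
/-- The inliers of the first half. -/
def inliersFst : Finset {i // i ∉ Out} := Finset.univ.filter fun i => i.1.val < n / 2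

variable (Out) in
/-- The inliers of the second half. -/
def inliersSnd : Finset {i // i ∉ Out} := Finset.univ.filter fun i => n / 2 ≤ i.1.val

lemma card_inliersSnd_le (hn : Even n) : ((inliersSnd Out).card : ℝ) ≤ n / 2 := by
  rw [← card_secondHalf hn]
  exact_mod_cast Finset.card_le_card_of_injOn (fun i : {i // i ∉ Out} => i.1)
    (fun i hi => by simpa [inliersSnd] using hi) fun i _ j _ h => Subtype.ext h

lemma card_inliersFst_eq : (inliersFst Out).card
    = (Finset.univ.filter fun i : Fin n => i.val < n / 2 ∧ i ∉ Out).card := by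
  have := card_inliers_eq (Out := Out) (fun i => i.val < n / 2) (fun _ => True)
    (x := fun _ => 0) (y := fun _ => 0) fun _ _ => rfl
  simpa [inliersFst] using this.symm

lemma card_inliersFst_le (hn : Even n) : ((inliersFst Out).card : ℝ) ≤ n / 2 := by
  have h := card_firstHalf_compl n (fun i => i ∉ Out)
  rw [← natCast_half hn, card_inliersFst_eq]
  exact_mod_cast (by omega)

lemma le_card_inliersFst (hn : Even n) {η : ℝ} (hOut : (Out.card : ℝ) ≤ η * n) :
    n / 2 - η * n ≤ ((inliersFst Out).card : ℝ) := by
  have h := card_firstHalf_compl n (fun i => i ∉ Out)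
  rw [← card_inliersFst_eq] at h
  have h1 : (Finset.univ.filter fun i : Fin n => i.val < n / 2 ∧ ¬ i ∉ Out).card ≤ Out.card :=
    Finset.card_le_card fun i hi => by
      simp only [Finset.mem_filter, Finset.mem_univ, true_and, not_not] at hi
      exact hi.2
  have h2 : n / 2 ≤ (inliersFst Out).card + Out.card := by omega
  have h3 : ((n / 2 : ℕ) : ℝ) ≤ (inliersFst Out).card + Out.card := by exact_mod_cast h2
  rw [natCast_half hn] at h3
  linarith

variable {Ω : Type*} [MeasurableSpace Ω] {ν : Measure Ω} [IsProbabilityMeasure ν]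
  {X : {i // i ∉ Out} → Ω → ℝ} {ρ : Measure ℝ} [IsProbabilityMeasure ρ] {m σ η L α : ℝ}

/-- The last identity is the Chebyshev bound for exceeding `U = 8/5 * σ / √α`: it is `25/64 * α`,
well below the trimmed fraction `α`. -/
lemma clip_constants (hn0 : 0 < n) (hσ : 0 < σ) (hη : 0 ≤ η) (hL : 2 ≤ L)
    (hα : α = 8 * η + 12 * (L / n)) :
    0 < α ∧ α * n / 2 = 4 * (η * n) + 6 * L ∧ 0 ≤ η * n
      ∧ σ ^ 2 / (8 / 5 * (σ / Real.sqrt α)) ^ 2 = 25 / 64 * α := by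
  have hn' : (0 : ℝ) < n := by exact_mod_cast hn0
  have hα0 : 0 < α := by rw [hα]; positivity
  refine ⟨hα0, ?_, by positivity, ?_⟩
  · rw [hα]; field_simp; ring
  · rw [mul_pow, div_pow σ, Real.sq_sqrt hα0.le]; field_simp; norm_num

/-- Chernoff with `t = log 2`: the expected count above the level is at most `25/64` of `α n / 2`,
and `L ≥ 2` absorbs the additive constants. Quantifying over `x` makes the bound uniform in the
outliers. -/
lemma prob_not_fewAbove (hn0 : 0 < n) (hn : Even n) (hσ : 0 < σ) (hη : 0 ≤ η) (hL : 2 ≤ L)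
    (hα : α = 8 * η + 12 * (L / n)) (hind : iIndepFun X ν)
    (hX : ∀ i, Measurable (X i)) (hlaw : ∀ i, ν.map (X i) = ρ) (hρ : HasMeanSD ρ m σ) :
    ν.real {ω | ∃ x : Fin n → ℝ, (∀ i (h : i ∉ Out), x i = X ⟨i, h⟩ ω)
      ∧ ¬ FewAbove Out α η (m + 8 / 5 * (σ / Real.sqrt α)) x} ≤ Real.exp (-L - 1 / 2) := by
  obtain ⟨hα0, hαN, hηn, hU⟩ := clip_constants hn0 hσ hη hL hα
  set U := 8 / 5 * (σ / Real.sqrt α) with hUdef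
  have hU0 : 0 < U := by have := Real.sqrt_pos.2 hα0; positivity
  have hcheb := hρ.chebyshev hU0
  rw [hU] at hcheb
  set a := α * n / 2 - η * n - 1 with ha
  have hlog := Real.log_two_gt_d9
  have hch := chernoff_card hind hX hlaw (fun x => m + U < x) measurableSet_Ioi (inliersFst Out)
    (Real.log 2) a
  rw [Real.exp_log (by norm_num)] at hch
  have hsub : {ω | ∃ x : Fin n → ℝ, (∀ i (h : i ∉ Out), x i = X ⟨i, h⟩ ω)
      ∧ ¬ FewAbove Out α η (m + U) x} ⊆ {ω | Real.log 2 * a ≤ Real.log 2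
        * (((inliersFst Out).filter fun i => m + U < X i ω).card : ℝ)} := by
    rintro ω ⟨x, hx, hfew⟩
    rw [FewAbove, card_inliers_eq (fun i => i.val < n / 2) (fun y => m + U < y)
      (y := fun i => X i ω) hx, not_le] at hfew
    rw [Set.mem_ofPred_eq]
    have h0 : 0 ≤ Real.log 2 := by linarith
    refine mul_le_mul_of_nonneg_left ?_ h0
    unfold inliersFst
    linarith
  refine (measureReal_mono hsub).trans (hch.trans (Real.exp_le_exp.2 ?_))
  have h1 : ((inliersFst Out).card : ℝ) * ((2 - 1) * ρ.real {x | m + U < x})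
      ≤ n / 2 * (25 / 64 * α) := by
    rw [show (2 - 1 : ℝ) = 1 by norm_num, one_mul]
    exact mul_le_mul (card_inliersFst_le hn) hcheb measureReal_nonneg (by positivity)
  have h2 : (n : ℝ) / 2 * (25 / 64 * α) = 25 / 64 * (4 * (η * n) + 6 * L) := by
    rw [← hαN]; ring
  have h3 : 0.6931 * a ≤ Real.log 2 * a := by
    refine mul_le_mul_of_nonneg_right (by linarith) ?_
    rw [ha, hαN]; linarith
  rw [ha, hαN] at h3 ⊢
  linarith

/-- Chernoff with `t = -log 2`. As `8η ≤ α < 1/2`, at least `7n/16` inliers remain in the first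
half, so the expected count is at least `63/32` of `α n / 2`. -/
lemma prob_not_manyBelow (hn0 : 0 < n) (hn : Even n) (hσ : 0 < σ) (hη : 0 ≤ η) (hL : 2 ≤ L)
    (hα : α = 8 * η + 12 * (L / n)) (hα2 : α < 1 / 2) (hOut : (Out.card : ℝ) ≤ η * n)
    (hind : iIndepFun X ν) (hX : ∀ i, Measurable (X i)) (hlaw : ∀ i, ν.map (X i) = ρ) {l : ℝ}
    (hl : 9 / 4 * α ≤ ρ.real (Set.Iic l)) :
    ν.real {ω | ∃ x : Fin n → ℝ, (∀ i (h : i ∉ Out), x i = X ⟨i, h⟩ ω)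
      ∧ ¬ ManyBelow Out α l x} ≤ Real.exp (-L - 1 / 2) := by
  obtain ⟨hα0, hαN, hηn, -⟩ := clip_constants hn0 hσ hη hL hα
  set a := α * n / 2 + 1 with ha
  have hlog := Real.log_two_gt_d9
  have hlog' := Real.log_two_lt_d9
  have hch := chernoff_card hind hX hlaw (fun x => x ≤ l) measurableSet_Iic (inliersFst Out)
    (-Real.log 2) a
  rw [Real.exp_neg, Real.exp_log (by norm_num)] at hch
  have hsub : {ω | ∃ x : Fin n → ℝ, (∀ i (h : i ∉ Out), x i = X ⟨i, h⟩ ω)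
      ∧ ¬ ManyBelow Out α l x} ⊆ {ω | -Real.log 2 * a ≤ -Real.log 2
        * (((inliersFst Out).filter fun i => X i ω ≤ l).card : ℝ)} := by
    rintro ω ⟨x, hx, hfew⟩
    rw [ManyBelow, card_inliers_eq (fun i => i.val < n / 2) (fun y => y ≤ l)
      (y := fun i => X i ω) hx, not_le] at hfew
    exact mul_le_mul_of_nonpos_left hfew.le (by linarith)
  refine (measureReal_mono hsub).trans (hch.trans (Real.exp_le_exp.2 ?_))
  have hn' : (0 : ℝ) < n := by exact_mod_cast hn0
  have hη2 : η ≤ 1 / 16 := by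
    have : 0 ≤ 12 * (L / n) := by positivity
    linarith
  have hs : 7 / 16 * (n : ℝ) ≤ (inliersFst Out).card := by
    have := le_card_inliersFst hn hOut
    nlinarith
  have h1 : 7 / 16 * (n : ℝ) * (9 / 4 * α) ≤ (inliersFst Out).card * ρ.real {x | x ≤ l} :=
    mul_le_mul hs hl (by positivity) (by positivity)
  have h2 : 7 / 16 * (n : ℝ) * (9 / 4 * α) = 63 / 32 * (4 * (η * n) + 6 * L) := by
    rw [← hαN]; ring
  have h3 : Real.log 2 * a ≤ 0.6932 * a := by
    refine mul_le_mul_of_nonneg_right (by linarith) ?_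
    rw [ha, hαN]; linarith
  rw [ha, hαN] at h3 ⊢
  linarith

lemma prob_clipped_sum (hn0 : 0 < n) (hn : Even n) (hσ : 0 < σ) (hη : 0 ≤ η) (hL : 2 ≤ L)
    (hα : α = 8 * η + 12 * (L / n)) (hα2 : α < 1 / 2)
    (hind : iIndepFun X ν) (hX : ∀ i, Measurable (X i)) (hlaw : ∀ i, ν.map (X i) = ρ)
    (hρ : HasMeanSD ρ m σ) {l : ℝ} (hl : l ≤ m + 3 * (σ * Real.sqrt α))
    (hl' : ∫ x, max (l - x) 0 ∂ρ = 3 * (σ * Real.sqrt α)) :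
    ν.real {ω | ∃ x : Fin n → ℝ, (∀ i (h : i ∉ Out), x i = X ⟨i, h⟩ ω)
      ∧ ¬ ∑ i ∈ Finset.univ.filter (fun i : Fin n => n / 2 ≤ i.val ∧ i ∉ Out),
        (max l (min (x i) (m + 8 / 5 * (σ / Real.sqrt α))) - m) ≤ n / 2 * (4 * (σ * Real.sqrt α))}
      ≤ Real.exp (-L - 1 / 2) := by
  obtain ⟨hα0, hαN, hηn, -⟩ := clip_constants hn0 hσ hη hL hα
  have hq := Real.sqrt_pos.2 hα0
  have hq2 := Real.sq_sqrt hα0.le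
  set q := Real.sqrt α with hqdef
  set U := 8 / 5 * (σ / q) with hU
  have hU0 : 0 < U := by positivity
  have hn' : (0 : ℝ) < n := by exact_mod_cast hn0
  have hlU : l ≤ m + U := by
    refine hl.trans (add_le_add_right ?_ m)
    have : U = 8 / 5 * σ / q := by rw [hU]; ring
    rw [this, le_div_iff₀ hq]
    nlinarith
  -- This makes `lam * U = 4/5` and `lam² σ² = α / 4`. Of the bound `4σq`, the part `3σq` is bias
  -- and `σq` is fluctuation.
  set lam := q / (2 * σ) with hlam
  have hlam0 : 0 < lam := by positivity
  have hlamU : lam * U ≤ 1 := by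
    have : lam * U = 4 / 5 := by rw [hlam, hU]; field_simp; norm_num
    rw [this]; norm_num
  obtain ⟨hint, hexp⟩ := hρ.integral_exp_clip_le hU0.le hlU hlam0.le hlamU
  have hclip := hρ.integral_clip_le hl' (m + U)
  set E := ∫ x, max l (min x (m + U)) ∂ρ with hE
  have hls : lam ^ 2 * σ ^ 2 = α / 4 := by
    rw [hlam, ← hq2]; field_simp; norm_num
  have hch := chernoff hind hX hlaw (by fun_prop) hint hexp (inliersSnd Out)
    (lam * (n / 2 * (σ * q)))
  have hsub : {ω | ∃ x : Fin n → ℝ, (∀ i (h : i ∉ Out), x i = X ⟨i, h⟩ ω)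
      ∧ ¬ ∑ i ∈ Finset.univ.filter (fun i : Fin n => n / 2 ≤ i.val ∧ i ∉ Out),
        (max l (min (x i) (m + U)) - m) ≤ n / 2 * (4 * (σ * q))}
      ⊆ {ω | lam * (n / 2 * (σ * q))
        ≤ ∑ i ∈ inliersSnd Out, lam * (max l (min (X i ω) (m + U)) - E)} := by
    rintro ω ⟨x, hx, hs⟩
    rw [sum_inliers_eq (fun i => n / 2 ≤ i.val) (fun y => max l (min y (m + U)) - m)
      (y := fun i => X i ω) hx, not_le] at hs
    change _ < ∑ i ∈ inliersSnd Out, _ at hs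
    rw [Set.mem_ofPred_eq, ← Finset.mul_sum]
    refine mul_le_mul_of_nonneg_left ?_ hlam0.le
    rw [Finset.sum_sub_distrib, Finset.sum_const, nsmul_eq_mul] at hs ⊢
    have h1 : ((inliersSnd Out).card : ℝ) * E
        ≤ (inliersSnd Out).card * (m + 3 * (σ * q)) := by gcongr
    have h2 : ((inliersSnd Out).card : ℝ) * (3 * (σ * q)) ≤ n / 2 * (3 * (σ * q)) := by
      gcongr; exact card_inliersSnd_le hn
    linarith
  refine (measureReal_mono hsub).trans (hch.trans (Real.exp_le_exp.2 ?_))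
  have h1 : ((inliersSnd Out).card : ℝ) * (lam ^ 2 * σ ^ 2) ≤ n / 2 * (α / 4) := by
    rw [hls]; gcongr; exact card_inliersSnd_le hn
  have h2 : lam * (n / 2 * (σ * q)) = α * n / 2 / 2 := by
    rw [hlam, ← hq2]; field_simp
  have h3 : (n : ℝ) / 2 * (α / 4) = α * n / 2 / 4 := by ring
  rw [h2, hαN]
  rw [h3, hαN] at h1
  linarith

/-- Concentration of the trimmed mean, uniformly over the values of the outliers. -/
theorem prob_trimmedMean_error (hn0 : 0 < n) (hn : Even n) (hσ : 0 < σ) (hη : 0 ≤ η) (hL : 2 ≤ L)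
    (hα : α = 8 * η + 12 * (L / n)) (hα2 : α < 1 / 2) (hOut : (Out.card : ℝ) ≤ η * n)
    (hind : iIndepFun X ν) (hX : ∀ i, Measurable (X i)) (hlaw : ∀ i, ν.map (X i) = ρ)
    (hρ : HasMeanSD ρ m σ) :
    ν.real {ω | ∃ x : Fin n → ℝ, (∀ i (h : i ∉ Out), x i = X ⟨i, h⟩ ω)
      ∧ 7 * σ * Real.sqrt (α / 2) < |trimmedMean α x - m|} ≤ 4 * Real.exp (-L) := by
  obtain ⟨hα0, hαN, hηn, -⟩ := clip_constants hn0 hσ hη hL hα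
  have hq := Real.sqrt_pos.2 hα0
  have hq2 := Real.sq_sqrt hα0.le
  have hind' : iIndepFun (fun i ω => -X i ω) ν := hind.comp (fun _ x => -x) fun _ => measurable_neg
  have hX' : ∀ i, Measurable fun ω => -X i ω := fun i => (hX i).neg
  have hlaw' : ∀ i, ν.map (fun ω => -X i ω) = ρ.map fun x => -x := fun i => by
    rw [← hlaw i, Measure.map_map measurable_neg (hX i)]; rfl
  have : IsProbabilityMeasure (ρ.map fun x => -x) :=
    Measure.isProbabilityMeasure_map measurable_neg.aemeasurable
  have hρ' := hρ.neg
  have hfew := prob_not_fewAbove (Out := Out) hn0 hn hσ hη hL hα hind hX hlaw hρ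
  have hfew' := prob_not_fewAbove (Out := Out) hn0 hn hσ hη hL hα hind' hX' hlaw' hρ'
  have hroot : 7 / 10 * Real.sqrt α ≤ Real.sqrt (α / 2) := by
    refine Real.le_sqrt_of_sq_le ?_
    rw [mul_pow, hq2]; linarith
  -- At most six events occur, and `6 * (2/3) = 4`; the extra `1/2` in each exponent pays for this
  -- count.
  have hexp : Real.exp (-L - 1 / 2) ≤ 2 / 3 * Real.exp (-L) := by
    rw [sub_eq_add_neg, Real.exp_add, mul_comm]
    refine mul_le_mul_of_nonneg_right ?_ (Real.exp_pos _).le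
    rw [Real.exp_neg, inv_le_comm₀ (Real.exp_pos _) (by norm_num)]
    refine le_trans (by norm_num) (Real.add_one_le_exp (1 / 2))
  have hneg : ∀ {ω} {x : Fin n → ℝ}, (∀ i (h : i ∉ Out), x i = X ⟨i, h⟩ ω) →
      ∀ i (h : i ∉ Out), -x i = -X ⟨i, h⟩ ω := fun hx i h => by rw [hx i h]
  set q := Real.sqrt α with hqdef
  set U := 8 / 5 * (σ / q) with hU
  have hUq : U * q = 8 / 5 * σ := by rw [hU]; field_simp
  have hU0 : 0 < U := by positivity
  -- Below `1/3` the bias bound is needed, and `p = 9/4 * α` with `b = 3σ√α` satisfies the condition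
  -- of `le_measureReal_Iic` exactly in this range. Above `1/3` the quantile bound `U` alone is at
  -- most `4.9 σ√α`.
  rcases le_or_gt α (1 / 3) with hα3 | hα3
  · have hb : 0 < 3 * (σ * q) := by positivity
    have hbp : 9 / 4 * α * σ ^ 2 ≤ (3 * (σ * q)) ^ 2 * (1 - 9 / 4 * α) := by
      rw [mul_pow, mul_pow, hq2]
      have : 0 < α * σ ^ 2 := by positivity
      nlinarith
    obtain ⟨l, hl1, hl2⟩ := hρ.exists_level hb
    obtain ⟨l', hl1', hl2'⟩ := hρ'.exists_level hb
    have hl3 := hρ.le_measureReal_Iic (by positivity) hb hl2 hbp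
    have hl3' := hρ'.le_measureReal_Iic (by positivity) hb hl2' hbp
    have hmany := prob_not_manyBelow hn0 hn hσ hη hL hα hα2 hOut hind hX hlaw hl3
    have hmany' := prob_not_manyBelow hn0 hn hσ hη hL hα hα2 hOut hind' hX' hlaw' hl3'
    have hsum := prob_clipped_sum hn0 hn hσ hη hL hα hα2 hind hX hlaw hρ hl1 hl2
    have hsum' := prob_clipped_sum hn0 hn hσ hη hL hα hα2 hind' hX' hlaw' hρ' hl1' hl2'
    rw [← hqdef, ← hU] at hsum hsum'
    set E1 := {ω | ∃ x : Fin n → ℝ, (∀ i (h : i ∉ Out), x i = X ⟨i, h⟩ ω)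
      ∧ ¬ FewAbove Out α η (m + U) x}
    set E2 := {ω | ∃ x : Fin n → ℝ, (∀ i (h : i ∉ Out), x i = -X ⟨i, h⟩ ω)
      ∧ ¬ FewAbove Out α η (-m + U) x}
    set E3 := {ω | ∃ x : Fin n → ℝ, (∀ i (h : i ∉ Out), x i = X ⟨i, h⟩ ω) ∧ ¬ ManyBelow Out α l x}
    set E4 := {ω | ∃ x : Fin n → ℝ, (∀ i (h : i ∉ Out), x i = -X ⟨i, h⟩ ω)
      ∧ ¬ ManyBelow Out α l' x}
    set E5 := {ω | ∃ x : Fin n → ℝ, (∀ i (h : i ∉ Out), x i = X ⟨i, h⟩ ω)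
      ∧ ¬ ∑ i ∈ Finset.univ.filter (fun i : Fin n => n / 2 ≤ i.val ∧ i ∉ Out),
        (max l (min (x i) (m + U)) - m) ≤ n / 2 * (4 * (σ * q))}
    set E6 := {ω | ∃ x : Fin n → ℝ, (∀ i (h : i ∉ Out), x i = -X ⟨i, h⟩ ω)
      ∧ ¬ ∑ i ∈ Finset.univ.filter (fun i : Fin n => n / 2 ≤ i.val ∧ i ∉ Out),
        (max l' (min (x i) (-m + U)) - -m) ≤ n / 2 * (4 * (σ * q))}
    have hsub : {ω | ∃ x : Fin n → ℝ, (∀ i (h : i ∉ Out), x i = X ⟨i, h⟩ ω)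
        ∧ 7 * σ * Real.sqrt (α / 2) < |trimmedMean α x - m|}
        ⊆ ((E1 ∪ E2) ∪ (E3 ∪ E4)) ∪ (E5 ∪ E6) := by
      rintro ω ⟨x, hx, herr⟩
      by_contra hω
      simp only [Set.mem_union, not_or] at hω
      obtain ⟨⟨⟨h1, h2⟩, h3, h4⟩, h5, h6⟩ := hω
      have g1 : FewAbove Out α η (m + U) x := by by_contra h; exact h1 ⟨x, hx, h⟩
      have g2 : FewAbove Out α η (-m + U) fun i => -x i := by
        by_contra h; exact h2 ⟨_, hneg hx, h⟩
      have g3 : ManyBelow Out α l x := by by_contra h; exact h3 ⟨x, hx, h⟩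
      have g4 : ManyBelow Out α l' fun i => -x i := by by_contra h; exact h4 ⟨_, hneg hx, h⟩
      have g5 : ∑ i ∈ Finset.univ.filter (fun i : Fin n => n / 2 ≤ i.val ∧ i ∉ Out),
          (max l (min (x i) (m + U)) - m) ≤ n / 2 * (4 * (σ * q)) := by
        by_contra h; exact h5 ⟨x, hx, h⟩
      have g6 : ∑ i ∈ Finset.univ.filter (fun i : Fin n => n / 2 ≤ i.val ∧ i ∉ Out),
          (max l' (min (-x i) (-m + U)) - -m) ≤ n / 2 * (4 * (σ * q)) := by
        by_contra h; exact h6 ⟨_, hneg hx, h⟩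
      have hfin := abs_trimmedMean_sub_le hn0 hn hα2 hU0.le hOut g1 g2 g3 g4 g5 g6
      have hηα : 8 * η ≤ α := by
        have : 0 ≤ 12 * (L / n) := by positivity
        linarith
      have h7 : 2 * η * U ≤ 2 / 5 * (σ * q) := by
        calc 2 * η * U ≤ 2 * (α / 8) * U := by gcongr; linarith
          _ = 1 / 4 * q * (U * q) := by rw [← hq2]; ring
          _ = _ := by rw [hUq]; ring
      have h8 := mul_le_mul_of_nonneg_left hroot hσ.le
      have h9 : 0 < σ * q := by positivity
      linarith
    have hu1 := measureReal_union_le (μ := ν) ((E1 ∪ E2) ∪ (E3 ∪ E4)) (E5 ∪ E6)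
    have hu2 := measureReal_union_le (μ := ν) (E1 ∪ E2) (E3 ∪ E4)
    have hu3 := measureReal_union_le (μ := ν) E1 E2
    have hu4 := measureReal_union_le (μ := ν) E3 E4
    have hu5 := measureReal_union_le (μ := ν) E5 E6
    have := measureReal_mono (μ := ν) hsub
    linarith
  · set E1 := {ω | ∃ x : Fin n → ℝ, (∀ i (h : i ∉ Out), x i = X ⟨i, h⟩ ω)
      ∧ ¬ FewAbove Out α η (m + U) x}
    set E2 := {ω | ∃ x : Fin n → ℝ, (∀ i (h : i ∉ Out), x i = -X ⟨i, h⟩ ω)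
      ∧ ¬ FewAbove Out α η (-m + U) x}
    have hsub : {ω | ∃ x : Fin n → ℝ, (∀ i (h : i ∉ Out), x i = X ⟨i, h⟩ ω)
        ∧ 7 * σ * Real.sqrt (α / 2) < |trimmedMean α x - m|} ⊆ E1 ∪ E2 := by
      rintro ω ⟨x, hx, herr⟩
      by_contra hω
      simp only [Set.mem_union, not_or] at hω
      obtain ⟨h1, h2⟩ := hω
      have g1 : FewAbove Out α η (m + U) x := by by_contra h; exact h1 ⟨x, hx, h⟩
      have g2 : FewAbove Out α η (-m + U) fun i => -x i := by
        by_contra h; exact h2 ⟨_, hneg hx, h⟩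
      have hfin := abs_trimmedMean_sub_le_of_fewAbove hn0 hn hα2 hOut g1 g2
      have h3 : U ≤ 4.9 * (σ * q) := by
        have e : U * q ≤ 4.9 * (σ * q) * q := by
          rw [hUq, mul_assoc, mul_assoc, ← sq, hq2]; nlinarith
        exact le_of_mul_le_mul_right e hq
      have h8 := mul_le_mul_of_nonneg_left hroot hσ.le
      linarith
    have hu3 := measureReal_union_le (μ := ν) E1 E2
    have := measureReal_mono (μ := ν) hsub
    have hpos := Real.exp_pos (-L)
    linarith

end TrimmedMeanTail

end AMDA

namespace AMDA

/-! ### The gradient estimator of one batch -/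

section Batch

variable {d n : ℕ} {𝒴 : Set ℝ} {ℓ ℓ' : ℝ → ℝ → ℝ} {P : Measure (Vec d × ℝ)}
  {Out : Finset (Fin n)} {α ε : ℝ} {S : Set (Vec d)}

/-- The parameters and inliers for which some (rational) values of the outlying gradient samples
make the trimmed mean of some coordinate miss the mean gradient by more than `ε`. -/
def estimatorFailure (ℓ' : ℝ → ℝ → ℝ) (P : Measure (Vec d × ℝ)) (α ε : ℝ) (S : Set (Vec d))
    (Out : Finset (Fin n)) : Set (Vec d × ({i : Fin n // i ∉ Out} → Vec d × ℝ)) :=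
  {p | p.1 ∈ S ∧ ∃ j : Fin d, ∃ q : Fin n → ℚ, ε < |trimmedMean α (fun i =>
    if h : i ∉ Out then gradSample ℓ' p.1 (p.2 ⟨i, h⟩) j else (q i : ℝ)) - meanGrad ℓ' P p.1 j|}

lemma measurable_gradSample_apply (hloss : IsAdmissibleLoss 𝒴 ℓ ℓ') (j : Fin d) :
    Measurable fun p : Vec d × (Vec d × ℝ) => gradSample ℓ' p.1 p.2 j :=
  (by fun_prop : Measurable fun v : Vec d => v j).comp (measurable_gradSample hloss)

lemma measurable_gradSample_comp (hloss : IsAdmissibleLoss 𝒴 ℓ ℓ') {A : Type*} [MeasurableSpace A]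
    {θ : A → Vec d} {z : A → Vec d × ℝ} (hθ : Measurable θ) (hz : Measurable z) (j : Fin d) :
    Measurable fun a => gradSample ℓ' (θ a) (z a) j := by
  have := (measurable_gradSample_apply hloss j).comp (hθ.prodMk hz)
  exact this

lemma measurableSet_estimatorFailure [IsProbabilityMeasure P] (hloss : IsAdmissibleLoss 𝒴 ℓ ℓ')
    (hS : MeasurableSet S) : MeasurableSet (estimatorFailure ℓ' P α ε S Out) := by
  have e : estimatorFailure ℓ' P α ε S Out = {p | p.1 ∈ S} ∩ ⋃ j : Fin d, ⋃ q : Fin n → ℚ,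
      {p | ε < |trimmedMean α (fun i => if h : i ∉ Out then gradSample ℓ' p.1 (p.2 ⟨i, h⟩) j
        else (q i : ℝ)) - meanGrad ℓ' P p.1 j|} := by
    ext p
    simp [estimatorFailure]
  rw [e]
  refine (measurable_fst hS).inter (.iUnion fun j => .iUnion fun q => ?_)
  refine measurableSet_lt measurable_const ?_
  have h1 : Measurable fun p : Vec d × ({i : Fin n // i ∉ Out} → Vec d × ℝ) => fun i : Fin n =>
      if h : i ∉ Out then gradSample ℓ' p.1 (p.2 ⟨i, h⟩) j else (q i : ℝ) := by
    refine measurable_pi_lambda _ fun i => ?_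
    by_cases h : i ∉ Out
    · simp only [dif_pos h]
      exact measurable_gradSample_comp hloss measurable_fst
        ((measurable_pi_apply _).comp measurable_snd) j
    · simp only [dif_neg h]
      exact measurable_const
  have h2 := (continuous_trimmedMean n α).measurable.comp h1
  exact continuous_abs.measurable.comp
    (h2.sub ((measurable_meanGrad hloss j).comp measurable_fst))

/-- The error exceeds `ε` on an open set of outlier values, so a rational point lies in it. A
countable union thus covers all outliers and stays measurable. -/
lemma mem_estimatorFailure {θ : Vec d} (hθ : θ ∈ S) {z : Fin n → Vec d × ℝ} {j : Fin d}
    (h : ε < |gradEst ℓ' α z θ j - meanGrad ℓ' P θ j|) :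
    (θ, fun i : {i : Fin n // i ∉ Out} => z i.1) ∈ estimatorFailure ℓ' P α ε S Out := by
  refine ⟨hθ, j, ?_⟩
  set f : (Fin n → ℝ) → ℝ := fun v => |trimmedMean α (fun i =>
    if _ : i ∉ Out then gradSample ℓ' θ (z i) j else v i) - meanGrad ℓ' P θ j| with hf
  have hcont : Continuous f := by
    have h1 : Continuous fun (v : Fin n → ℝ) (i : Fin n) =>
        if _ : i ∉ Out then gradSample ℓ' θ (z i) j else v i := by
      refine continuous_pi fun i => ?_
      by_cases h : i ∉ Out
      · simp only [dif_pos h]; exact continuous_const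
      · simp only [dif_neg h]; exact continuous_apply i
    exact (((continuous_trimmedMean n α).comp h1).sub continuous_const).abs
  have hdense : DenseRange (Pi.map fun (_ : Fin n) (q : ℚ) => (q : ℝ)) :=
    DenseRange.piMap fun _ => Rat.denseRange_cast
  have hmem : f (fun i => gradSample ℓ' θ (z i) j) = |gradEst ℓ' α z θ j - meanGrad ℓ' P θ j| := by
    simp only [hf, dite_eq_ite, ite_self]; rfl
  obtain ⟨q, hq⟩ := hdense.exists_mem_open (hcont.isOpen_preimage _ isOpen_Ioi)
    ⟨_, show f (fun i => gradSample ℓ' θ (z i) j) ∈ Set.Ioi ε from hmem ▸ h⟩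
  exact ⟨q, hq⟩

lemma hasMeanSD_gradSample [IsProbabilityMeasure P] (hloss : IsAdmissibleLoss 𝒴 ℓ ℓ')
    (hmom : HasMoments 𝒴 P) {σ : ℝ} {θ : Vec d} {j : Fin d}
    (hvar : variance (fun z => gradSample ℓ' θ z j) P ≤ σ ^ 2) :
    HasMeanSD (P.map fun z => gradSample ℓ' θ z j) (meanGrad ℓ' P θ j) σ := by
  have hm : Measurable fun z => gradSample ℓ' θ z j :=
    measurable_gradSample_comp hloss measurable_const measurable_id j
  refine ⟨(memLp_map_measure_iff aestronglyMeasurable_id hm.aemeasurable).2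
    (memLp_gradSample hloss hmom θ j), ?_, ?_⟩
  · rw [integral_map hm.aemeasurable (by fun_prop)]; rfl
  · rw [integral_map hm.aemeasurable (by fun_prop)]
    rwa [variance_eq_integral hm.aemeasurable] at hvar

lemma pi_trimmedMean_error {E : Type*} [MeasurableSpace E] {P : Measure E} [IsProbabilityMeasure P]
    {σ η L m : ℝ} (hn0 : 0 < n) (hn : Even n) (hσ : 0 < σ) (hη : 0 ≤ η) (hL : 2 ≤ L)
    (hα : α = 8 * η + 12 * (L / n)) (hα2 : α < 1 / 2) (hOut : (Out.card : ℝ) ≤ η * n)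
    {f : E → ℝ} (hf : Measurable f) (hρ : HasMeanSD (P.map f) m σ) :
    (Measure.pi fun _ : {i : Fin n // i ∉ Out} => P).real {y | ∃ x : Fin n → ℝ,
      (∀ i (h : i ∉ Out), x i = f (y ⟨i, h⟩))
        ∧ 7 * σ * Real.sqrt (α / 2) < |trimmedMean α x - m|} ≤ 4 * Real.exp (-L) := by
  have : IsProbabilityMeasure (P.map f) := Measure.isProbabilityMeasure_map hf.aemeasurable
  have hind : iIndepFun (fun (i : {i : Fin n // i ∉ Out}) (y : {i : Fin n // i ∉ Out} → E) =>
      f (y i)) (Measure.pi fun _ => P) :=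
    iIndepFun_pi (X := fun _ => f) fun _ => hf.aemeasurable
  refine prob_trimmedMean_error (ρ := P.map f) hn0 hn hσ hη hL hα hα2 hOut hind
    (fun i => hf.comp (measurable_pi_apply i)) (fun i => ?_) hρ
  have h1 := (measurePreserving_eval (fun _ : {i : Fin n // i ∉ Out} => P) i).map_eq
  have h2 := Measure.map_map (μ := Measure.pi fun _ : {i : Fin n // i ∉ Out} => P) hf
    (measurable_pi_apply i)
  exact h2.symm.trans (congrArg (Measure.map f) h1)

lemma pi_estimatorFailure_le [IsProbabilityMeasure P] (hd : 3 ≤ d)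
    (hloss : IsAdmissibleLoss 𝒴 ℓ ℓ') (hmom : HasMoments 𝒴 P) {σ η δt : ℝ}
    (hn0 : 0 < n) (hn : Even n) (hσ : 0 < σ) (hη : 0 ≤ η) (hδ : 0 < δt) (hδ1 : δt ≤ 1)
    (hα : α = trimLevel η δt d n) (hα2 : α < 1 / 2) (hε : ε = 7 * σ * statRate η δt d n)
    (hOut : (Out.card : ℝ) ≤ η * n)
    (hvar : ∀ θ ∈ S, ∀ j, variance (fun z => gradSample ℓ' θ z j) P ≤ σ ^ 2) (θ : Vec d) :
    (Measure.pi fun _ : {i : Fin n // i ∉ Out} => P)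
      {y | (θ, y) ∈ estimatorFailure ℓ' P α ε S Out} ≤ ENNReal.ofReal δt := by
  by_cases hθ : θ ∈ S
  swap
  · have : {y | (θ, y) ∈ estimatorFailure ℓ' P α ε S Out} = ∅ := by
      ext y; simp [estimatorFailure, hθ]
    rw [this, measure_empty]; exact bot_le
  set ν := Measure.pi fun _ : {i : Fin n // i ∉ Out} => P with hν
  set L := Real.log (4 / δt) + Real.log d with hL
  have hlogd := one_lt_log_of_three_le hd
  have hL2 : 2 ≤ L := by
    have h1 : Real.log 4 ≤ Real.log (4 / δt) :=
      Real.log_le_log (by norm_num) (by rw [le_div_iff₀ hδ]; linarith)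
    have h2 : Real.log 4 = 2 * Real.log 2 := by
      rw [show (4 : ℝ) = 2 ^ 2 by norm_num, Real.log_pow]; norm_num
    linarith [Real.log_two_gt_d9]
  have hrate : ε = 7 * σ * Real.sqrt (α / 2) := by
    rw [hε, hα, statRate, trimLevel]
    congr 2; ring
  -- `log d` in `L` pays for the union bound over the `d` coordinates.
  have hexpL : 4 * Real.exp (-L) = δt / d := by
    have hd0 : (0 : ℝ) < d := by positivity
    rw [hL, neg_add, Real.exp_add, Real.exp_neg, Real.exp_neg, Real.exp_log (by positivity),
      Real.exp_log hd0]
    field_simp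
  have hj : ∀ j : Fin d, ν.real {y | ∃ x : Fin n → ℝ,
      (∀ i (h : i ∉ Out), x i = gradSample ℓ' θ (y ⟨i, h⟩) j)
        ∧ ε < |trimmedMean α x - meanGrad ℓ' P θ j|} ≤ δt / d := by
    intro j
    have hm : Measurable fun z => gradSample ℓ' θ z j :=
      measurable_gradSample_comp hloss measurable_const measurable_id j
    rw [← hexpL, hrate]
    exact pi_trimmedMean_error hn0 hn hσ hη hL2 hα hα2 hOut hm
      (hasMeanSD_gradSample hloss hmom (hvar θ hθ j))
  have hsub : {y | (θ, y) ∈ estimatorFailure ℓ' P α ε S Out} ⊆ ⋃ j : Fin d, {y | ∃ x : Fin n → ℝ,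
      (∀ i (h : i ∉ Out), x i = gradSample ℓ' θ (y ⟨i, h⟩) j)
        ∧ ε < |trimmedMean α x - meanGrad ℓ' P θ j|} := by
    rintro y ⟨-, j, q, hq⟩
    exact Set.mem_iUnion.2 ⟨j, _, fun i h => dif_pos h, hq⟩
  have hreal : ν.real {y | (θ, y) ∈ estimatorFailure ℓ' P α ε S Out} ≤ δt := by
    refine (measureReal_mono hsub).trans ((measureReal_iUnion_fintype_le _).trans ?_)
    refine (Finset.sum_le_card_nsmul _ _ _ fun j _ => hj j).trans (le_of_eq ?_)
    have hd0 : (d : ℝ) ≠ 0 := by positivity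
    rw [Finset.card_univ, Fintype.card_fin, nsmul_eq_mul]
    field_simp
  rw [← ofReal_measureReal]
  exact ENNReal.ofReal_le_ofReal hreal

variable {Ω : Type*} [MeasurableSpace Ω] {μ : Measure Ω} [IsProbabilityMeasure μ] {T : ℕ}

/-- The failure event depends on the parameter and the inliers of batch `t` only, and these are
independent. The joint law is a product and the fixed-parameter bound integrates. The outliers of
batch `t` may depend on everything. -/
lemma prob_estimator_error_le [IsProbabilityMeasure P] (hd : 3 ≤ d)
    (hloss : IsAdmissibleLoss 𝒴 ℓ ℓ') (hmom : HasMoments 𝒴 P) {σ η δt : ℝ}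
    (hn0 : 0 < n) (hn : Even n) (hσ : 0 < σ) (hη : 0 ≤ η) (hδ : 0 < δt) (hδ1 : δt ≤ 1)
    (hα : α = trimLevel η δt d n) (hα2 : α < 1 / 2) (hε : ε = 7 * σ * statRate η δt d n)
    (hS : MeasurableSet S)
    (hvar : ∀ θ ∈ S, ∀ j, variance (fun z => gradSample ℓ' θ z j) P ≤ σ ^ 2)
    {O : Finset (Fin T × Fin n)} {Z : Fin T → Fin n → Ω → Vec d × ℝ}
    (hZ : IsCorruptedSample μ P η O Z) (t : Fin T)
    {F : ({p : Fin T × Fin n // p.1 < t} → Vec d × ℝ) → Vec d} (hF : Measurable F) :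
    μ {ω | F (fun p => Z p.1.1 p.1.2 ω) ∈ S ∧ ∃ j, ε < |gradEst ℓ' α (fun i => Z t i ω)
      (F fun p => Z p.1.1 p.1.2 ω) j - meanGrad ℓ' P (F fun p => Z p.1.1 p.1.2 ω) j|}
      ≤ ENNReal.ofReal δt := by
  set Out : Finset (Fin n) := Finset.univ.filter fun i => (t, i) ∈ O with hOutdef
  have hmemOut : ∀ i, i ∉ Out ↔ (t, i) ∉ O := fun i => by simp [hOutdef]
  set past : Ω → ({p : Fin T × Fin n // p.1 < t} → Vec d × ℝ) :=
    fun ω p => Z p.1.1 p.1.2 ω with hpast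
  set inl : Ω → ({i : Fin n // i ∉ Out} → Vec d × ℝ) := fun ω i => Z t i.1 ω with hinl
  have hpastm : Measurable past := measurable_pi_lambda _ fun p => hZ.measurable _ _
  have hinlm : Measurable inl := measurable_pi_lambda _ fun p => hZ.measurable _ _
  have hre : Measurable fun (w : {i : Fin n // (t, i) ∉ O} → Vec d × ℝ)
      (i : {i : Fin n // i ∉ Out}) => w ⟨i.1, (hmemOut i.1).1 i.2⟩ :=
    measurable_pi_lambda _ fun i => measurable_pi_apply _
  have hindep : IndepFun (fun ω => F (past ω)) inl μ :=
    ((hZ.indep_past t).comp hre hF).symm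
  have hlaw : μ.map inl = Measure.pi fun _ => P := by
    have hind : iIndepFun (fun i : {i : Fin n // i ∉ Out} => Z t i.1) μ :=
      hZ.indep.precomp (g := fun i : {i : Fin n // i ∉ Out} =>
        (⟨(t, i.1), (hmemOut i.1).1 i.2⟩ : {p : Fin T × Fin n // p ∉ O}))
        fun i j h => Subtype.ext (by simpa using h)
    refine (hind.map_fun_eq_pi_map (f := fun i : {i : Fin n // i ∉ Out} => Z t i.1)
      fun i => (hZ.measurable t i.1).aemeasurable).trans ?_
    congr 1
    funext i
    exact hZ.law t i.1 ((hmemOut i.1).1 i.2)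
  have hFm : Measurable fun ω => F (past ω) := hF.comp hpastm
  have hsub : {ω | F (past ω) ∈ S ∧ ∃ j, ε < |gradEst ℓ' α (fun i => Z t i ω) (F (past ω)) j
      - meanGrad ℓ' P (F (past ω)) j|}
      ⊆ (fun ω => (F (past ω), inl ω)) ⁻¹' estimatorFailure ℓ' P α ε S Out := by
    rintro ω ⟨h1, j, hj⟩
    have := mem_estimatorFailure (Out := Out) (z := fun i => Z t i ω) h1 hj
    exact this
  refine (measure_mono hsub).trans ?_
  have hmeas : MeasurableSet (estimatorFailure ℓ' P α ε S Out) :=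
    measurableSet_estimatorFailure hloss hS
  have : IsProbabilityMeasure (μ.map fun ω => F (past ω)) :=
    Measure.isProbabilityMeasure_map hFm.aemeasurable
  rw [← Measure.map_apply (hFm.prodMk hinlm) hmeas,
    (indepFun_iff_map_prod_eq_prod_map_map hFm.aemeasurable hinlm.aemeasurable).1 hindep, hlaw,
    Measure.prod_apply hmeas]
  refine (lintegral_mono fun θ => pi_estimatorFailure_le hd hloss hmom hn0 hn hσ hη hδ hδ1 hα hα2
    hε (hZ.card_outliers t) hvar θ).trans ?_
  rw [lintegral_const, measure_univ, mul_one]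

end Batch

end AMDA

namespace AMDA

/-! ### The iterates -/

section Iterates

variable {d : ℕ}

/-- One stage of AMDA: dual averaging on the `ℓ₁` ball of radius `r` around `c`. -/
noncomputable def stage (r : ℝ) (ghat : ℕ → Vec d → Vec d) (c : Vec d) : ℕ → Vec d × Vec d :=
  dualAveraging (l1Ball c r) (fun θ => proxFun (θ - c)) (fun _ => r)
    (fun i => Real.sqrt (i + 1)) ghat c

lemma stage_zero (r : ℝ) (ghat : ℕ → Vec d → Vec d) (c : Vec d) :
    stage r ghat c 0 = (c, r • ghat 0 c) := rfl

lemma stage_succ_fst {r : ℝ} (hr : 0 < r) (ghat : ℕ → Vec d → Vec d) (c : Vec d) (t : ℕ) :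
    (stage r ghat c (t + 1)).1 = (1 - 1 / ((t : ℝ) + 2)) • (stage r ghat c t).1
      + (1 / ((t : ℝ) + 2)) • proxStep c r (Real.sqrt (t + 1)) (stage r ghat c t).2 := by
  have hw : r / ∑ _i ∈ Finset.range (t + 2), r = 1 / ((t : ℝ) + 2) := by
    rw [Finset.sum_const, Finset.card_range, nsmul_eq_mul]
    push_cast; field_simp
  rw [← hw]
  rfl

lemma stage_succ_snd (r : ℝ) (ghat : ℕ → Vec d → Vec d) (c : Vec d) (t : ℕ) :
    (stage r ghat c (t + 1)).2
      = (stage r ghat c t).2 + r • ghat (t + 1) (stage r ghat c (t + 1)).1 := rfl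

lemma stage_snd (r : ℝ) (ghat : ℕ → Vec d → Vec d) (c : Vec d) (t : ℕ) :
    (stage r ghat c t).2
      = r • ∑ i ∈ Finset.range (t + 1), ghat i (stage r ghat c i).1 := by
  induction t with
  | zero => simp [stage_zero]
  | succ t ih => rw [stage_succ_snd, ih, Finset.sum_range_succ _ (t + 1), smul_add]

/-- The centre keeps weight `1 / (t + 1)` in the average, so the iterates stay strictly inside the
ball, as `abs_meanGrad_le` requires. -/
lemma stage_mem (hd : 3 ≤ d) {r : ℝ} (hr : 0 < r) (ghat : ℕ → Vec d → Vec d) (c : Vec d) (t : ℕ) :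
    (stage r ghat c t).1 ∈ l1Ball c (r * (1 - 1 / ((t : ℝ) + 1))) := by
  induction t with
  | zero => simp [stage_zero, l1Ball, l1Norm_zero]
  | succ t ih =>
    have hm := (proxStep_spec hd c hr.le (Real.sqrt (t + 1)) (stage r ghat c t).2).1
    have hw0 : 0 ≤ 1 / ((t : ℝ) + 2) := by positivity
    have hw1 : 1 / ((t : ℝ) + 2) ≤ 1 := by
      rw [div_le_one (by positivity)]; linarith [Nat.cast_nonneg (α := ℝ) t]
    have h := l1Ball_combo ih hm hw0 hw1
    rw [stage_succ_fst hr]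
    have e : r * (1 - 1 / (((t + 1 : ℕ) : ℝ) + 1))
        = (1 - 1 / ((t : ℝ) + 2)) * (r * (1 - 1 / ((t : ℝ) + 1))) + 1 / ((t : ℝ) + 2) * r := by
      push_cast
      field_simp
      ring
    rw [e]
    exact h

lemma stage_radius_lt {r : ℝ} (hr : 0 < r) (t : ℕ) : r * (1 - 1 / ((t : ℝ) + 1)) < r := by
  have : 0 < 1 / ((t : ℝ) + 1) := by positivity
  nlinarith

/-- The iterate `t` involves only the estimators with index below `t`; this is what sample splitting
exploits. -/
lemma stage_congr {r : ℝ} (hr : 0 < r) {ghat ghat' : ℕ → Vec d → Vec d} (c : Vec d) {t : ℕ}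
    (h : ∀ i < t, ghat i = ghat' i) : (stage r ghat c t).1 = (stage r ghat' c t).1 := by
  induction t using Nat.strong_induction_on with
  | _ t ih =>
    match t with
    | 0 => rfl
    | t + 1 =>
      have hf : ∀ i ≤ t, (stage r ghat c i).1 = (stage r ghat' c i).1 := fun i hi =>
        ih i (by omega) fun j hj => h j (by omega)
      rw [stage_succ_fst hr, stage_succ_fst hr, hf t le_rfl, stage_snd, stage_snd]
      congr 4
      refine Finset.sum_congr rfl fun i hi => ?_
      rw [Finset.mem_range] at hi
      rw [hf i (by omega), h i (by omega)]

/-- The gradient query point at iteration `i` of stage `k + 1` of AMDA. -/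
noncomputable def queryPoint (T' : ℕ) (H : Vec d → Vec d) (τ Rs R : ℝ)
    (ghat : ℕ → Vec d → Vec d) (θ₀ : Vec d) (k i : ℕ) : Vec d :=
  (stage (stageRadius τ Rs R k) (fun i => ghat (k * T' + i)) (amda T' H τ Rs R ghat θ₀ k) i).1

lemma amda_succ (T' : ℕ) (H : Vec d → Vec d) (τ Rs R : ℝ) (ghat : ℕ → Vec d → Vec d)
    (θ₀ : Vec d) (k : ℕ) :
    amda T' H τ Rs R ghat θ₀ (k + 1) = H (queryPoint T' H τ Rs R ghat θ₀ k T') := rfl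

variable {T' : ℕ} {H : Vec d → Vec d} {τ Rs R : ℝ} {θ₀ : Vec d}

lemma amda_congr (hRs : 0 < Rs) (hR : Rs ≤ R) {ghat ghat' : ℕ → Vec d → Vec d} {k : ℕ}
    (h : ∀ s < k * T', ghat s = ghat' s) :
    amda T' H τ Rs R ghat θ₀ k = amda T' H τ Rs R ghat' θ₀ k := by
  induction k with
  | zero => rfl
  | succ k ih =>
    have hk : (k + 1) * T' = k * T' + T' := by ring
    rw [amda_succ, amda_succ, queryPoint, queryPoint, ih fun s hs => h s (by omega)]
    rw [stage_congr (hRs.trans_le (rStar_le_stageRadius hR k)) _ fun i hi => h _ (by omega)]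

lemma queryPoint_congr (hRs : 0 < Rs) (hR : Rs ≤ R) {ghat ghat' : ℕ → Vec d → Vec d} {k i : ℕ}
    (h : ∀ s < k * T' + i, ghat s = ghat' s) :
    queryPoint T' H τ Rs R ghat θ₀ k i = queryPoint T' H τ Rs R ghat' θ₀ k i := by
  rw [queryPoint, queryPoint, amda_congr hRs hR fun s hs => h s (by omega)]
  exact stage_congr (hRs.trans_le (rStar_le_stageRadius hR k)) _ fun j hj => h _ (by omega)

/-! ### Measurability of the iterates in the data -/

section Measurability

variable {A : Type*} [MeasurableSpace A]

/-- A family of random vector fields whose values at measurable random points are measurable. -/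
def MeasurableField (ghat : ℕ → A → Vec d → Vec d) : Prop :=
  ∀ s, ∀ θ : A → Vec d, Measurable θ → Measurable fun a => ghat s a (θ a)

lemma measurable_stage (hd : 3 ≤ d) {r : ℝ} (hr : 0 < r) {ghat : ℕ → A → Vec d → Vec d}
    (hg : MeasurableField ghat) {c : A → Vec d} (hc : Measurable c) (t : ℕ) :
    (Measurable fun a => (stage r (fun i => ghat i a) (c a) t).1)
      ∧ Measurable fun a => (stage r (fun i => ghat i a) (c a) t).2 := by
  induction t with
  | zero => exact ⟨hc, (hg 0 c hc).const_smul r⟩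
  | succ t ih =>
    have h1 : Measurable fun a => (stage r (fun i => ghat i a) (c a) (t + 1)).1 := by
      simp only [stage_succ_fst hr]
      exact (ih.1.const_smul (1 - 1 / ((t : ℝ) + 2))).add ((measurable_proxStep hd hr.le
        (Real.sqrt_pos.2 (by positivity)) hc ih.2).const_smul (1 / ((t : ℝ) + 2)))
    refine ⟨h1, ?_⟩
    simp only [stage_succ_snd]
    exact ih.2.add ((hg (t + 1) _ h1).const_smul r)

lemma measurable_amda (hd : 3 ≤ d) (hRs : 0 < Rs) (hR : Rs ≤ R) (hH : Measurable H)
    {ghat : ℕ → A → Vec d → Vec d} (hg : MeasurableField ghat) (k : ℕ) :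
    Measurable fun a => amda T' H τ Rs R (fun s => ghat s a) θ₀ k := by
  induction k with
  | zero => exact measurable_const
  | succ k ih =>
    exact hH.comp (measurable_stage hd (hRs.trans_le (rStar_le_stageRadius hR k))
      (ghat := fun i => ghat (k * T' + i)) (fun i => hg (k * T' + i)) ih T').1

lemma measurable_queryPoint (hd : 3 ≤ d) (hRs : 0 < Rs) (hR : Rs ≤ R) (hH : Measurable H)
    {ghat : ℕ → A → Vec d → Vec d} (hg : MeasurableField ghat) (k i : ℕ) :
    Measurable fun a => queryPoint T' H τ Rs R (fun s => ghat s a) θ₀ k i :=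
  (measurable_stage hd (hRs.trans_le (rStar_le_stageRadius hR k))
    (ghat := fun i => ghat (k * T' + i)) (fun i => hg (k * T' + i))
    (measurable_amda hd hRs hR hH hg k) i).1

lemma measurableField_batchGradEst {𝒴 : Set ℝ} {ℓ ℓ' : ℝ → ℝ → ℝ}
    (hloss : IsAdmissibleLoss 𝒴 ℓ ℓ') {T n : ℕ} (α : ℝ) {z : A → Fin T → Fin n → Vec d × ℝ}
    (hz : ∀ t i, Measurable fun a => z a t i) :
    MeasurableField fun s a => batchGradEst ℓ' α (z a) s := by
  intro s θ hθ
  unfold batchGradEst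
  by_cases hs : s < T
  · simp only [dif_pos hs]
    refine (WithLp.measurable_toLp 2 _).comp (measurable_pi_lambda _ fun j => ?_)
    exact (continuous_trimmedMean n α).measurable.comp (measurable_pi_lambda _ fun i =>
      measurable_gradSample_comp hloss hθ (hz ⟨s, hs⟩ i) j)
  · simp only [dif_neg hs]
    exact measurable_const

end Measurability

end Iterates

/-! ### Convergence on the good event -/

section Deterministic

variable {d : ℕ} {𝒴 : Set ℝ} {ℓ ℓ' : ℝ → ℝ → ℝ} {P : Measure (Vec d × ℝ)}

lemma stage_excess_le [IsProbabilityMeasure P] (hd : 3 ≤ d) (hloss : IsAdmissibleLoss 𝒴 ℓ ℓ')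
    (hmom : HasMoments 𝒴 P) {S : Set (Vec d)} {M : ℝ}
    (hLip : ∀ θ ∈ S, ∀ θ' ∈ S, risk ℓ P θ - risk ℓ P θ' ≤ M * l1Norm (θ - θ'))
    {c θs : Vec d} {r ε : ℝ} (hr : 0 < r) (hε : 0 ≤ ε) (hS : l1Ball c r ⊆ S)
    (hθs : θs ∈ l1Ball c r) {T : ℕ} (hT : 1 ≤ T) (hlong : nu d + M ^ 2 ≤ ε * Real.sqrt T)
    {ghat : ℕ → Vec d → Vec d}
    (hgood : ∀ i < T, ∀ j,
      |(ghat i (stage r ghat c i).1 - meanGrad ℓ' P (stage r ghat c i).1) j| ≤ ε) :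
    risk ℓ P (stage r ghat c T).1 - risk ℓ P θs ≤ 5 * r * ε := by
  set θ : ℕ → Vec d := fun i => (stage r ghat c i).1 with hθ
  set g : ℕ → Vec d := fun i => meanGrad ℓ' P (θ i) with hg
  -- The estimator at the last iterate does not influence `θ T` and is not controlled, so the exact
  -- gradient is substituted there.
  set s : ℕ → Vec d := fun i => if i < T then ghat i (θ i) else g i with hs
  have hmem : ∀ t, θ t ∈ l1Ball c r := fun t =>
    (stage_mem hd hr ghat c t).trans (stage_radius_lt hr t).le
  refine dualAveraging_convergence hd (f := risk ℓ P) (θ := θ) (g := g) (s := s) hr hε hT rfl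
    (fun t ht => ?_) (fun t _ => hmem t) (fun t _ v _ => risk_subgradient hloss hmom _ v)
    (fun t _ j => abs_meanGrad_le hloss hmom hLip hS (stage_radius_lt hr t)
      (stage_mem hd hr ghat c t) j) (fun t _ j => ?_) hθs hlong
  · have h1 : ∑ i ∈ Finset.range (t + 1), s i = ∑ i ∈ Finset.range (t + 1), ghat i (θ i) :=
      Finset.sum_congr rfl fun i hi => if_pos (by rw [Finset.mem_range] at hi; omega)
    rw [h1, ← stage_snd]
    exact stage_succ_fst hr ghat c t
  · by_cases ht : t < T
    · simp only [hs, if_pos ht]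
      exact hgood t ht j
    · simp [hs, if_neg ht, hε]

/-- The origin of the radius `3R`: the steps from `θ₀` to `θs`, to the centre and to the point each
cost at most `R`. -/
lemma l1Ball_subset_of_near {θ₀ θs c : Vec d} {r R : ℝ} (hθs : θs ∈ l1Ball θ₀ R)
    (hc : l1Norm (c - θs) ≤ r) (hr : r ≤ R) : l1Ball c r ⊆ l1Ball θ₀ (3 * R) := by
  intro θ hθ
  have h1 : l1Norm (θ - c) ≤ r := hθ
  have h2 : l1Norm (θs - θ₀) ≤ R := hθs
  have h3 := l1Norm_sub_le θ c θ₀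
  have h4 := l1Norm_sub_le c θs θ₀
  change l1Norm (θ - θ₀) ≤ 3 * R
  linarith

/-- If every queried gradient is estimated within `ε`, the stages of AMDA shrink the distance to
the optimum to `R_k`. -/
lemma amda_error_le [IsProbabilityMeasure P] (hd : 3 ≤ d) (hloss : IsAdmissibleLoss 𝒴 ℓ ℓ')
    (hmom : HasMoments 𝒴 P) {θ₀ θs : Vec d} {R M κ lam ε : ℝ} (hθs : θs ∈ l1Ball θ₀ R)
    {sbar : ℕ} (hsbar : 1 ≤ sbar) (hsparse : nnz θs ≤ sbar)
    (hLip : ∀ θ ∈ l1Ball θ₀ (3 * R), ∀ θ' ∈ l1Ball θ₀ (3 * R),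
      risk ℓ P θ - risk ℓ P θ' ≤ M * l1Norm (θ - θ'))
    (hκ : 0 < κ) (hlam : 0 < lam)
    (hgrowth : ∀ θ ∈ l1Ball θ₀ (3 * R),
      κ * ‖θ - θs‖ ^ 2 / (lam + ‖θ - θs‖) ≤ risk ℓ P θ - risk ℓ P θs)
    (hε : 0 < ε) {T' : ℕ} (hT : 1 ≤ T') (hlong : nu d + M ^ 2 ≤ ε * Real.sqrt T')
    {τ Rs : ℝ} (hτ : τ = tauConst sbar κ ε) (hτ1 : τ < 1) (hRs : Rs = rStar sbar κ lam ε)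
    (hRsR : Rs ≤ R) (hRs0 : 0 < Rs) {H : Vec d → Vec d} (hH : IsSparsifier sbar H)
    {ghat : ℕ → Vec d → Vec d} {K : ℕ}
    (hgood : ∀ k < K, ∀ i < T', queryPoint T' H τ Rs R ghat θ₀ k i ∈ l1Ball θ₀ (3 * R) →
      ∀ j, |(ghat (k * T' + i) (queryPoint T' H τ Rs R ghat θ₀ k i)
        - meanGrad ℓ' P (queryPoint T' H τ Rs R ghat θ₀ k i)) j| ≤ ε) :
    ∀ k ≤ K, l1Norm (amda T' H τ Rs R ghat θ₀ k - θs) ≤ stageRadius τ Rs R k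
      ∧ (1 ≤ k → Real.sqrt (2 * sbar) * ‖amda T' H τ Rs R ghat θ₀ k - θs‖
        ≤ stageRadius τ Rs R k) := by
  intro k
  induction k with
  | zero =>
    intro _
    -- The `ℓ₂` bound is claimed only from the first stage on: `θ₀` need not be sparse.
    refine ⟨?_, fun h => absurd h (by norm_num)⟩
    rw [l1Norm_sub_comm]
    exact hθs
  | succ k ih =>
    intro hk
    have hk1 := (ih (by omega)).1
    set r := stageRadius τ Rs R k with hr
    set c := amda T' H τ Rs R ghat θ₀ k with hc
    have hr0 : 0 < r := hRs0.trans_le (rStar_le_stageRadius hRsR k)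
    have hS : l1Ball c r ⊆ l1Ball θ₀ (3 * R) :=
      l1Ball_subset_of_near hθs hk1 (stageRadius_le hτ1 hRs0 hRsR k)
    have hmem : ∀ i, queryPoint T' H τ Rs R ghat θ₀ k i ∈ l1Ball θ₀ (3 * R) := fun i =>
      hS ((stage_mem hd hr0 (fun i => ghat (k * T' + i)) c i).trans (stage_radius_lt hr0 i).le)
    have hθc : θs ∈ l1Ball c r := by
      change l1Norm (θs - c) ≤ r
      rw [l1Norm_sub_comm]; exact hk1
    have hex := stage_excess_le hd hloss hmom hLip hr0 hε.le hS hθc hT hlong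
      (ghat := fun i => ghat (k * T' + i)) fun i hi j => hgood k (by omega) i hi (hmem i) j
    have hl2 : Real.sqrt (2 * sbar) * ‖amda T' H τ Rs R ghat θ₀ (k + 1) - θs‖
        ≤ stageRadius τ Rs R (k + 1) := by
      have := hH.norm_sub_le_of_excess hsbar hsparse hκ hlam hε hr0 (hgrowth _ (hmem T')) hex
      rw [← hτ, ← hRs] at this
      exact this
    exact ⟨(hH.l1Norm_sub_le hsparse).trans hl2, fun _ => hl2⟩

end Deterministic

end AMDA

namespace AMDA

/-! ### The good event -/

section GoodEvent

variable {d n K T' : ℕ} {𝒴 : Set ℝ} {ℓ ℓ' : ℝ → ℝ → ℝ} {P : Measure (Vec d × ℝ)}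
  {Ω : Type*} [MeasurableSpace Ω] {μ : Measure Ω} [IsProbabilityMeasure μ]
  {H : Vec d → Vec d} {τ Rs R α ε : ℝ} {θ₀ : Vec d}

/-- The data of the batches before `t`, completed by zeros. -/
noncomputable def extendPast {T : ℕ} (t : Fin T)
    (w : {p : Fin T × Fin n // p.1 < t} → Vec d × ℝ) : Fin T → Fin n → Vec d × ℝ :=
  fun s i => if h : s < t then w ⟨(s, i), h⟩ else 0

lemma measurable_extendPast {T : ℕ} (t s : Fin T) (i : Fin n) :
    Measurable fun w : {p : Fin T × Fin n // p.1 < t} → Vec d × ℝ => extendPast t w s i := by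
  unfold extendPast
  by_cases h : s < t
  · simp only [dif_pos h]; exact measurable_pi_apply _
  · simp only [dif_neg h]; exact measurable_const

lemma batchGradEst_extendPast {T : ℕ} (t : Fin T) (z : Fin T → Fin n → Vec d × ℝ) {s : ℕ}
    (hs : s < t) : batchGradEst ℓ' α (extendPast t fun p => z p.1.1 p.1.2) s
      = batchGradEst ℓ' α z s := by
  have hsT : s < T := hs.trans t.2
  funext θ
  unfold batchGradEst
  rw [dif_pos hsT, dif_pos hsT]
  congr 1
  funext i
  exact dif_pos (show (⟨s, hsT⟩ : Fin T) < t from hs)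

/-- With probability at least `1 - δ`, all gradients queried inside `S` are estimated
within `ε`. -/
lemma prob_some_estimator_error_le [IsProbabilityMeasure P] (hd : 3 ≤ d)
    (hloss : IsAdmissibleLoss 𝒴 ℓ ℓ') (hmom : HasMoments 𝒴 P) {σ η δ δt : ℝ}
    (hn0 : 0 < n) (hn : Even n) (hσ : 0 < σ) (hη : 0 ≤ η) (hδ : 0 < δ) (hδ1 : δ < 1)
    (hKT : 1 ≤ K * T') (hδt : δt = δ / ((K * T' : ℕ) : ℝ))
    (hα : α = trimLevel η δt d n) (hα2 : α < 1 / 2) (hε : ε = 7 * σ * statRate η δt d n)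
    {S : Set (Vec d)} (hS : MeasurableSet S)
    (hvar : ∀ θ ∈ S, ∀ j, variance (fun z => gradSample ℓ' θ z j) P ≤ σ ^ 2)
    {O : Finset (Fin (K * T') × Fin n)} {Z : Fin (K * T') → Fin n → Ω → Vec d × ℝ}
    (hZ : IsCorruptedSample μ P η O Z) (hRs : 0 < Rs) (hR : Rs ≤ R) (hH : Measurable H) :
    μ {ω | ∃ k < K, ∃ i < T',
      queryPoint T' H τ Rs R (batchGradEst ℓ' α fun t i => Z t i ω) θ₀ k i ∈ S ∧ ∃ j,
        ε < |(batchGradEst ℓ' α (fun t i => Z t i ω) (k * T' + i)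
            (queryPoint T' H τ Rs R (batchGradEst ℓ' α fun t i => Z t i ω) θ₀ k i)
          - meanGrad ℓ' P
            (queryPoint T' H τ Rs R (batchGradEst ℓ' α fun t i => Z t i ω) θ₀ k i)) j|}
      ≤ ENNReal.ofReal δ := by
  have hKT' : (1 : ℝ) ≤ ((K * T' : ℕ) : ℝ) := by exact_mod_cast hKT
  have hKT0 : (0 : ℝ) < ((K * T' : ℕ) : ℝ) := by linarith
  have hδt0 : 0 < δt := by rw [hδt]; exact div_pos hδ hKT0
  have hδt1 : δt ≤ 1 := by rw [hδt, div_le_one hKT0]; linarith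
  -- Padding the missing batches by zeros makes the query point a function of the past alone.
  -- Division by `T'` recovers stage and iteration from `t`.
  set F : (t : Fin (K * T')) → ({p : Fin (K * T') × Fin n // p.1 < t} → Vec d × ℝ) → Vec d :=
    fun t w => queryPoint T' H τ Rs R (batchGradEst ℓ' α (extendPast t w)) θ₀
      (t.val / T') (t.val % T') with hF
  have hFm : ∀ t, Measurable (F t) := fun t =>
    measurable_queryPoint hd hRs hR hH (measurableField_batchGradEst hloss α
      fun s i => measurable_extendPast t s i) _ _
  have hFeq : ∀ (t : Fin (K * T')) ω, F t (fun p => Z p.1.1 p.1.2 ω)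
      = queryPoint T' H τ Rs R (batchGradEst ℓ' α fun t i => Z t i ω) θ₀
        (t.val / T') (t.val % T') := fun t ω => by
    refine queryPoint_congr hRs hR fun s hs => ?_
    rw [Nat.div_add_mod'] at hs
    exact batchGradEst_extendPast t (fun t i => Z t i ω) hs
  set Bad : Fin (K * T') → Set Ω := fun t => {ω | F t (fun p => Z p.1.1 p.1.2 ω) ∈ S ∧ ∃ j,
    ε < |gradEst ℓ' α (fun i => Z t i ω) (F t fun p => Z p.1.1 p.1.2 ω) j
      - meanGrad ℓ' P (F t fun p => Z p.1.1 p.1.2 ω) j|} with hBad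
  have hprob : ∀ t, μ (Bad t) ≤ ENNReal.ofReal δt := fun t =>
    prob_estimator_error_le hd hloss hmom hn0 hn hσ hη hδt0 hδt1 hα hα2 hε hS hvar hZ t (hFm t)
  refine (measure_mono (t := ⋃ t, Bad t) ?_).trans ?_
  · rintro ω ⟨k, hk, i, hi, hmem, j, hj⟩
    have ht : k * T' + i < K * T' := by
      calc k * T' + i < (k + 1) * T' := by rw [add_mul, one_mul]; omega
        _ ≤ K * T' := Nat.mul_le_mul_right _ hk
    have e1 : (k * T' + i) / T' = k := by
      rw [mul_comm, Nat.mul_add_div (by omega), Nat.div_eq_of_lt hi, add_zero]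
    have e2 : (k * T' + i) % T' = i := by
      rw [mul_comm, Nat.mul_add_mod, Nat.mod_eq_of_lt hi]
    have hq := hFeq ⟨k * T' + i, ht⟩ ω
    simp only [e1, e2] at hq
    rw [← hq] at hmem hj
    refine Set.mem_iUnion.2 ⟨⟨k * T' + i, ht⟩, hmem, j, ?_⟩
    have hb : batchGradEst ℓ' α (fun t i => Z t i ω) (k * T' + i)
        = gradEst ℓ' α fun i' => Z ⟨k * T' + i, ht⟩ i' ω := by
      funext θ
      exact dif_pos ht
    rw [hb] at hj
    exact hj
  · refine (measure_iUnion_fintype_le μ Bad).trans ((Finset.sum_le_sum fun t _ => hprob t).trans ?_)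
    rw [Finset.sum_const, Finset.card_univ, Fintype.card_fin, nsmul_eq_mul,
      ← ENNReal.ofReal_natCast, ← ENNReal.ofReal_mul (by positivity), hδt,
      mul_div_cancel₀ _ hKT0.ne']

end GoodEvent

lemma statRate_pos {η δt : ℝ} {d n : ℕ} (hd : 3 ≤ d) (hn0 : 0 < n) (hη : 0 ≤ η) (hδt0 : 0 ≤ δt)
    (hδt1 : δt ≤ 1) : 0 < statRate η δt d n := by
  have hlogd := one_lt_log_of_three_le hd
  have hlog : 0 ≤ Real.log (4 / δt) := by
    -- For `δt = 0` the conventions `4 / 0 = 0` and `log 0 = 0` apply. The case must be covered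
    -- because `T' ≥ 1` is itself deduced from `ε > 0`.
    rcases hδt0.eq_or_lt with h | h
    · simp [← h]
    · exact Real.log_nonneg (by rw [le_div_iff₀ h]; linarith)
  have hn' : (0 : ℝ) < n := by exact_mod_cast hn0
  unfold statRate
  positivity

end AMDA

/-! ### Assembly of the main theorem -/

theorem mainTheorem11
    {Ω : Type*} [MeasurableSpace Ω] (μ : Measure Ω) [IsProbabilityMeasure μ]
    -- dimension, law of the data, label set, loss
    (d : ℕ) (hd : 3 ≤ d)
    (P : Measure (AMDA.Vec d × ℝ)) [IsProbabilityMeasure P]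
    (𝒴 : Set ℝ) (ℓ ℓ' : ℝ → ℝ → ℝ)
    (hloss : AMDA.IsAdmissibleLoss 𝒴 ℓ ℓ') (hmom : AMDA.HasMoments 𝒴 P)
    -- starting point, radius, sparse optimum
    (θ₀ θstar : AMDA.Vec d) (R : ℝ) (hR : 0 < R) (hθstar : θstar ∈ AMDA.l1Ball θ₀ R)
    (sbar : ℕ) (hsbar : 1 ≤ sbar) (hsparse : AMDA.nnz θstar ≤ sbar)
    (hmin : ∀ θ ∈ AMDA.l1Ball θ₀ (3 * R), AMDA.risk ℓ P θstar ≤ AMDA.risk ℓ P θ)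
    -- Lipschitz objective
    (M : ℝ) (hM : 0 < M)
    (hLip : ∀ θ ∈ AMDA.l1Ball θ₀ (3 * R), ∀ θ' ∈ AMDA.l1Ball θ₀ (3 * R),
      AMDA.risk ℓ P θ - AMDA.risk ℓ P θ' ≤ M * AMDA.l1Norm (θ - θ'))
    -- pseudo-linear growth
    (κ lam : ℝ) (hκ : 0 < κ) (hlam : 0 < lam)
    (hgrowth : ∀ θ ∈ AMDA.l1Ball θ₀ (3 * R),
      κ * ‖θ - θstar‖ ^ 2 / (lam + ‖θ - θstar‖) ≤ AMDA.risk ℓ P θ - AMDA.risk ℓ P θstar)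
    -- maximal standard deviation
    (σ : ℝ) (hσ : σ = AMDA.sigmaMax ℓ' P (AMDA.l1Ball θ₀ (3 * R))) (hσpos : 0 < σ)
    -- `K` stages of `T'` iterations, confidence level, corruption rate, batch size
    (K T' : ℕ) (hK : 1 ≤ K)
    (δ η : ℝ) (hδ : 0 < δ) (hδ1 : δ < 1) (hη : 0 ≤ η)
    (nt : ℕ) (hnt : 0 < nt) (hnteven : Even nt)
    (δt : ℝ) (hδt : δt = δ / ((K * T' : ℕ) : ℝ))
    -- trimming level, gradient error bound, and derived constants
    (α : ℝ) (hα : α = AMDA.trimLevel η δt d nt) (hαhalf : α < 1 / 2)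
    (ε : ℝ) (hε : ε = 7 * σ * AMDA.statRate η δt d nt)
    (hT' : ⌈((AMDA.nu d + M ^ 2) / ε) ^ 2⌉₊ ≤ T')
    (τ : ℝ) (hτ : τ = AMDA.tauConst sbar κ ε) (hτ1 : τ < 1)
    (Rstar : ℝ) (hRstar : Rstar = AMDA.rStar sbar κ lam ε) (hRstarR : Rstar ≤ R)
    -- sparsification operator and data
    (H : AMDA.Vec d → AMDA.Vec d) (hH : AMDA.IsSparsifier sbar H)
    (O : Finset (Fin (K * T') × Fin nt))
    (Z : Fin (K * T') → Fin nt → Ω → AMDA.Vec d × ℝ)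
    (hZ : AMDA.IsCorruptedSample μ P η O Z) :
    ∃ K₁ : ℕ,
      IsLeast {k : ℕ | τ * AMDA.stageRadius τ Rstar R k
        ≤ 1 / 2 * (AMDA.stageRadius τ Rstar R k + Rstar)} K₁ ∧
      (K₁ : ℝ) ≤ Real.log (κ * R / (80 * lam * sbar * ε)) / Real.log (1 / τ) ∧
      ENNReal.ofReal (1 - δ) ≤ μ {ω |
        ‖AMDA.amda T' H τ Rstar R
            (AMDA.batchGradEst ℓ' α fun t i => Z t i ω) θ₀ K - θstar‖
          ≤ τ ^ (min K K₁) * (2 : ℝ) ^ (min ((K₁ : ℤ) - (K : ℤ)) 0) * (R / Real.sqrt (2 * sbar))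
            + 280 * lam * Real.sqrt (2 * sbar) * σ / κ * AMDA.statRate η δt d nt} := by
  have hδt0 : 0 ≤ δt := by rw [hδt]; positivity
  have hδt1 : δt ≤ 1 := by
    rw [hδt]
    rcases Nat.eq_zero_or_pos (K * T') with h | h
    · simp [h]
    · have : (1 : ℝ) ≤ ((K * T' : ℕ) : ℝ) := by exact_mod_cast h
      exact (div_le_one (by linarith)).2 (by linarith)
  have hrate := AMDA.statRate_pos hd hnt hη hδt0 hδt1
  have hε0 : 0 < ε := by rw [hε]; positivity
  have hν : 0 < AMDA.nu d := by
    have := AMDA.one_lt_log_of_three_le hd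
    unfold AMDA.nu; positivity
  have hratio : 0 < (AMDA.nu d + M ^ 2) / ε := by positivity
  have hT1 : 1 ≤ T' := le_trans (Nat.ceil_pos.2 (by positivity)) hT'
  have hlong : AMDA.nu d + M ^ 2 ≤ ε * Real.sqrt T' := by
    have h1 : ((AMDA.nu d + M ^ 2) / ε) ^ 2 ≤ T' := (Nat.le_ceil _).trans (by exact_mod_cast hT')
    have h2 := Real.le_sqrt_of_sq_le h1
    rw [div_le_iff₀ hε0] at h2
    linarith
  have hs : (1 : ℝ) ≤ sbar := by exact_mod_cast hsbar
  have hτ0 : 0 < τ := by rw [hτ]; unfold AMDA.tauConst; positivity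
  have hRs0 : 0 < Rstar := by rw [hRstar]; unfold AMDA.rStar; positivity
  classical
  have hex := AMDA.exists_stageRadius_turn hτ1 hRs0 hRstarR
  have hleast : IsLeast {k : ℕ | τ * AMDA.stageRadius τ Rstar R k
      ≤ 1 / 2 * (AMDA.stageRadius τ Rstar R k + Rstar)} (Nat.find hex) :=
    ⟨Nat.find_spec hex, fun _ hk => Nat.find_min' hex hk⟩
  refine ⟨Nat.find hex, hleast, ?_, ?_⟩
  · have h := AMDA.turn_le_log_div_log hτ0 hτ1 hRs0 hRstarR hleast
    have e : R / Rstar = κ * R / (80 * lam * sbar * ε) := by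
      rw [hRstar, AMDA.rStar]; field_simp
    rwa [e] at h
  have hvar : ∀ θ ∈ AMDA.l1Ball θ₀ (3 * R), ∀ j,
      variance (fun z => AMDA.gradSample ℓ' θ z j) P ≤ σ ^ 2 := fun θ hθ j => by
    rw [hσ] at hσpos ⊢
    exact AMDA.variance_le_sigmaMax_sq hσpos hθ j
  have hbad := AMDA.prob_some_estimator_error_le (τ := τ) (θ₀ := θ₀) hd hloss hmom hnt hnteven
    hσpos hη hδ hδ1 (Nat.mul_pos hK hT1) hδt hα hαhalf hε (AMDA.measurableSet_l1Ball θ₀ (3 * R))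
    hvar hZ hRs0 hRstarR hH.measurable
  set Bad := {ω | ∃ k < K, ∃ i < T',
      AMDA.queryPoint T' H τ Rstar R (AMDA.batchGradEst ℓ' α fun t i => Z t i ω) θ₀ k i
        ∈ AMDA.l1Ball θ₀ (3 * R) ∧ ∃ j,
        ε < |(AMDA.batchGradEst ℓ' α (fun t i => Z t i ω) (k * T' + i)
            (AMDA.queryPoint T' H τ Rstar R (AMDA.batchGradEst ℓ' α fun t i => Z t i ω) θ₀ k i)
          - AMDA.meanGrad ℓ' P
            (AMDA.queryPoint T' H τ Rstar R
              (AMDA.batchGradEst ℓ' α fun t i => Z t i ω) θ₀ k i)) j|}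
  set Good := {ω | ‖AMDA.amda T' H τ Rstar R
            (AMDA.batchGradEst ℓ' α fun t i => Z t i ω) θ₀ K - θstar‖
          ≤ τ ^ (min K (Nat.find hex)) * (2 : ℝ) ^ (min ((Nat.find hex : ℤ) - (K : ℤ)) 0)
              * (R / Real.sqrt (2 * sbar))
            + 280 * lam * Real.sqrt (2 * sbar) * σ / κ * AMDA.statRate η δt d nt}
  -- Only subadditivity of `μ` is used on this cover, so neither set has to be shown measurable.
  have hcover : (Set.univ : Set Ω) ⊆ Good ∪ Bad := by
    intro ω _
    by_cases hω : ω ∈ Bad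
    · exact Or.inr hω
    refine Or.inl ?_
    have hgood : ∀ k < K, ∀ i < T',
        AMDA.queryPoint T' H τ Rstar R (AMDA.batchGradEst ℓ' α fun t i => Z t i ω) θ₀ k i
          ∈ AMDA.l1Ball θ₀ (3 * R) → ∀ j,
        |(AMDA.batchGradEst ℓ' α (fun t i => Z t i ω) (k * T' + i)
            (AMDA.queryPoint T' H τ Rstar R (AMDA.batchGradEst ℓ' α fun t i => Z t i ω) θ₀ k i)
          - AMDA.meanGrad ℓ' P
            (AMDA.queryPoint T' H τ Rstar R
              (AMDA.batchGradEst ℓ' α fun t i => Z t i ω) θ₀ k i)) j| ≤ ε := by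
      intro k hk i hi hmem j
      by_contra hcon
      exact hω ⟨k, hk, i, hi, hmem, j, not_le.1 hcon⟩
    have herr := (AMDA.amda_error_le hd hloss hmom hθstar hsbar hsparse hLip hκ hlam hgrowth hε0
      hT1 hlong hτ hτ1 hRstar hRstarR hRs0 hH hgood K le_rfl).2 hK
    have hrad := AMDA.stageRadius_bound hτ1 hRs0 hRstarR hleast K
    have hq : 0 < Real.sqrt (2 * sbar) := Real.sqrt_pos.2 (by positivity)
    have hq2 : Real.sqrt (2 * sbar) ^ 2 = 2 * sbar := Real.sq_sqrt (by positivity)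
    -- The constant is `80 * 7 / 2 = 280`, from `R⋆ = 80 λ sbar ε / κ`, `ε = 7σ · statRate` and
    -- `sbar = √(2 sbar)² / 2`.
    have hRsq : Rstar / Real.sqrt (2 * sbar)
        = 280 * lam * Real.sqrt (2 * sbar) * σ / κ * AMDA.statRate η δt d nt := by
      rw [div_eq_iff hq.ne', hRstar, AMDA.rStar, hε]
      calc _ = 280 * lam * (2 * sbar) * σ / κ * AMDA.statRate η δt d nt := by ring
        _ = 280 * lam * Real.sqrt (2 * sbar) ^ 2 * σ / κ * AMDA.statRate η δt d nt := by rw [hq2]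
        _ = _ := by ring
    change ‖_‖ ≤ _
    rw [← hRsq, ← mul_div_assoc, ← add_div, le_div_iff₀ hq]
    linarith
  have h1 : (1 : ENNReal) ≤ μ Good + ENNReal.ofReal δ := by
    calc (1 : ENNReal) = μ Set.univ := measure_univ.symm
      _ ≤ μ (Good ∪ Bad) := measure_mono hcover
      _ ≤ μ Good + μ Bad := measure_union_le _ _
      _ ≤ _ := add_le_add_right hbad _
  rw [ENNReal.ofReal_sub _ hδ.le, ENNReal.ofReal_one]
  exact tsub_le_iff_right.2 h1
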